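/- **Theorem (well-posedness of the fractional Schrödinger equation with a nonlinear delta interaction).** Let $s\in(\tfrac12,1]$, $\sigma>0$, $\beta\in\mathbb R$. Write $\widehat u(k)=(2\pi)^{-1/2}\int e^{-ikx}u(x)\,dx$, let $(-\Delta)^s$ be the Fourier multiplier $|k|^{2s}$, let $\mathcal U_s(t)$ be the Fourier multiplier $e^{-i|k|^{2s}t}$, whose convolution kernel $\mathcal U_s(t,\cdot)$ has Fourier transform $(2\pi)^{-1/2}e^{-i|k|^{2s}t}$, and for $\lambda>0$ let $\mathcal G^\lambda\in L^2(\mathbb R)$ be the Green's function, $\widehat{\mathcal G^\lambda}(k)=(2\pi)^{-1/2}(|k|^{2s}+\lambda)^{-1}$. For $\psi\in H^s(\mathbb R)$, $\psi(0)$ denotes the value of the continuous representative. The nonlinear operator $\mathcal H$ has domain $$\mathcal D=\{\psi\in H^s(\mathbb R):\ \psi=\phi_\lambda-\beta|\psi(0)|^{2\sigma}\psi(0)\,\mathcal G^\lambda,\ \phi_\lambda\in H^{2s}(\mathbb R),\ \lambda>0\}$$ and action $(\mathcal H+\lambda)\psi=((-\Delta)^s+\lambda)\phi_\lambda$ (both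 independent of $\lambda>0$); $\phi_\lambda$ is called the regular part of $\psi$, and $\mathcal D$ carries the graph distance $\|\psi-\chi\|_{L^2}+\|\mathcal H\psi-\mathcal H\chi\|_{L^2}$. Let $a(s)=\frac1{2\pi}\int_{\mathbb R}e^{-i|\rho|^{2s}}d\rho$, a convergent improper integral. For $\psi_0\in\mathcal D$ consider the charge equation $$q(t)+i\,a(s)\beta\int_0^t\frac{|q(\tau)|^{2\sigma}q(\tau)}{(t-\tau)^{1/(2s)}}\,d\tau=(\mathcal U_s(t)\psi_0)(0),\tag{1}$$ the Duhamel formula $$\psi(t,\cdot)=\mathcal U_s(t)\psi_0-i\beta\int_0^t\mathcal U_s(t-\tau,\cdot)\,|q(\tau)|^{2\sigma}q(\tau)\,d\tau,\tag{2}$$ understood through its Fourier transform in the space variable, and the Cauchy problem $$i\,\partial_t\psi=\mathcal H\psi\ \text{ in }L^2(\mathbb R),\qquad \psi(0,\cdot)=\psi_0.\tag{3}$$ A strong solution on $[0,T]$ is a $\psi\in C^0([0,T];\mathcal D)\cap C^1([0,T];L^2(\mathbb R))$ that satisfies (3) at every $t\in[0,T]$. Say that $(q,\psi)$ *solves the problem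 on* $[0,T]$ if $q$ is the unique continuous solution of (1) on $[0,T]$, $\psi$ is given by (2), $\psi$ is the unique strong solution on $[0,T]$, and $\psi(t,0)=q(t)$ for all $t\in[0,T]$. Put $$M(\psi)=\|\psi\|_{L^2},\qquad E(\psi)=\int_{\mathbb R}|k|^{2s}|\widehat\psi(k)|^2dk+\frac{\beta}{\sigma+1}|\psi(0)|^{2\sigma+2}.$$ 1. *(Local well-posedness)* For every $\psi_0\in\mathcal D$ there are $T>0$ and a pair $(q,\psi)$ that solves the problem on $[0,T]$. Moreover, whenever $T>0$ and $q$ is a continuous solution of (1) on $[0,T]$, there is a $\psi$ such that $(q,\psi)$ solves the problem on $[0,T]$. 2. *(Conservation laws)* For every $\psi_0\in\mathcal D$, every $T>0$ and every strong solution $\psi$ on $[0,T]$, $M(\psi(t))=M(\psi_0)$ and $E(\psi(t))=E(\psi_0)$ for all $t\in[0,T]$. 3. *(Global well-posedness)* If $\beta\ge0$, or if $\beta<0$ and $\sigma<2s-1$, then for every $\psi_0\in\mathcal D$ there is a pair $(q,\psi)$ on $[0,\infty)$ that solves the problem on $[0,T]$ for every $T>0$. If $\beta<0$ and $\sigma=2s-1$,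 there is a constant $C=C(s,\beta)>0$ such that the same holds for every $\psi_0\in\mathcal D$ with $\|\psi_0\|_{L^2}<C$. 4. *(Blow-up)* Let $\beta<0$ and $\sigma\ge 2s-1$, and let $\psi_0\in\mathcal D$ have regular part $\phi_\lambda\in\mathcal S(\mathbb R)$ for some $\lambda>0$ and $E(\psi_0)<0$. Then there are a finite $T^*>0$ and a pair $(q,\psi)$ on $[0,T^*)$ that solves the problem on $[0,T]$ for every $T\in(0,T^*)$, with $\limsup_{t\uparrow T^*}|q(t)|=+\infty$. -/

import Mathlib

open MeasureTheory FourierTransform Filter Topology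
open scoped SchwartzMap ENNReal ContDiff

noncomputable section

namespace FracDelta

/-- The space `L²(ℝ; ℂ)`. -/
abbrev L2 : Type := Lp ℂ 2 (volume : Measure ℝ)

/-- The symbol `|k|^{2s}` of `(-Δ)^s`, in Mathlib's frequency variable `ξ`, where `k = 2πξ`. -/
def symb (s ξ : ℝ) : ℝ := |2 * Real.pi * ξ| ^ (2 * s)

/-- The Fourier multiplier with symbol `m`, on its maximal domain in `L²`
(and `0` outside that domain). -/
def fourierMul (m : ℝ → ℂ) (u : L2) : L2 :=
  open Classical in
  if h : MemLp (fun ξ => m ξ * (𝓕 u : L2) ξ) 2 (volume : Measure ℝ) then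
    𝓕⁻ (h.toLp _ : L2)
  else 0

/-- The fractional Laplacian `(-Δ)^s` in `L²`, with domain `H^{2s}`. -/
def fracLaplacian (s : ℝ) (u : L2) : L2 := fourierMul (fun ξ => (symb s ξ : ℂ)) u

/-- The free propagator `U_s(t)`, multiplication by `e^{-i|k|^{2s}t}` on the Fourier side. -/
def propagator (s t : ℝ) (u : L2) : L2 :=
  fourierMul (fun ξ => Complex.exp (-Complex.I * (symb s ξ : ℂ) * (t : ℂ))) u

/-- The Fourier transform of the Green's function. With `𝓕 u(ξ) = ∫ e^{-2πixξ} u(x) dx`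
one has `𝓕 δ = 1`, so no constant appears. -/
def greenHat (s lam ξ : ℝ) : ℂ := ((symb s ξ + lam)⁻¹ : ℝ)

/-- The Green's function of `(-Δ)^s + lam`, the element of `L²` with Fourier transform
`greenHat s lam` (see `fourier_green`). -/
def green (s lam : ℝ) : L2 :=
  open Classical in
  if h : MemLp (greenHat s lam) 2 (volume : Measure ℝ) then 𝓕⁻ (h.toLp _ : L2) else 0

/-- The value at `x` of the continuous representative of `u`
(and `0` if there is no continuous representative). -/
def value (u : L2) (x : ℝ) : ℂ :=
  open Classical in
  if h : ∃ g : ℝ → ℂ, Continuous g ∧ u =ᵐ[volume] g then h.choose x else 0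

/-- The nonlinearity `β |z|^{2σ} z`. -/
def nonlin (σ β : ℝ) (z : ℂ) : ℂ := (β : ℂ) * ((‖z‖ ^ (2 * σ) : ℝ) : ℂ) * z

/-- The regular part `φ_lam = ψ + β|ψ(0)|^{2σ}ψ(0) G^lam`. -/
def regularPart (s σ β lam : ℝ) (ψ : L2) : L2 :=
  ψ + nonlin σ β (value ψ 0) • green s lam

/-- The domain of the nonlinear operator: all `ψ ∈ H^s` of the form
`ψ = φ_lam - β|ψ(0)|^{2σ}ψ(0) G^lam` with `φ_lam ∈ H^{2s}` and `lam > 0`. -/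
def domain (s σ β : ℝ) : Set L2 :=
  {ψ | TemperedDistribution.MemSobolev s 2 (ψ : 𝓢'(ℝ, ℂ)) ∧
    ∃ lam : ℝ, 0 < lam ∧
      TemperedDistribution.MemSobolev (2 * s) 2 (regularPart s σ β lam ψ : 𝓢'(ℝ, ℂ))}

/-- The nonlinear operator `H`, defined on `domain s σ β` by
`(H + lam) ψ = ((-Δ)^s + lam) φ_lam`, here with `lam = 1`; by `opH_add_smul` this identity
then holds for every `lam > 0`. -/
def opH (s σ β : ℝ) (ψ : L2) : L2 :=
  fracLaplacian s (regularPart s σ β 1 ψ) + regularPart s σ β 1 ψ - ψ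

/-- The mass `M(ψ) = ‖ψ‖`. -/
def mass (ψ : L2) : ℝ := ‖ψ‖

/-- The energy `E(ψ) = [ψ]²_{Ḣ^s} + β/(σ+1) |ψ(0)|^{2σ+2}`, where
`[ψ]²_{Ḣ^s} = ∫ |k|^{2s} |ψ̂(k)|² dk` with the unitary Fourier transform `ψ̂`. -/
def energy (s σ β : ℝ) (ψ : L2) : ℝ :=
  (∫ ξ : ℝ, symb s ξ * ‖(𝓕 ψ : L2) ξ‖ ^ 2) + β / (σ + 1) * ‖value ψ 0‖ ^ (2 * σ + 2)

/-- The truncated integral `(2π)⁻¹ ∫_{-R}^R e^{-i|ρ|^{2s}} dρ`. -/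
def kernelTrunc (s R : ℝ) : ℂ :=
  ((2 * Real.pi)⁻¹ : ℂ) * ∫ ρ in (-R)..R, Complex.exp (-Complex.I * ((|ρ| ^ (2 * s) : ℝ) : ℂ))

/-- The constant `a(s) = U_s(1,0) = (2π)⁻¹ ∫ e^{-i|ρ|^{2s}} dρ`, an improper (conditionally
convergent) integral. -/
def kernelConst (s : ℝ) : ℂ := limUnder atTop (kernelTrunc s)

/-- `q` is a continuous solution on `[0,T]` of the charge equation
`q(t) + i a(s) β ∫₀ᵗ |q(τ)|^{2σ} q(τ) (t-τ)^{-1/(2s)} dτ = (U_s(t)ψ₀)(0)`. -/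
structure IsChargeSolution (s σ β T : ℝ) (ψ₀ : L2) (q : ℝ → ℂ) : Prop where
  continuousOn : ContinuousOn q (Set.Icc 0 T)
  eqn : ∀ t ∈ Set.Icc 0 T,
    q t + Complex.I * kernelConst s *
        ∫ τ in (0 : ℝ)..t, nonlin σ β (q τ) / (((t - τ) ^ (1 / (2 * s)) : ℝ) : ℂ) =
      value (propagator s t ψ₀) 0

/-- `ψ` is given on `[0,T]` by the Duhamel formula
`ψ(t) = U_s(t)ψ₀ - i ∫₀ᵗ U_s(t-τ,·) β|q(τ)|^{2σ}q(τ) dτ`.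
The kernel `U_s(t,·)` is the tempered distribution with Fourier transform `e^{-i|k|^{2s}t}`
(normalised so that `δ` has Fourier transform `1`), and the formula is written on the Fourier
side, where the integral converges absolutely. -/
def IsDuhamel (s σ β T : ℝ) (ψ₀ : L2) (q : ℝ → ℂ) (ψ : ℝ → L2) : Prop :=
  ∀ t ∈ Set.Icc 0 T, ∀ᵐ ξ : ℝ,
    (𝓕 (ψ t) : L2) ξ = (𝓕 (propagator s t ψ₀) : L2) ξ -
      Complex.I * ∫ τ in (0 : ℝ)..t,
        Complex.exp (-Complex.I * (symb s ξ : ℂ) * ((t - τ : ℝ) : ℂ)) * nonlin σ β (q τ)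

/-- `ψ` is a strong solution on `[0,T]` of `i ∂ₜψ = Hψ`, `ψ(0) = ψ₀`, in the class
`C⁰([0,T]; D) ∩ C¹([0,T]; L²)`: the equation holds in `L²` at every time (one-sided derivatives
at the end points), and continuity into `D` is with respect to the graph distance
`‖ψ - χ‖ + ‖Hψ - Hχ‖`. -/
structure IsStrongSolution (s σ β T : ℝ) (ψ₀ : L2) (ψ : ℝ → L2) : Prop where
  initial : ψ 0 = ψ₀
  mem_domain : ∀ t ∈ Set.Icc 0 T, ψ t ∈ domain s σ β
  continuousOn : ContinuousOn ψ (Set.Icc 0 T)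
  continuousOn_opH : ContinuousOn (fun t => opH s σ β (ψ t)) (Set.Icc 0 T)
  contDiffOn : ContDiffOn ℝ 1 ψ (Set.Icc 0 T)
  eqn : ∀ t ∈ Set.Icc 0 T,
    Complex.I • derivWithin ψ (Set.Icc 0 T) t = opH s σ β (ψ t)

/-- Well-posedness on `[0,T]` through `q` and `ψ`: `q` is the unique continuous solution of the
charge equation, `ψ` is given by `q` through the Duhamel formula and is the unique strong
solution, and `q(t) = ψ(t,0)`. -/
structure WellPosedOn (s σ β T : ℝ) (ψ₀ : L2) (q : ℝ → ℂ) (ψ : ℝ → L2) : Prop where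
  charge : IsChargeSolution s σ β T ψ₀ q
  charge_unique : ∀ q' : ℝ → ℂ, IsChargeSolution s σ β T ψ₀ q' → Set.EqOn q' q (Set.Icc 0 T)
  duhamel : IsDuhamel s σ β T ψ₀ q ψ
  strong : IsStrongSolution s σ β T ψ₀ ψ
  strong_unique : ∀ ψ' : ℝ → L2, IsStrongSolution s σ β T ψ₀ ψ' → Set.EqOn ψ' ψ (Set.Icc 0 T)
  value_eq : ∀ t ∈ Set.Icc 0 T, value (ψ t) 0 = q t

/-! ### The objects above are well defined -/

lemma symb_nonneg (s ξ : ℝ) : 0 ≤ symb s ξ := Real.rpow_nonneg (abs_nonneg _) _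

lemma measurable_symb (s : ℝ) : Measurable (symb s) := by
  unfold symb
  fun_prop

/-- A continuous representative gives the value. -/
lemma value_eq_of_ae {u : L2} {g : ℝ → ℂ} (hg : Continuous g) (h : u =ᵐ[volume] g) (x : ℝ) :
    value u x = g x := by
  have hex : ∃ g : ℝ → ℂ, Continuous g ∧ u =ᵐ[volume] g := ⟨g, hg, h⟩
  unfold value
  rw [dif_pos hex]
  have := hex.choose_spec
  exact congrFun ((this.1.ae_eq_iff_eq volume hg).1 (this.2.symm.trans h)) x

lemma fourier_fourierMul {m : ℝ → ℂ} {u : L2}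
    (h : MemLp (fun ξ => m ξ * (𝓕 u : L2) ξ) 2 (volume : Measure ℝ)) :
    (𝓕 (fourierMul m u) : L2) =ᵐ[volume] fun ξ => m ξ * (𝓕 u : L2) ξ := by
  unfold fourierMul
  rw [dif_pos h, fourier_fourierInv_eq]
  exact h.coeFn_toLp

lemma fourier_propagator (s t : ℝ) (u : L2) :
    (𝓕 (propagator s t u) : L2) =ᵐ[volume]
      fun ξ => Complex.exp (-Complex.I * (symb s ξ : ℂ) * (t : ℂ)) * (𝓕 u : L2) ξ := by
  have hm : Measurable fun ξ => Complex.exp (-Complex.I * (symb s ξ : ℂ) * (t : ℂ)) := by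
    have := measurable_symb s
    fun_prop
  apply fourier_fourierMul
  refine (Lp.memLp (𝓕 u : L2)).norm.mono'
    (hm.aestronglyMeasurable.mul (Lp.memLp (𝓕 u : L2)).1) (Eventually.of_forall fun ξ => ?_)
  rw [norm_mul, Complex.norm_exp]
  simp

/-- Membership in `H^r`, on the Fourier side. -/
lemma memSobolev_iff (r : ℝ) (u : L2) :
    TemperedDistribution.MemSobolev r 2 (u : 𝓢'(ℝ, ℂ)) ↔
      MemLp (fun ξ => (((1 + ‖ξ‖ ^ 2) ^ (r / 2) : ℝ) : ℂ) * (𝓕 u : L2) ξ) 2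
        (volume : Measure ℝ) := by
  set w : ℝ → ℂ := fun ξ => (((1 + ‖ξ‖ ^ 2) ^ (r / 2) : ℝ) : ℂ) with hw
  have hwt : w.HasTemperateGrowth := by
    rw [hw]
    fun_prop
  have hwc : Continuous w := hwt.1.continuous
  rw [TemperedDistribution.memSobolev_iff_exists_smulLeftCLM_fourier,
    Lp.fourier_toTemperedDistribution_eq]
  constructor
  · rintro ⟨f', hf'⟩
    change TemperedDistribution.smulLeftCLM ℂ w _ = _ at hf'
    have hloc : LocallyIntegrable (fun ξ => w ξ * (𝓕 u : L2) ξ) (volume : Measure ℝ) := by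
      have h1 : LocallyIntegrable ((𝓕 u : L2) : ℝ → ℂ) (volume : Measure ℝ) :=
        (Lp.memLp (𝓕 u : L2)).locallyIntegrable (by norm_num)
      rw [locallyIntegrable_iff] at h1 ⊢
      intro K hK
      exact (h1 K hK).continuousOn_mul hwc.continuousOn hK
    have hae : ∀ᵐ ξ : ℝ, w ξ * (𝓕 u : L2) ξ = f' ξ := by
      apply ae_eq_of_integral_contDiff_smul_eq hloc
        ((Lp.memLp f').locallyIntegrable (by norm_num))
      intro g g_smooth g_cpt
      have hg₁ : HasCompactSupport (Complex.ofRealCLM ∘ g) := g_cpt.comp_left rfl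
      have hg₂ : ContDiff ℝ ∞ (Complex.ofRealCLM ∘ g) := by fun_prop
      have key := congrArg (fun T : 𝓢'(ℝ, ℂ) => T (hg₁.toSchwartzMap hg₂)) hf'
      simp only [TemperedDistribution.smulLeftCLM_apply_apply,
        Lp.toTemperedDistribution_apply] at key
      simp only [SchwartzMap.smulLeftCLM_apply_apply hwt] at key
      refine Eq.trans ?_ (key.trans ?_)
      · apply integral_congr_ae
        filter_upwards with x
        simp [hw]
        ring
      · apply integral_congr_ae
        filter_upwards with x
        simp
    exact (memLp_congr_ae hae).2 (Lp.memLp f')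
  · intro h
    refine ⟨h.toLp _, ?_⟩
    ext φ
    simp only [TemperedDistribution.smulLeftCLM_apply_apply, Lp.toTemperedDistribution_apply]
    apply integral_congr_ae
    filter_upwards [h.coeFn_toLp] with x hx
    rw [hx, SchwartzMap.smulLeftCLM_apply_apply hwt]
    simp only [smul_eq_mul]
    ring

/-- The weights `(1+|ξ|²)^s` and `|2πξ|^{2s} + lam` are comparable. -/
lemma weight_le {s lam : ℝ} (hs : 0 ≤ s) (hlam : 0 < lam) :
    ∃ C : ℝ, 0 < C ∧ ∀ ξ : ℝ, (1 + ‖ξ‖ ^ 2) ^ s ≤ C * (symb s ξ + lam) := by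
  refine ⟨(2 : ℝ) ^ s * (1 + lam⁻¹), by positivity, fun ξ => ?_⟩
  have hpi : |ξ| ≤ |2 * Real.pi * ξ| := by
    rw [abs_mul, abs_of_pos (by positivity : (0 : ℝ) < 2 * Real.pi)]
    have := Real.pi_gt_three
    nlinarith [abs_nonneg ξ]
  have hsy : symb s ξ = (|2 * Real.pi * ξ| ^ 2) ^ s := by
    rw [symb, Real.rpow_mul (abs_nonneg _), Real.rpow_two]
  have h0 := symb_nonneg s ξ
  have hone : 1 ≤ (1 + lam⁻¹) * (symb s ξ + lam) := by
    have : lam⁻¹ * lam = 1 := inv_mul_cancel₀ hlam.ne'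
    have h2 : 0 < lam⁻¹ := inv_pos.2 hlam
    nlinarith [mul_nonneg h2.le h0]
  have hsymb : symb s ξ ≤ (1 + lam⁻¹) * (symb s ξ + lam) := by
    have h2 : 0 < lam⁻¹ := inv_pos.2 hlam
    nlinarith [mul_nonneg h2.le h0, mul_pos h2 hlam]
  rw [mul_assoc]
  rcases le_total |ξ| 1 with h | h
  · calc (1 + ‖ξ‖ ^ 2) ^ s ≤ (2 : ℝ) ^ s := by
          apply Real.rpow_le_rpow (by positivity) _ hs
          rw [Real.norm_eq_abs]
          nlinarith [abs_nonneg ξ]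
      _ ≤ _ := le_mul_of_one_le_right (by positivity) hone
  · calc (1 + ‖ξ‖ ^ 2) ^ s ≤ (2 * |2 * Real.pi * ξ| ^ 2) ^ s := by
          apply Real.rpow_le_rpow (by positivity) _ hs
          rw [Real.norm_eq_abs]
          nlinarith [abs_nonneg ξ]
      _ = 2 ^ s * symb s ξ := by rw [Real.mul_rpow (by norm_num) (by positivity), hsy]
      _ ≤ _ := by gcongr

lemma symb_le {s : ℝ} (hs : 0 ≤ s) (ξ : ℝ) :
    symb s ξ ≤ ((2 * Real.pi) ^ 2) ^ s * (1 + ‖ξ‖ ^ 2) ^ s := by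
  rw [← Real.mul_rpow (by positivity) (by positivity), symb,
    Real.rpow_mul (abs_nonneg _), Real.rpow_two]
  apply Real.rpow_le_rpow (by positivity) _ hs
  rw [sq_abs, Real.norm_eq_abs, sq_abs]
  nlinarith [Real.pi_pos]

lemma measurable_greenHat (s lam : ℝ) : Measurable (greenHat s lam) := by
  unfold greenHat
  have := measurable_symb s
  fun_prop

lemma memLp_greenHat {s lam : ℝ} (hs : 1 / 2 < s) (hlam : 0 < lam) :
    MemLp (greenHat s lam) 2 (volume : Measure ℝ) := by
  obtain ⟨C, hC, hle⟩ := weight_le (by linarith : 0 ≤ s) hlam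
  have hint : MemLp (fun ξ : ℝ => (1 + ‖ξ‖ ^ 2) ^ (-s)) 2 (volume : Measure ℝ) := by
    have hcont : Continuous (fun ξ : ℝ => (1 + ‖ξ‖ ^ 2) ^ (-s)) := by
      apply Continuous.rpow_const (by fun_prop)
      intro x
      left
      positivity
    rw [memLp_two_iff_integrable_sq hcont.aestronglyMeasurable]
    have := integrable_rpow_neg_one_add_norm_sq (E := ℝ) (μ := volume) (r := 4 * s)
      (by simp; linarith)
    refine this.congr (Eventually.of_forall fun ξ => ?_)
    simp only
    rw [← Real.rpow_mul_natCast (by positivity)]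
    congr 1
    push_cast
    ring
  refine (hint.const_mul C).mono' (measurable_greenHat s lam).aestronglyMeasurable
    (Eventually.of_forall fun ξ => ?_)
  have h0 := symb_nonneg s ξ
  have hp : 0 < symb s ξ + lam := by linarith
  have hq : (0 : ℝ) < (1 + ‖ξ‖ ^ 2) ^ s := by positivity
  rw [greenHat, Complex.norm_real, Real.norm_of_nonneg (inv_nonneg.2 hp.le),
    Real.rpow_neg (by positivity), ← div_eq_mul_inv, inv_eq_one_div, div_le_div_iff₀ hp hq]
  simpa using hle ξ

lemma fourier_green {s lam : ℝ} (hs : 1 / 2 < s) (hlam : 0 < lam) :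
    (𝓕 (green s lam) : L2) =ᵐ[volume] greenHat s lam := by
  unfold green
  rw [dif_pos (memLp_greenHat hs hlam), fourier_fourierInv_eq]
  exact (memLp_greenHat hs hlam).coeFn_toLp

lemma memLp_symb_of_memSobolev {s : ℝ} (hs : 0 ≤ s) {u : L2}
    (h : TemperedDistribution.MemSobolev (2 * s) 2 (u : 𝓢'(ℝ, ℂ))) :
    MemLp (fun ξ => (symb s ξ : ℂ) * (𝓕 u : L2) ξ) 2 (volume : Measure ℝ) := by
  rw [memSobolev_iff] at h
  have hm := (measurable_symb s).complex_ofReal.aestronglyMeasurable (μ := volume)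
  refine (h.norm.const_mul (((2 * Real.pi) ^ 2) ^ s)).mono'
    (hm.mul (Lp.memLp (𝓕 u : L2)).1) (Eventually.of_forall fun ξ => ?_)
  simp only [norm_mul, Complex.norm_real]
  rw [Real.norm_of_nonneg (symb_nonneg s ξ), Real.norm_of_nonneg (by positivity), ← mul_assoc]
  gcongr
  have := symb_le hs ξ
  rwa [mul_div_cancel_left₀ s (by norm_num : (2 : ℝ) ≠ 0)]

lemma memSobolev_green_sub {s lam mu : ℝ} (hs : 1 / 2 < s) (hlam : 0 < lam) (hmu : 0 < mu) :
    TemperedDistribution.MemSobolev (2 * s) 2 ((green s lam - green s mu : L2) : 𝓢'(ℝ, ℂ)) := by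
  rw [memSobolev_iff]
  obtain ⟨C, hC, hle⟩ := weight_le (by linarith : 0 ≤ s) hlam
  have hcont : Continuous (fun ξ : ℝ => (((1 + ‖ξ‖ ^ 2) ^ (2 * s / 2) : ℝ) : ℂ)) := by
    refine Complex.continuous_ofReal.comp (Continuous.rpow_const (by fun_prop) fun x => ?_)
    left
    positivity
  refine (((memLp_greenHat hs hmu).norm.const_mul (C * |mu - lam|)).mono'
    (hcont.aestronglyMeasurable.mul (Lp.memLp (𝓕 (green s lam - green s mu) : L2)).1) ?_)
  have hsub : (𝓕 (green s lam - green s mu) : L2) = 𝓕 (green s lam) - 𝓕 (green s mu) :=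
    (Lp.fourierTransformₗᵢ ℝ ℂ).map_sub _ _
  rw [hsub]
  filter_upwards [Lp.coeFn_sub (𝓕 (green s lam) : L2) (𝓕 (green s mu) : L2),
    fourier_green hs hlam, fourier_green hs hmu] with ξ h1 h2 h3
  have h0 := symb_nonneg s ξ
  have hp : 0 < symb s ξ + lam := by linarith
  have hq : 0 < symb s ξ + mu := by linarith
  have hsub : greenHat s lam ξ - greenHat s mu ξ =
      (((symb s ξ + lam)⁻¹ * (mu - lam) : ℝ) : ℂ) * greenHat s mu ξ := by
    unfold greenHat
    rw [← Complex.ofReal_sub, ← Complex.ofReal_mul]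
    congr 1
    field_simp
    ring
  rw [h1, Pi.sub_apply, h2, h3, hsub, ← mul_assoc, norm_mul, mul_div_cancel_left₀ s two_ne_zero]
  gcongr
  rw [← Complex.ofReal_mul, Complex.norm_real, Real.norm_eq_abs, ← mul_assoc, abs_mul]
  gcongr
  rw [abs_of_nonneg (by positivity), ← div_eq_mul_inv, div_le_iff₀ hp]
  exact hle ξ

/-- The domain does not depend on the parameter `lam > 0`. -/
lemma memSobolev_regularPart {s σ β lam : ℝ} (hs : 1 / 2 < s) (hlam : 0 < lam) {ψ : L2}
    (hψ : ψ ∈ domain s σ β) :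
    TemperedDistribution.MemSobolev (2 * s) 2 (regularPart s σ β lam ψ : 𝓢'(ℝ, ℂ)) := by
  obtain ⟨-, mu, hmu, h⟩ := hψ
  have h2 := h.add ((memSobolev_green_sub hs hlam hmu).smul (nonlin σ β (value ψ 0)))
  have e : regularPart s σ β lam ψ =
      regularPart s σ β mu ψ + nonlin σ β (value ψ 0) • (green s lam - green s mu) := by
    unfold regularPart
    module
  rw [e, ← Lp.toTemperedDistributionCLM_apply]
  simpa only [map_add, map_smul, Lp.toTemperedDistributionCLM_apply] using h2

/-- The operator does not depend on the parameter `lam > 0`. -/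
lemma opH_add_smul {s σ β lam : ℝ} (hs : 1 / 2 < s) (hlam : 0 < lam) {ψ : L2}
    (hψ : ψ ∈ domain s σ β) :
    opH s σ β ψ + (lam : ℂ) • ψ =
      fracLaplacian s (regularPart s σ β lam ψ) + (lam : ℂ) • regularPart s σ β lam ψ := by
  have key : ∀ mu : ℝ, 0 < mu →
      (𝓕 (fracLaplacian s (regularPart s σ β mu ψ) + (mu : ℂ) • regularPart s σ β mu ψ
        - (mu : ℂ) • ψ) : L2) =ᵐ[volume]
      fun ξ => (symb s ξ : ℂ) * (𝓕 ψ : L2) ξ + nonlin σ β (value ψ 0) := by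
    intro mu hmu
    have hm := memLp_symb_of_memSobolev (by linarith : 0 ≤ s) (memSobolev_regularPart hs hmu hψ)
    have hreg : (𝓕 (regularPart s σ β mu ψ) : L2) =
        𝓕 ψ + nonlin σ β (value ψ 0) • (𝓕 (green s mu) : L2) := by
      rw [regularPart, FourierTransform.fourier_add, FourierTransform.fourier_smul]
    have hreg' : (𝓕 (regularPart s σ β mu ψ) : L2) =ᵐ[volume]
        fun ξ => (𝓕 ψ : L2) ξ + nonlin σ β (value ψ 0) * greenHat s mu ξ := by
      rw [hreg]
      filter_upwards [Lp.coeFn_add (𝓕 ψ : L2) (nonlin σ β (value ψ 0) • (𝓕 (green s mu) : L2)),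
        Lp.coeFn_smul (nonlin σ β (value ψ 0)) (𝓕 (green s mu) : L2),
        fourier_green hs hmu] with ξ h1 h2 h3
      rw [h1, Pi.add_apply, h2, Pi.smul_apply, h3, smul_eq_mul]
    have e : fracLaplacian s (regularPart s σ β mu ψ) + (mu : ℂ) • regularPart s σ β mu ψ
        - (mu : ℂ) • ψ = fracLaplacian s (regularPart s σ β mu ψ) +
          ((mu : ℂ) * nonlin σ β (value ψ 0)) • green s mu := by
      simp only [regularPart]
      module
    rw [e, FourierTransform.fourier_add, FourierTransform.fourier_smul]
    filter_upwards [Lp.coeFn_add (𝓕 (fracLaplacian s (regularPart s σ β mu ψ)) : L2)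
        (((mu : ℂ) * nonlin σ β (value ψ 0)) • (𝓕 (green s mu) : L2)),
      Lp.coeFn_smul ((mu : ℂ) * nonlin σ β (value ψ 0)) (𝓕 (green s mu) : L2),
      fourier_green hs hmu, fourier_fourierMul hm, hreg'] with ξ h1 h2 h3 h4 h5
    have h0 := symb_nonneg s ξ
    have hq : ((symb s ξ : ℂ) + (mu : ℂ)) ≠ 0 := by
      rw [← Complex.ofReal_add]
      exact Complex.ofReal_ne_zero.2 (by linarith)
    rw [h1, Pi.add_apply, h2, Pi.smul_apply, h3, fracLaplacian, h4, h5, smul_eq_mul, greenHat]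
    push_cast
    field_simp
    ring
  have h1 := (key 1 one_pos).trans (key lam hlam).symm
  have h2 := (Lp.fourierTransformₗᵢ ℝ ℂ).injective (Lp.ext h1)
  rw [Complex.ofReal_one, one_smul, one_smul] at h2
  rw [opH, h2]
  abel

end FracDelta

end

open FracDelta

/-! On the Fourier side the nonlinear operator is multiplication by `symb` plus a constant. A pair
`(U, H)` of `L²` functions with `H = symb · U + z`, where `z` is the nonlinearity evaluated at `∫
U`, is the same thing as an element of the domain together with its image (`graph_of_mem_domain`,
`mem_domain_of_graph`), because `∫ U` is the value at the origin. Frequency by frequency the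
equation is therefore a scalar linear ODE with a source `N(t)`, the nonlinearity at `q(t)`, that
does not depend on `ξ`. Its solution is the Duhamel formula. Integrating that over `ξ` gives the
charge equation: by scaling, the integral of the phase over all frequencies is `a(s) t^{-1/(2s)}`, a
singularity that is integrable at `t = 0` because `s > 1/2`.

From charge to wave function. The Duhamel state has to lie in the domain, so `symb · U + N` has to
be in `L²`. Integration by parts in time (`symb_mul_duhamelHat_add`) rewrites it as the free
evolution of the image of the datum plus a phase integral of `N'`. Two facts are needed. The phase
integral maps `L²(0,T)` into `L²` (`exists_phaseInt_bound`); by a `TT*` argument this is Schur's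
test for the kernel `|t|^{-1/(2s)}`. And `N` is absolutely continuous with derivative in `L²`
(`IsChargeSolution.exists_density`): by the dual of the smoothing estimate the free evolution at the
origin, corrected by the initial charge term, is the primitive of an `L²` function, and the
increments of `q` are then dominated by the integral of the solution of a linear weakly singular
Volterra equation (`exists_majorant`, `enorm_sub_le_lintegral_majorant`).

From wave function to charge. Pairing a strong solution with a backward free evolution localised to
`|ξ| ≤ R` and letting `R → ∞` shows that its value at the origin solves the charge equation. That
equation has at most one solution, by a weakly singular Gronwall lemma, so two strong solutions with
the same datum have the same charge; their difference solves a linear equation with constant norm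
and vanishes.

Conservation. The mass is constant since the inner product of `U` and `H` is real. For the energy
`q` need not be differentiable in time. The increment of the energy is a term linear in the
increment of `U` plus an error `O(|δq|²)`, and interpolation gives `|δq|² ≲ ‖δU‖ ‖δH‖ + ‖δU‖²`,
which is `o(|δt|)`.

Existence. With the nonlinearity replaced by a Lipschitz function the charge equation has a global
solution, by contraction in an exponentially weighted norm. It is a true charge until its modulus
reaches a prescribed level. Together with the conservation laws and the inequality `|q|^{4s} ≤ c
M^{4s-2} ∫ symb |U|²`, this gives global solutions when `β ≥ 0`, when `σ < 2s - 1`, and at `σ = 2s -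
1` for small mass; otherwise it gives the blow-up alternative.

Blow-up. Let `V` be the integral of `w |∂_ξ U|²` with `w · symb' = ξ`. Then `V' = 2D` with a
dilation functional `D`, and `D' = 2s ∫ symb |U|² + β |q|^{2σ+2} ≤ 2s E` when `β < 0` and `σ + 1 ≥
2s`. Since `V ≥ 0` and `E < 0`, the solution cannot exist for long. The computation is carried out
on `|ξ| ≤ R`, and only the resulting inequality is passed to the limit (`virial_nonneg`). -/

noncomputable section

namespace FracDelta

/-! ### The oscillatory kernel -/

/-- The multiplier `e^{-i|k|^{2s}t}` of the free propagator. -/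
def phase (s t ξ : ℝ) : ℂ := Complex.exp (-Complex.I * (symb s ξ : ℂ) * (t : ℂ))

lemma norm_phase (s t ξ : ℝ) : ‖phase s t ξ‖ = 1 := by
  rw [phase, Complex.norm_exp]
  simp

lemma phase_add (s t r ξ : ℝ) : phase s (t + r) ξ = phase s t ξ * phase s r ξ := by
  rw [phase, phase, phase, ← Complex.exp_add]
  congr 1
  push_cast
  ring

lemma phase_sub (s t r ξ : ℝ) : phase s (t - r) ξ = phase s t ξ * phase s (-r) ξ := by
  rw [← phase_add, sub_eq_add_neg]

@[simp] lemma phase_zero (s ξ : ℝ) : phase s 0 ξ = 1 := by simp [phase]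

lemma conj_phase (s t ξ : ℝ) : (starRingEnd ℂ) (phase s t ξ) = phase s (-t) ξ := by
  rw [phase, phase, ← Complex.exp_conj]
  simp

lemma continuous_symb {s : ℝ} (hs : 0 ≤ s) : Continuous (symb s) := by
  unfold symb
  exact Continuous.rpow_const (by fun_prop) fun x => Or.inr (by linarith)

lemma continuous_phase {s : ℝ} (hs : 0 ≤ s) : Continuous fun p : ℝ × ℝ => phase s p.1 p.2 := by
  have h : Continuous fun p : ℝ × ℝ => symb s p.2 := (continuous_symb hs).comp continuous_snd
  have h2 : Continuous fun p : ℝ × ℝ => (p.1 : ℂ) := Complex.continuous_ofReal.comp continuous_fst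
  exact Complex.continuous_exp.comp
    ((continuous_const.mul (Complex.continuous_ofReal.comp h)).mul h2)

lemma continuous_phase_right {s : ℝ} (hs : 0 ≤ s) (t : ℝ) : Continuous fun ξ => phase s t ξ := by
  have h : Continuous fun ξ : ℝ => (t, ξ) := by fun_prop
  simpa only [Function.comp_def] using (continuous_phase hs).comp h

lemma continuous_phase_left {s : ℝ} (ξ : ℝ) : Continuous fun t => phase s t ξ := by
  unfold phase
  fun_prop

lemma measurable_phase (s : ℝ) : Measurable fun p : ℝ × ℝ => phase s p.1 p.2 := by
  have h : Measurable fun p : ℝ × ℝ => symb s p.2 := (measurable_symb s).comp measurable_snd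
  have h2 : Measurable fun p : ℝ × ℝ => (p.1 : ℂ) := Complex.measurable_ofReal.comp measurable_fst
  exact Complex.measurable_exp.comp
    ((measurable_const.mul (Complex.measurable_ofReal.comp h)).mul h2)

lemma measurable_phase_right (s t : ℝ) : Measurable fun ξ => phase s t ξ := by
  have h : Measurable fun ξ : ℝ => (t, ξ) := by fun_prop
  simpa only [Function.comp_def] using (measurable_phase s).comp h

lemma hasDerivAt_phase (s t ξ : ℝ) :
    HasDerivAt (fun t => phase s t ξ) (-Complex.I * (symb s ξ : ℂ) * phase s t ξ) t := by
  have h : HasDerivAt (fun t : ℝ => -Complex.I * (symb s ξ : ℂ) * (t : ℂ))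
      (-Complex.I * (symb s ξ : ℂ) * 1) t :=
    (Complex.ofRealCLM.hasDerivAt (x := t)).const_mul _
  exact h.cexp.congr_deriv (by rw [mul_one, mul_comm]; rfl)

attribute [irreducible] phase

/-- The kernel of the free propagator at `x = 0`, truncated to the frequencies `|ξ| ≤ R`. -/
def kernelCut (s R t : ℝ) : ℂ := ∫ ξ in (-R)..R, phase s t ξ

/-- The integrand is `(i/2s) ρ^{1-2s}` times its own derivative. After integration by parts on `[1,
R]` the boundary term at `R` tends to zero and the new integrand is `O(ρ^{-2s})`, absolutely
integrable because `2s > 1`. -/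
lemma exists_tendsto_halfKernel {s : ℝ} (hs : 1 / 2 < s) :
    ∃ c : ℂ, Tendsto (fun R : ℝ => ∫ ρ in (0 : ℝ)..R,
      Complex.exp (-Complex.I * ((|ρ| ^ (2 * s) : ℝ) : ℂ))) atTop (𝓝 c) := by
  set e : ℝ → ℂ := fun ρ => Complex.exp (-Complex.I * ((|ρ| ^ (2 * s) : ℝ) : ℂ)) with he
  have hec : Continuous e := by
    have : Continuous fun ρ : ℝ => |ρ| ^ (2 * s) :=
      Continuous.rpow_const (by fun_prop) fun x => Or.inr (by linarith)
    rw [he]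
    fun_prop
  have hne : ∀ ρ, ‖e ρ‖ = 1 := fun ρ => by
    rw [he]
    simp only
    rw [Complex.norm_exp]
    simp
  set u : ℝ → ℂ := fun ρ => Complex.I / (2 * s) * ((ρ ^ (1 - 2 * s) : ℝ) : ℂ) with hu
  set u' : ℝ → ℂ := fun ρ => Complex.I / (2 * s) * (((1 - 2 * s) * ρ ^ (-(2 * s)) : ℝ) : ℂ)
    with hu'
  have hs0 : (s : ℂ) ≠ 0 := by
    exact_mod_cast (by linarith : s ≠ 0)
  have hder : ∀ ρ : ℝ, 0 < ρ → HasDerivAt (fun ρ => u ρ * e ρ) (u' ρ * e ρ + e ρ) ρ := by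
    intro ρ hρ
    have h1 : HasDerivAt u (u' ρ) ρ := by
      have := (Real.hasDerivAt_rpow_const (p := 1 - 2 * s) (Or.inl hρ.ne')).ofReal_comp.const_mul
        (Complex.I / (2 * s))
      rw [show 1 - 2 * s - 1 = -(2 * s) by ring] at this
      exact this
    have h2 : HasDerivAt e (-Complex.I * ((2 * s * ρ ^ (2 * s - 1) : ℝ) : ℂ) * e ρ) ρ := by
      have h3 : HasDerivAt (fun ρ : ℝ => Complex.exp (-Complex.I * ((ρ ^ (2 * s) : ℝ) : ℂ)))
          (Complex.exp (-Complex.I * ((ρ ^ (2 * s) : ℝ) : ℂ)) *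
            (-Complex.I * ((2 * s * ρ ^ (2 * s - 1) : ℝ) : ℂ))) ρ :=
        ((Real.hasDerivAt_rpow_const (p := 2 * s) (Or.inl hρ.ne')).ofReal_comp.const_mul
          (-Complex.I)).cexp
      have h4 : e =ᶠ[𝓝 ρ] fun ρ : ℝ => Complex.exp (-Complex.I * ((ρ ^ (2 * s) : ℝ) : ℂ)) := by
        filter_upwards [lt_mem_nhds hρ] with x hx
        simp only [he, abs_of_pos hx]
      have h5 := h3.congr_of_eventuallyEq h4
      rw [← h4.eq_of_nhds, mul_comm] at h5
      exact h5
    have h3 := h1.mul h2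
    refine h3.congr_deriv ?_
    congr 1
    have : (ρ ^ (1 - 2 * s) * ρ ^ (2 * s - 1) : ℝ) = 1 := by
      rw [← Real.rpow_add hρ]
      simp
    have hc : ((ρ ^ (1 - 2 * s) : ℝ) : ℂ) * ((ρ ^ (2 * s - 1) : ℝ) : ℂ) = 1 := by
      exact_mod_cast this
    simp only [hu]
    push_cast
    calc _ = -(Complex.I * Complex.I) * (((ρ ^ (1 - 2 * s) : ℝ) : ℂ) *
          ((ρ ^ (2 * s - 1) : ℝ) : ℂ)) * e ρ * (s / s) := by field_simp
      _ = e ρ := by rw [hc, div_self hs0, Complex.I_mul_I]; ring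
  have hint' : IntegrableOn (fun ρ => u' ρ * e ρ) (Set.Ioi 1) := by
    have h1 : IntegrableOn (fun ρ : ℝ => ρ ^ (-(2 * s))) (Set.Ioi 1) :=
      integrableOn_Ioi_rpow_of_lt (by linarith) one_pos
    have h2 : IntegrableOn u' (Set.Ioi 1) := ((h1.const_mul (1 - 2 * s)).ofReal).const_mul _
    refine Integrable.mul_bdd (c := 1) h2 hec.aestronglyMeasurable (Eventually.of_forall fun ρ => ?_)
    exact (hne ρ).le
  have heq : ∀ R : ℝ, 1 ≤ R → ∫ ρ in (0 : ℝ)..R, e ρ = (∫ ρ in (0 : ℝ)..1, e ρ) +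
      (u R * e R - u 1 * e 1 - ∫ ρ in (1 : ℝ)..R, u' ρ * e ρ) := by
    intro R hR
    have hi : IntervalIntegrable (fun ρ => u' ρ * e ρ) volume 1 R := by
      rw [intervalIntegrable_iff_integrableOn_Ioc_of_le hR]
      exact hint'.mono_set Set.Ioc_subset_Ioi_self
    have h := intervalIntegral.integral_eq_sub_of_hasDerivAt (a := 1) (b := R)
      (f := fun ρ => u ρ * e ρ) (f' := fun ρ => u' ρ * e ρ + e ρ)
      (fun x hx => hder x (by rw [Set.uIcc_of_le hR] at hx; linarith [hx.1]))
      (hi.add (hec.intervalIntegrable _ _))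
    rw [intervalIntegral.integral_add hi (hec.intervalIntegrable _ _)] at h
    rw [← intervalIntegral.integral_add_adjacent_intervals (hec.intervalIntegrable 0 1)
      (hec.intervalIntegrable 1 R), ← h]
    ring
  have hu0 : Tendsto (fun R => u R * e R) atTop (𝓝 0) := by
    rw [tendsto_zero_iff_norm_tendsto_zero]
    have h1 : Tendsto (fun R : ℝ => R ^ (-(2 * s - 1))) atTop (𝓝 0) :=
      tendsto_rpow_neg_atTop (by linarith)
    have h2 : Tendsto u atTop (𝓝 0) := by
      have := (Complex.continuous_ofReal.tendsto 0).comp h1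
      have h3 := this.const_mul (Complex.I / (2 * s))
      rw [Complex.ofReal_zero, mul_zero] at h3
      refine h3.congr fun R => ?_
      simp only [Function.comp, hu]
      congr 4
      ring
    simpa [hne] using h2.norm
  have hlim := ((hu0.sub_const (u 1 * e 1)).sub
    (intervalIntegral_tendsto_integral_Ioi 1 hint' tendsto_id)).const_add (∫ ρ in (0 : ℝ)..1, e ρ)
  exact ⟨_, hlim.congr' (by
    filter_upwards [eventually_ge_atTop 1] with R hR using (heq R hR).symm)⟩

/-- The improper integral that defines the constant of the kernel converges. -/
lemma tendsto_kernelTrunc {s : ℝ} (hs : 1 / 2 < s) :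
    Tendsto (kernelTrunc s) atTop (𝓝 (kernelConst s)) := by
  obtain ⟨c, hc⟩ := exists_tendsto_halfKernel hs
  set e : ℝ → ℂ := fun ρ => Complex.exp (-Complex.I * ((|ρ| ^ (2 * s) : ℝ) : ℂ)) with he
  have hec : Continuous e := by
    have : Continuous fun ρ : ℝ => |ρ| ^ (2 * s) :=
      Continuous.rpow_const (by fun_prop) fun x => Or.inr (by linarith)
    rw [he]
    fun_prop
  have h : Tendsto (kernelTrunc s) atTop (𝓝 (((2 * Real.pi)⁻¹ : ℂ) * (c + c))) := by
    refine ((hc.add hc).const_mul _).congr fun R => ?_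
    rw [kernelTrunc]
    congr 1
    rw [← intervalIntegral.integral_add_adjacent_intervals (hec.intervalIntegrable (-R) 0)
      (hec.intervalIntegrable 0 R)]
    congr 1
    have := intervalIntegral.integral_comp_neg (f := e) (a := 0) (b := R)
    rw [neg_zero] at this
    rw [← this]
    simp [he]
  rw [kernelConst, h.limUnder_eq]
  exact h

lemma exists_norm_kernelTrunc_le {s : ℝ} (hs : 1 / 2 < s) :
    ∃ C : ℝ, 0 < C ∧ ∀ R, 0 ≤ R → ‖kernelTrunc s R‖ ≤ C := by
  have hec : Continuous fun ρ : ℝ => Complex.exp (-Complex.I * ((|ρ| ^ (2 * s) : ℝ) : ℂ)) := by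
    have : Continuous fun ρ : ℝ => |ρ| ^ (2 * s) :=
      Continuous.rpow_const (by fun_prop) fun x => Or.inr (by linarith)
    fun_prop
  have hcont : Continuous (kernelTrunc s) := by
    have h1 : Continuous fun R : ℝ => ∫ ρ in (0 : ℝ)..R,
        Complex.exp (-Complex.I * ((|ρ| ^ (2 * s) : ℝ) : ℂ)) :=
      intervalIntegral.continuous_primitive (fun a b => hec.intervalIntegrable a b) 0
    have h2 := h1.sub (h1.comp continuous_neg)
    refine (h2.const_mul ((2 * Real.pi)⁻¹ : ℂ)).congr fun R => ?_
    rw [kernelTrunc]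
    congr 1
    exact intervalIntegral.integral_interval_sub_left (hec.intervalIntegrable _ _)
      (hec.intervalIntegrable _ _)
  have h := tendsto_kernelTrunc hs
  have hev : ∀ᶠ R in atTop, ‖kernelTrunc s R‖ < ‖kernelConst s‖ + 1 :=
    h.norm.eventually (gt_mem_nhds (by linarith))
  obtain ⟨A, hA⟩ := eventually_atTop.1 hev
  obtain ⟨B, hB⟩ := (isCompact_Icc (a := (0 : ℝ)) (b := A)).exists_bound_of_continuousOn
    hcont.continuousOn
  refine ⟨max B (‖kernelConst s‖ + 1), by positivity, fun R hR => ?_⟩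
  rcases le_total R A with hRA | hRA
  · exact (hB R ⟨hR, hRA⟩).trans (le_max_left _ _)
  · exact (hA R hRA).le.trans (le_max_right _ _)

/-- The scaling of the truncated kernel. -/
lemma kernelCut_eq {s : ℝ} (hs : 1 / 2 < s) (R : ℝ) {t : ℝ} (ht : 0 < t) :
    kernelCut s R t = ((t ^ (1 / (2 * s)) : ℝ) : ℂ)⁻¹ *
      kernelTrunc s (2 * Real.pi * t ^ (1 / (2 * s)) * R) := by
  -- The substitution `ρ = c ξ` turns `symb s ξ * t` into `|ρ|^{2s}`; the factor `2π` in `c`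
  -- produces the prefactor of `kernelTrunc`.
  set c := 2 * Real.pi * t ^ (1 / (2 * s)) with hc
  have htp : 0 < t ^ (1 / (2 * s)) := Real.rpow_pos_of_pos ht _
  have hcpos : 0 < c := by positivity
  have h := intervalIntegral.integral_comp_mul_left (a := -R) (b := R)
    (fun ρ : ℝ => Complex.exp (-Complex.I * ((|ρ| ^ (2 * s) : ℝ) : ℂ))) hcpos.ne'
  rw [mul_neg] at h
  have hk : kernelCut s R t = ∫ x in (-R)..R,
      Complex.exp (-Complex.I * ((|c * x| ^ (2 * s) : ℝ) : ℂ)) := by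
    simp only [kernelCut, phase]
    congr 1
    funext x
    rw [mul_assoc, ← Complex.ofReal_mul]
    congr 4
    rw [symb, hc, show 2 * Real.pi * t ^ (1 / (2 * s)) * x = (2 * Real.pi * x) * t ^ (1 / (2 * s))
      by ring, abs_mul (2 * Real.pi * x), Real.mul_rpow (abs_nonneg _) (abs_nonneg _),
      abs_of_pos htp, ← Real.rpow_mul ht.le, one_div_mul_cancel (by linarith), Real.rpow_one]
  rw [hk, h, kernelTrunc, hc, Complex.real_smul]
  have : ((t ^ (1 / (2 * s)) : ℝ) : ℂ) ≠ 0 := by exact_mod_cast htp.ne'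
  have hpi : (Real.pi : ℂ) ≠ 0 := by exact_mod_cast Real.pi_ne_zero
  push_cast
  field_simp

/-- The uniformity in `R` carries both the dominated convergence in `tendsto_integral_kernelCut` and
the Schur bound in `exists_phaseInt_bound`. Negative times reduce to positive ones by complex
conjugation. -/
lemma exists_norm_kernelCut_le {s : ℝ} (hs : 1 / 2 < s) :
    ∃ C : ℝ, 0 < C ∧ ∀ R, 0 ≤ R → ∀ t, t ≠ 0 →
      ‖kernelCut s R t‖ ≤ C * |t| ^ (-(1 / (2 * s))) := by
  obtain ⟨C, hC, h⟩ := exists_norm_kernelTrunc_le hs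
  have key : ∀ R, 0 ≤ R → ∀ t, 0 < t → ‖kernelCut s R t‖ ≤ C * t ^ (-(1 / (2 * s))) := by
    intro R hR t ht
    have htp : 0 < t ^ (1 / (2 * s)) := Real.rpow_pos_of_pos ht _
    rw [kernelCut_eq hs R ht, norm_mul, norm_inv, Complex.norm_real, Real.norm_of_nonneg htp.le,
      Real.rpow_neg ht.le, mul_comm]
    gcongr
    exact h _ (by positivity)
  refine ⟨C, hC, fun R hR t ht => ?_⟩
  rcases lt_or_gt_of_ne ht with h0 | h0
  · have h1 : kernelCut s R t = (starRingEnd ℂ) (kernelCut s R (-t)) := by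
      unfold kernelCut
      rw [intervalIntegral.intervalIntegral_eq_integral_uIoc,
        intervalIntegral.intervalIntegral_eq_integral_uIoc, Complex.real_smul, Complex.real_smul,
        map_mul, Complex.conj_ofReal, ← integral_conj]
      simp [conj_phase]
    rw [h1, RCLike.norm_conj, abs_of_neg h0]
    exact key R hR _ (by linarith)
  · rw [abs_of_pos h0]
    exact key R hR t h0

lemma tendsto_kernelCut {s : ℝ} (hs : 1 / 2 < s) {t : ℝ} (ht : 0 < t) :
    Tendsto (fun R => kernelCut s R t) atTop
      (𝓝 (((t ^ (1 / (2 * s)) : ℝ) : ℂ)⁻¹ * kernelConst s)) := by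
  have htp : 0 < t ^ (1 / (2 * s)) := Real.rpow_pos_of_pos ht _
  simp_rw [kernelCut_eq hs _ ht]
  exact ((tendsto_kernelTrunc hs).comp
    (tendsto_id.const_mul_atTop (by positivity))).const_mul _

lemma continuous_kernelCut {s : ℝ} (hs : 0 ≤ s) (R : ℝ) : Continuous (kernelCut s R) := by
  unfold kernelCut
  exact intervalIntegral.continuous_parametric_intervalIntegral_of_continuous'
    (f := fun t ξ => phase s t ξ) (continuous_phase hs) _ _

/-- The truncated kernel converges to the kernel of the charge equation under the integral sign. -/
lemma tendsto_integral_kernelCut {s : ℝ} (hs : 1 / 2 < s) {t : ℝ} (ht : 0 ≤ t) {N : ℝ → ℂ}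
    (hN : ContinuousOn N (Set.Icc 0 t)) :
    Tendsto (fun R => ∫ τ in (0 : ℝ)..t, N τ * kernelCut s R (t - τ)) atTop
      (𝓝 (kernelConst s * ∫ τ in (0 : ℝ)..t, N τ / (((t - τ) ^ (1 / (2 * s)) : ℝ) : ℂ))) := by
  obtain ⟨C, hC, hK⟩ := exists_norm_kernelCut_le hs
  obtain ⟨B, hB⟩ := isCompact_Icc.exists_bound_of_continuousOn hN
  have hα : 1 / (2 * s) < 1 := by
    rw [div_lt_one (by linarith)]
    linarith
  rw [← intervalIntegral.integral_const_mul]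
  apply intervalIntegral.tendsto_integral_filter_of_dominated_convergence
    (fun τ => B * (C * (t - τ) ^ (-(1 / (2 * s)))))
  · refine Eventually.of_forall fun R => ?_
    rw [Set.uIoc_of_le ht]
    refine ((hN.mono Set.Ioc_subset_Icc_self).mul ?_).aestronglyMeasurable measurableSet_Ioc
    exact ((continuous_kernelCut (by linarith) R).comp (by fun_prop)).continuousOn
  · filter_upwards [eventually_ge_atTop 0] with R hR
    have hne : ∀ᵐ τ : ℝ, τ ≠ t := by simp [ae_iff]
    filter_upwards [hne] with τ hτ hmem
    rw [Set.uIoc_of_le ht] at hmem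
    have : 0 < t - τ := sub_pos.2 (lt_of_le_of_ne hmem.2 hτ)
    rw [norm_mul]
    have h1 := hK R hR (t - τ) this.ne'
    rw [abs_of_pos this] at h1
    have h2 := hB τ ⟨hmem.1.le, hmem.2⟩
    exact mul_le_mul h2 h1 (norm_nonneg _) ((norm_nonneg _).trans h2)
  · have h := (intervalIntegral.intervalIntegrable_rpow' (a := 0) (b := t)
      (r := -(1 / (2 * s))) (by linarith)).comp_sub_left t
    simp only [sub_zero, sub_self] at h
    exact (h.symm.const_mul C).const_mul B
  · have hne : ∀ᵐ τ : ℝ, τ ≠ t := by simp [ae_iff]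
    filter_upwards [hne] with τ hτ hmem
    rw [Set.uIoc_of_le ht] at hmem
    have : 0 < t - τ := sub_pos.2 (lt_of_le_of_ne hmem.2 hτ)
    have h := (tendsto_kernelCut hs this).const_mul (N τ)
    convert! h using 2
    rw [div_eq_mul_inv]
    ring

/-! ### Sobolev functions on the Fourier side -/

/-- When the Fourier transform is integrable, its inverse Fourier integral is continuous. Testing
against smooth compactly supported functions shows that it represents `u`, so evaluation at `0`
removes the character. -/
lemma value_eq_integral {u : L2} (h : Integrable (𝓕 u : L2)) :
    value u 0 = ∫ ξ, (𝓕 u : L2) ξ := by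
  -- The minus sign makes the Fourier integral along `L` the inverse transform.
  set L : ℝ →ₗ[ℝ] ℝ →ₗ[ℝ] ℝ := -(innerₗ ℝ) with hL
  have hLc : Continuous fun p : ℝ × ℝ => (L p.1) p.2 := by
    simp only [hL, LinearMap.neg_apply, innerₗ_apply_apply]
    fun_prop
  set g : ℝ → ℂ := VectorFourier.fourierIntegral Real.fourierChar volume L (𝓕 u : L2) with hg
  have hgc : Continuous g :=
    VectorFourier.fourierIntegral_continuous Real.continuous_fourierChar hLc h
  have hae : u =ᵐ[volume] g := by
    apply ae_eq_of_integral_contDiff_smul_eq ((Lp.memLp u).locallyIntegrable (by norm_num))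
      hgc.locallyIntegrable
    intro φ φ_smooth φ_cpt
    have hφ₁ : HasCompactSupport (Complex.ofRealCLM ∘ φ) := φ_cpt.comp_left rfl
    have hφ₂ : ContDiff ℝ ∞ (Complex.ofRealCLM ∘ φ) := by fun_prop
    set Φ : 𝓢(ℝ, ℂ) := hφ₁.toSchwartzMap hφ₂ with hΦ
    have h1 : (u : 𝓢'(ℝ, ℂ)) Φ = ((𝓕 u : L2) : 𝓢'(ℝ, ℂ)) (𝓕⁻ Φ) := by
      rw [← TemperedDistribution.fourierInv_apply, Lp.fourierInv_toTemperedDistribution_eq,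
        fourierInv_fourier_eq]
    have h2 := VectorFourier.integral_fourierIntegral_smul_eq_flip (μ := volume) (ν := volume)
      (L := L) Real.continuous_fourierChar hLc Φ.integrable h
    have hflip : L.flip = L := by
      ext
      simp [hL]
    rw [hflip] at h2
    rw [Lp.toTemperedDistribution_apply, Lp.toTemperedDistribution_apply] at h1
    have h3 : ∀ ξ, VectorFourier.fourierIntegral Real.fourierChar volume L Φ ξ = (𝓕⁻ Φ) ξ := by
      intro ξ
      rw [SchwartzMap.fourierInv_coe, Real.fourierInv_eq, VectorFourier.fourierIntegral]
      simp [hL]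
    simp only [h3] at h2
    have h4 := h1.trans h2
    simpa [hΦ] using h4
  rw [value_eq_of_ae hgc hae, hg, VectorFourier.fourierIntegral]
  simp

/-- `U` is the Fourier transform of an element of `H^s`. -/
def FormInt (s : ℝ) (U : L2) : Prop := Integrable fun ξ => symb s ξ * ‖U ξ‖ ^ 2

/-- `(U, H)` lies on the graph of the Fourier side of the operator, with charge term `z`. -/
def Graph (s : ℝ) (U H : L2) (z : ℂ) : Prop := ∀ᵐ ξ, H ξ = (symb s ξ : ℂ) * U ξ + z

lemma integrable_norm_sq (U : L2) : Integrable fun ξ => ‖U ξ‖ ^ 2 :=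
  (memLp_two_iff_integrable_sq_norm (Lp.memLp U).1).1 (Lp.memLp U)

lemma norm_sq_eq_integral (U : L2) : ‖U‖ ^ 2 = ∫ ξ, ‖U ξ‖ ^ 2 := by
  have h := L2.inner_def (𝕜 := ℂ) U U
  rw [inner_self_eq_norm_sq_to_K] at h
  have h2 : ∀ ξ, inner ℂ (U ξ) (U ξ) = ((‖U ξ‖ ^ 2 : ℝ) : ℂ) := fun ξ => by
    rw [inner_self_eq_norm_sq_to_K]
    push_cast
    rfl
  simp_rw [h2] at h
  rw [integral_complex_ofReal] at h
  have h3 : ((‖U‖ ^ 2 : ℝ) : ℂ) = (RCLike.ofReal ‖U‖ : ℂ) ^ 2 := by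
    push_cast
    rfl
  exact Complex.ofReal_injective (h3.trans h)

lemma integrable_inv_symb_add {s μ : ℝ} (hs : 1 / 2 < s) (hμ : 0 < μ) :
    Integrable fun ξ => (symb s ξ + μ)⁻¹ := by
  obtain ⟨C, hC, hle⟩ := weight_le (by linarith : 0 ≤ s) hμ
  have h := integrable_rpow_neg_one_add_norm_sq (E := ℝ) (μ := volume) (r := 2 * s)
    (by simp; linarith)
  have hm := measurable_symb s
  refine (h.const_mul C).mono' (by fun_prop) (Eventually.of_forall fun ξ => ?_)
  have h0 := symb_nonneg s ξ
  have hp : 0 < symb s ξ + μ := by linarith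
  rw [Real.norm_of_nonneg (inv_nonneg.2 hp.le), show -(2 * s) / 2 = -s by ring,
    Real.rpow_neg (by positivity), ← div_eq_mul_inv, inv_eq_one_div,
    div_le_div_iff₀ hp (by positivity), one_mul]
  exact hle ξ

/-- The integral `∫ (|k|^{2s} + 1)⁻¹`. -/
def greenInt (s : ℝ) : ℝ := ∫ ξ, (symb s ξ + 1)⁻¹

lemma greenInt_pos {s : ℝ} (hs : 1 / 2 < s) : 0 < greenInt s := by
  have h : ∀ ξ, 0 < (symb s ξ + 1)⁻¹ := fun ξ => by
    have := symb_nonneg s ξ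
    positivity
  rw [greenInt, integral_pos_iff_support_of_nonneg (fun ξ => (h ξ).le)
    (integrable_inv_symb_add hs one_pos)]
  have : Function.support (fun ξ => (symb s ξ + 1)⁻¹) = Set.univ :=
    Set.eq_univ_of_forall fun ξ => (h ξ).ne'
  simp [this]

/-- Scaling `ξ ↦ μ^{1/(2s)} ξ`. The exponent of `μ` is negative, so the constant is small for large
`μ`, which `exists_norm_integral_sq_le` exploits. -/
lemma integral_inv_symb_add {s μ : ℝ} (hs : 1 / 2 < s) (hμ : 0 < μ) :
    ∫ ξ, (symb s ξ + μ)⁻¹ = μ ^ (1 / (2 * s) - 1) * greenInt s := by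
  have hc : 0 < μ ^ (1 / (2 * s)) := Real.rpow_pos_of_pos hμ _
  have h := Measure.integral_comp_mul_left (fun ξ => (symb s ξ + μ)⁻¹) (μ ^ (1 / (2 * s)))
  have h2 : ∀ ξ, symb s (μ ^ (1 / (2 * s)) * ξ) = μ * symb s ξ := by
    intro ξ
    rw [symb, symb, show 2 * Real.pi * (μ ^ (1 / (2 * s)) * ξ) =
      μ ^ (1 / (2 * s)) * (2 * Real.pi * ξ) by ring, abs_mul, Real.mul_rpow (abs_nonneg _)
      (abs_nonneg _), abs_of_pos hc, ← Real.rpow_mul hμ.le, one_div_mul_cancel (by linarith),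
      Real.rpow_one]
  have h3 : ∀ ξ, (symb s (μ ^ (1 / (2 * s)) * ξ) + μ)⁻¹ = μ⁻¹ * (symb s ξ + 1)⁻¹ := by
    intro ξ
    rw [h2, ← mul_inv]
    congr 1
    ring
  simp_rw [h3] at h
  rw [integral_const_mul, smul_eq_mul, abs_of_pos (inv_pos.2 hc)] at h
  rw [Real.rpow_sub hμ, Real.rpow_one, greenInt]
  field_simp at h ⊢
  linarith

/-- Young's inequality `2x ≤ (εw)⁻¹ + εw x²` with `w = symb + μ`. Being pointwise, it yields both
integrability and the interpolation inequality upon integration. -/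
lemma norm_le_of_weight {s μ ε : ℝ} (hμ : 0 < μ) (hε : 0 < ε) (ξ : ℝ) (x : ℝ) :
    x ≤ (ε⁻¹ * (symb s ξ + μ)⁻¹ + ε * (symb s ξ * x ^ 2 + μ * x ^ 2)) / 2 := by
  have h0 := symb_nonneg s ξ
  set w := symb s ξ + μ with hw
  have hp : 0 < w := by linarith
  have e : symb s ξ * x ^ 2 + μ * x ^ 2 = w * x ^ 2 := by rw [hw]; ring
  rw [e]
  have h1 : 0 ≤ (ε * w)⁻¹ * (ε * w * x - 1) ^ 2 := by positivity
  have h2 : (ε * w)⁻¹ * (ε * w * x - 1) ^ 2 = ε⁻¹ * w⁻¹ + ε * (w * x ^ 2) - 2 * x := by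
    field_simp
    ring
  linarith

lemma FormInt.integrable {s : ℝ} (hs : 1 / 2 < s) {U : L2} (hU : FormInt s U) :
    Integrable U := by
  refine ((((integrable_inv_symb_add hs one_pos).const_mul 1⁻¹).add
    ((hU.add ((integrable_norm_sq U).const_mul 1)).const_mul 1)).div_const 2).mono' (Lp.memLp U).1
    (Eventually.of_forall fun ξ => ?_)
  exact norm_le_of_weight one_pos one_pos ξ _

/-- The Gagliardo–Nirenberg inequality before optimisation. -/
lemma FormInt.norm_integral_sq_le {s μ : ℝ} (hs : 1 / 2 < s) (hμ : 0 < μ) {U : L2}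
    (hU : FormInt s U) :
    ‖∫ ξ, U ξ‖ ^ 2 ≤ μ ^ (1 / (2 * s) - 1) * greenInt s *
      ((∫ ξ, symb s ξ * ‖U ξ‖ ^ 2) + μ * ‖U‖ ^ 2) := by
  set A := μ ^ (1 / (2 * s) - 1) * greenInt s with hA
  set B := (∫ ξ, symb s ξ * ‖U ξ‖ ^ 2) + μ * ‖U‖ ^ 2 with hB
  have hApos : 0 < A := mul_pos (Real.rpow_pos_of_pos hμ _) (greenInt_pos hs)
  have hBnn : 0 ≤ B := add_nonneg (integral_nonneg fun ξ =>
    mul_nonneg (symb_nonneg s ξ) (by positivity)) (by positivity)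
  have key : ∀ ε : ℝ, 0 < ε → ‖∫ ξ, U ξ‖ ≤ (ε⁻¹ * A + ε * B) / 2 := by
    intro ε hε
    have hi1 := (integrable_inv_symb_add hs hμ).const_mul ε⁻¹
    have hi2 := (hU.add ((integrable_norm_sq U).const_mul μ)).const_mul ε
    calc ‖∫ ξ, U ξ‖ ≤ ∫ ξ, ‖U ξ‖ := norm_integral_le_integral_norm _
      _ ≤ ∫ ξ, (ε⁻¹ * (symb s ξ + μ)⁻¹ + ε * (symb s ξ * ‖U ξ‖ ^ 2 + μ * ‖U ξ‖ ^ 2)) / 2 :=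
          integral_mono (hU.integrable hs).norm ((hi1.add hi2).div_const 2)
            fun ξ => norm_le_of_weight hμ hε ξ _
      _ = _ := by
          have e1 : ∫ ξ, (symb s ξ * ‖U ξ‖ ^ 2 + μ * ‖U ξ‖ ^ 2) = B := by
            rw [hB, norm_sq_eq_integral, ← integral_const_mul]
            exact integral_add hU ((integrable_norm_sq U).const_mul μ)
          rw [integral_div, ← integral_inv_symb_add hs hμ |>.trans hA.symm, ← e1,
            ← integral_const_mul, ← integral_const_mul]
          congr 1
          exact integral_add hi1 hi2
  rcases (norm_nonneg (∫ ξ, U ξ)).eq_or_lt with h0 | h0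
  · rw [← h0]
    simpa using mul_nonneg hApos.le hBnn
  · set Q := ‖∫ ξ, U ξ‖
    -- The optimal `ε`: the first term becomes `Q` itself, half of which is absorbed by the left
    -- side.
    have h := key (A / Q) (by positivity)
    have h2 : (A / Q)⁻¹ * A = Q := by field_simp
    rw [h2] at h
    have h3 : Q ≤ A / Q * B := by linarith
    have h4 : Q * Q ≤ A / Q * B * Q := mul_le_mul_of_nonneg_right h3 h0.le
    have h5 : A / Q * B * Q = A * B := by field_simp
    nlinarith

/-- The Gagliardo–Nirenberg inequality. -/
lemma FormInt.gagliardo_nirenberg {s : ℝ} (hs : 1 / 2 < s) {U : L2} (hU : FormInt s U) :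
    ‖∫ ξ, U ξ‖ ^ (4 * s) ≤
      (2 * greenInt s) ^ (2 * s) * ‖U‖ ^ (4 * s - 2) * ∫ ξ, symb s ξ * ‖U ξ‖ ^ 2 := by
  have hκ := greenInt_pos hs
  set K := ∫ ξ, symb s ξ * ‖U ξ‖ ^ 2 with hK
  have hKnn : 0 ≤ K := integral_nonneg fun ξ => mul_nonneg (symb_nonneg s ξ) (by positivity)
  set Q := ‖∫ ξ, U ξ‖ with hQ
  rcases (norm_nonneg (∫ ξ, U ξ)).eq_or_lt with h0 | h0
  · rw [← hQ] at h0
    rw [← h0, Real.zero_rpow (by linarith)]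
    positivity
  rw [← hQ] at h0
  have hM : 0 < ‖U‖ := by
    rw [norm_pos_iff]
    rintro rfl
    have : ∫ ξ, ((0 : L2) : ℝ → ℂ) ξ = 0 := by
      rw [integral_congr_ae (Lp.coeFn_zero ℂ 2 volume)]
      simp
    rw [hQ, this, norm_zero] at h0
    exact lt_irrefl _ h0
  set M := ‖U‖
  -- The parameter will be `μ = x^{2s}`, with `x` such that the mass term on the right equals `Q²/2`
  -- and is absorbed.
  set x := Q ^ 2 / (2 * greenInt s * M ^ 2) with hx
  have hxpos : 0 < x := by positivity
  have hμ : 0 < x ^ (2 * s) := by positivity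
  have h := hU.norm_integral_sq_le hs hμ
  have e1 : (x ^ (2 * s)) ^ (1 / (2 * s) - 1) = x * (x ^ (2 * s))⁻¹ := by
    rw [Real.rpow_sub hμ, Real.rpow_one, ← Real.rpow_mul hxpos.le,
      mul_one_div_cancel (by linarith), Real.rpow_one, div_eq_mul_inv]
  rw [e1] at h
  have h2 : x * (x ^ (2 * s))⁻¹ * greenInt s * (K + x ^ (2 * s) * M ^ 2) =
      x * (x ^ (2 * s))⁻¹ * greenInt s * K + Q ^ 2 / 2 := by
    have : x * greenInt s * M ^ 2 = Q ^ 2 / 2 := by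
      rw [hx]
      field_simp
    rw [← this]
    field_simp
  have h3 : Q ^ 2 / 2 ≤ x * (x ^ (2 * s))⁻¹ * greenInt s * K := by
    change Q ^ 2 ≤ x * (x ^ (2 * s))⁻¹ * greenInt s * (K + x ^ (2 * s) * M ^ 2) at h
    rw [h2] at h
    linarith
  have h4 : x ^ (2 * s) * M ^ 2 ≤ K := by
    have e : Q ^ 2 / 2 = x * greenInt s * M ^ 2 := by
      rw [hx]
      field_simp
    rw [e] at h3
    have h5 : (x * greenInt s) * (x ^ (2 * s) * M ^ 2) ≤ (x * greenInt s) * K := by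
      have := mul_le_mul_of_nonneg_left h3 hμ.le
      calc _ = x ^ (2 * s) * (x * greenInt s * M ^ 2) := by ring
        _ ≤ _ := this
        _ = x * greenInt s * K * (x ^ (2 * s) * (x ^ (2 * s))⁻¹) := by ring
        _ = _ := by rw [mul_inv_cancel₀ hμ.ne', mul_one]
    exact le_of_mul_le_mul_left h5 (by positivity)
  have h6 : x ^ (2 * s) = Q ^ (4 * s) / ((2 * greenInt s) ^ (2 * s) * M ^ (4 * s)) := by
    rw [hx, Real.div_rpow (by positivity) (by positivity), Real.mul_rpow (by positivity)
      (by positivity), ← Real.rpow_natCast_mul (by positivity), ← Real.rpow_natCast_mul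
      (by positivity)]
    push_cast
    ring_nf
  rw [h6] at h4
  have h7 : M ^ (4 * s - 2) = M ^ (4 * s) / M ^ 2 := by
    rw [Real.rpow_sub hM, Real.rpow_two]
  rw [h7]
  have hM4 : 0 < M ^ (4 * s) := by positivity
  have hk4 : 0 < (2 * greenInt s) ^ (2 * s) := by positivity
  rw [div_mul_eq_mul_div, div_le_iff₀ (by positivity)] at h4
  calc Q ^ (4 * s) = Q ^ (4 * s) * M ^ 2 / M ^ 2 := by field_simp
    _ ≤ K * ((2 * greenInt s) ^ (2 * s) * M ^ (4 * s)) / M ^ 2 := by gcongr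
    _ = _ := by ring

/-- The interpolation inequality with a small constant in front of the form. -/
lemma exists_norm_integral_sq_le {s ε : ℝ} (hs : 1 / 2 < s) (hε : 0 < ε) :
    ∃ C : ℝ, 0 < C ∧ ∀ U : L2, FormInt s U →
      ‖∫ ξ, U ξ‖ ^ 2 ≤ ε * (∫ ξ, symb s ξ * ‖U ξ‖ ^ 2) + C * ‖U‖ ^ 2 := by
  have hκ := greenInt_pos hs
  have hα : 1 / (2 * s) < 1 := by
    rw [div_lt_one (by linarith)]
    linarith
  have h : Tendsto (fun μ : ℝ => μ ^ (-(1 - 1 / (2 * s))) * greenInt s) atTop (𝓝 (0 * greenInt s)) :=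
    (tendsto_rpow_neg_atTop (by linarith)).mul_const _
  rw [zero_mul] at h
  obtain ⟨μ, hμ1, hμ2⟩ := ((h.eventually (gt_mem_nhds hε)).and (eventually_gt_atTop 0)).exists
  rw [show -(1 - 1 / (2 * s)) = 1 / (2 * s) - 1 by ring] at hμ1
  refine ⟨ε * μ, by positivity, fun U hU => ?_⟩
  have hnn : 0 ≤ ∫ ξ, symb s ξ * ‖U ξ‖ ^ 2 :=
    integral_nonneg fun ξ => mul_nonneg (symb_nonneg s ξ) (by positivity)
  calc _ ≤ _ := hU.norm_integral_sq_le hs hμ2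
    _ ≤ ε * ((∫ ξ, symb s ξ * ‖U ξ‖ ^ 2) + μ * ‖U‖ ^ 2) := by gcongr
    _ = _ := by ring

lemma formInt_iff_memSobolev {s : ℝ} (hs : 0 ≤ s) (u : L2) :
    FormInt s (𝓕 u : L2) ↔ TemperedDistribution.MemSobolev s 2 (u : 𝓢'(ℝ, ℂ)) := by
  have hw : Continuous (fun ξ : ℝ => (((1 + ‖ξ‖ ^ 2) ^ (s / 2) : ℝ) : ℂ)) := by
    refine Complex.continuous_ofReal.comp (Continuous.rpow_const (by fun_prop) fun x => ?_)
    left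
    positivity
  have hmeas : AEStronglyMeasurable
      (fun ξ : ℝ => (((1 + ‖ξ‖ ^ 2) ^ (s / 2) : ℝ) : ℂ) * (𝓕 u : L2) ξ) volume :=
    hw.aestronglyMeasurable.mul (Lp.memLp (𝓕 u : L2)).1
  rw [memSobolev_iff, memLp_two_iff_integrable_sq_norm hmeas]
  have e : ∀ ξ, ‖(((1 + ‖ξ‖ ^ 2) ^ (s / 2) : ℝ) : ℂ) * (𝓕 u : L2) ξ‖ ^ 2 =
      (1 + ‖ξ‖ ^ 2) ^ s * ‖(𝓕 u : L2) ξ‖ ^ 2 := by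
    intro ξ
    rw [norm_mul, Complex.norm_real, mul_pow, Real.norm_of_nonneg (by positivity),
      ← Real.rpow_mul_natCast (by positivity)]
    congr 2
    push_cast
    ring
  have hm2 := (measurable_symb s).aestronglyMeasurable (μ := volume)
  constructor
  · intro h
    obtain ⟨C, hC, hle⟩ := weight_le hs one_pos
    refine ((h.add (integrable_norm_sq (𝓕 u : L2))).const_mul C).mono' (hmeas.norm.pow 2)
      (Eventually.of_forall fun ξ => ?_)
    simp only [Pi.add_apply, e]
    rw [Real.norm_of_nonneg (by positivity)]
    calc _ ≤ C * (symb s ξ + 1) * ‖(𝓕 u : L2) ξ‖ ^ 2 := by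
          gcongr
          exact hle ξ
      _ = _ := by ring
  · intro h
    refine (h.const_mul (((2 * Real.pi) ^ 2) ^ s)).mono'
      (hm2.mul ((Lp.memLp (𝓕 u : L2)).1.norm.pow 2)) (Eventually.of_forall fun ξ => ?_)
    simp only [e]
    rw [Real.norm_of_nonneg (mul_nonneg (symb_nonneg s ξ) (by positivity)), ← mul_assoc]
    gcongr
    exact symb_le hs ξ

/-- With `w = symb + 1` one has `w U = H + U - z`, hence `symb |U|² ≤ w⁻¹ |H + U - z|²`. The
constant `z` is not in `L²`, but `|z|² w⁻¹` is integrable since `2s > 1`. -/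
lemma Graph.formInt {s : ℝ} (hs : 1 / 2 < s) {U H : L2} {z : ℂ} (h : Graph s U H z) :
    FormInt s U := by
  have hm2 := (measurable_symb s).aestronglyMeasurable (μ := volume)
  refine ((((integrable_norm_sq H).add (integrable_norm_sq U)).add
    ((integrable_inv_symb_add hs one_pos).const_mul (‖z‖ ^ 2))).const_mul 3).mono'
    (hm2.mul ((Lp.memLp U).1.norm.pow 2)) ?_
  filter_upwards [h] with ξ hξ
  have h0 := symb_nonneg s ξ
  rw [Real.norm_of_nonneg (mul_nonneg h0 (by positivity))]
  simp only [Pi.add_apply]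
  set w := symb s ξ + 1 with hw
  have hw1 : 1 ≤ w := by linarith
  have e : (w : ℂ) * U ξ = H ξ + U ξ - z := by
    rw [hξ, hw]
    push_cast
    ring
  have h1 : w * ‖U ξ‖ ≤ ‖H ξ‖ + ‖U ξ‖ + ‖z‖ := by
    have := congrArg norm e
    rw [norm_mul, Complex.norm_real, Real.norm_of_nonneg (by linarith)] at this
    rw [this]
    exact (norm_sub_le _ _).trans (by gcongr; exact norm_add_le _ _)
  have h2 : (w * ‖U ξ‖) ^ 2 ≤ 3 * (‖H ξ‖ ^ 2 + ‖U ξ‖ ^ 2 + ‖z‖ ^ 2) := by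
    have := pow_le_pow_left₀ (by positivity) h1 2
    nlinarith [sq_nonneg (‖H ξ‖ - ‖U ξ‖), sq_nonneg (‖H ξ‖ - ‖z‖), sq_nonneg (‖U ξ‖ - ‖z‖)]
  have h3 : symb s ξ * ‖U ξ‖ ^ 2 ≤ w⁻¹ * (w * ‖U ξ‖) ^ 2 := by
    have : w⁻¹ * (w * ‖U ξ‖) ^ 2 = w * ‖U ξ‖ ^ 2 := by field_simp
    rw [this]
    gcongr
    linarith
  have hwi : w⁻¹ ≤ 1 := inv_le_one_of_one_le₀ hw1
  have hwp : 0 < w⁻¹ := by positivity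
  calc _ ≤ _ := h3
    _ ≤ w⁻¹ * (3 * (‖H ξ‖ ^ 2 + ‖U ξ‖ ^ 2 + ‖z‖ ^ 2)) := by gcongr
    _ = 3 * (w⁻¹ * (‖H ξ‖ ^ 2 + ‖U ξ‖ ^ 2) + ‖z‖ ^ 2 * w⁻¹) := by ring
    _ ≤ 3 * (1 * (‖H ξ‖ ^ 2 + ‖U ξ‖ ^ 2) + ‖z‖ ^ 2 * w⁻¹) := by gcongr
    _ = _ := by ring

lemma fourier_regularPart {s σ β lam : ℝ} (hs : 1 / 2 < s) (hlam : 0 < lam) (ψ : L2) :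
    (𝓕 (regularPart s σ β lam ψ) : L2) =ᵐ[volume]
      fun ξ => (𝓕 ψ : L2) ξ + nonlin σ β (value ψ 0) * greenHat s lam ξ := by
  rw [regularPart, FourierTransform.fourier_add, FourierTransform.fourier_smul]
  filter_upwards [Lp.coeFn_add (𝓕 ψ : L2) (nonlin σ β (value ψ 0) • (𝓕 (green s lam) : L2)),
    Lp.coeFn_smul (nonlin σ β (value ψ 0)) (𝓕 (green s lam) : L2),
    fourier_green hs hlam] with ξ h1 h2 h3
  rw [h1, Pi.add_apply, h2, Pi.smul_apply, h3, smul_eq_mul]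

/-- The transform of the Green's function is `(symb + 1)⁻¹`, so `symb` applied to the regular part,
plus the remaining multiple of the Green's function, adds up to `symb · 𝓕 ψ` plus the bare charge
term. -/
lemma graph_opH_of_memSobolev {s σ β : ℝ} (hs : 1 / 2 < s) {ψ : L2}
    (h : TemperedDistribution.MemSobolev (2 * s) 2 (regularPart s σ β 1 ψ : 𝓢'(ℝ, ℂ))) :
    Graph s (𝓕 ψ : L2) (𝓕 (opH s σ β ψ) : L2) (nonlin σ β (value ψ 0)) := by
  have hm := memLp_symb_of_memSobolev (by linarith : 0 ≤ s) h
  have e : opH s σ β ψ =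
      fracLaplacian s (regularPart s σ β 1 ψ) + nonlin σ β (value ψ 0) • green s 1 := by
    rw [opH]
    nth_rewrite 2 [regularPart]
    abel
  unfold Graph
  rw [e, FourierTransform.fourier_add, FourierTransform.fourier_smul]
  filter_upwards [Lp.coeFn_add (𝓕 (fracLaplacian s (regularPart s σ β 1 ψ)) : L2)
      (nonlin σ β (value ψ 0) • (𝓕 (green s 1) : L2)),
    Lp.coeFn_smul (nonlin σ β (value ψ 0)) (𝓕 (green s 1) : L2),
    fourier_green hs one_pos, fourier_fourierMul hm, fourier_regularPart hs one_pos ψ]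
    with ξ h1 h2 h3 h4 h5
  have h0 := symb_nonneg s ξ
  have hq : ((symb s ξ : ℂ) + 1) ≠ 0 := by
    exact_mod_cast (by linarith : symb s ξ + 1 ≠ 0)
  rw [h1, Pi.add_apply, h2, Pi.smul_apply, h3, fracLaplacian, h4, h5, smul_eq_mul, greenHat]
  push_cast
  field_simp
  ring

lemma formInt_of_mem_domain {s σ β : ℝ} (hs : 1 / 2 < s) {ψ : L2} (h : ψ ∈ domain s σ β) :
    FormInt s (𝓕 ψ : L2) :=
  (formInt_iff_memSobolev (by linarith) ψ).2 h.1

lemma graph_of_mem_domain {s σ β : ℝ} (hs : 1 / 2 < s) {ψ : L2} (h : ψ ∈ domain s σ β) :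
    Graph s (𝓕 ψ : L2) (𝓕 (opH s σ β ψ) : L2) (nonlin σ β (value ψ 0)) :=
  graph_opH_of_memSobolev hs (memSobolev_regularPart hs one_pos h)

lemma value_of_mem_domain {s σ β : ℝ} (hs : 1 / 2 < s) {ψ : L2} (h : ψ ∈ domain s σ β) :
    value ψ 0 = ∫ ξ, (𝓕 ψ : L2) ξ :=
  value_eq_integral ((formInt_of_mem_domain hs h).integrable hs)

/-- A point of the graph gives an element of the domain. -/
lemma mem_domain_of_graph {s σ β : ℝ} (hs : 1 / 2 < s) {ψ H : L2}
    (h : Graph s (𝓕 ψ : L2) H (nonlin σ β (∫ ξ, (𝓕 ψ : L2) ξ))) :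
    ψ ∈ domain s σ β ∧ (𝓕 (opH s σ β ψ) : L2) = H := by
  have hF := h.formInt hs
  have hv := value_eq_integral (hF.integrable hs)
  rw [← hv] at h
  obtain ⟨C, hC, hle⟩ := weight_le (by linarith : 0 ≤ s) one_pos
  have hreg : TemperedDistribution.MemSobolev (2 * s) 2
      (regularPart s σ β 1 ψ : 𝓢'(ℝ, ℂ)) := by
    rw [memSobolev_iff]
    have hcont : Continuous (fun ξ : ℝ => (((1 + ‖ξ‖ ^ 2) ^ (2 * s / 2) : ℝ) : ℂ)) := by
      refine Complex.continuous_ofReal.comp (Continuous.rpow_const (by fun_prop) fun x => ?_)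
      left
      positivity
    refine (((Lp.memLp H).add (Lp.memLp (𝓕 ψ : L2))).norm.const_mul C).mono'
      (hcont.aestronglyMeasurable.mul (Lp.memLp _).1) ?_
    filter_upwards [h, fourier_regularPart hs one_pos ψ] with ξ h1 h2
    have h0 := symb_nonneg s ξ
    have hp : 0 < symb s ξ + 1 := by linarith
    -- The charge term cancels: the regular part is the resolvent of `(-Δ)^s` at `-1` applied to `H
    -- + 𝓕 ψ`, and this gains the full `2s` derivatives.
    have e : (𝓕 (regularPart s σ β 1 ψ) : L2) ξ =
        (((symb s ξ + 1)⁻¹ : ℝ) : ℂ) * (H ξ + (𝓕 ψ : L2) ξ) := by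
      have hq : ((symb s ξ : ℂ) + 1) ≠ 0 := by exact_mod_cast hp.ne'
      rw [h2, h1, greenHat]
      push_cast
      field_simp
      ring
    rw [e, ← mul_assoc, norm_mul, ← Complex.ofReal_mul, Complex.norm_real, Pi.add_apply,
      Real.norm_of_nonneg (by positivity), mul_div_cancel_left₀ s two_ne_zero]
    gcongr
    rw [← div_eq_mul_inv, div_le_iff₀ hp]
    exact hle ξ
  refine ⟨⟨(formInt_iff_memSobolev (by linarith) ψ).1 hF, 1, one_pos, hreg⟩, Lp.ext ?_⟩
  filter_upwards [graph_opH_of_memSobolev hs hreg, h] with ξ h1 h2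
  rw [h1, h2]

/-! ### Weakly singular Volterra equations -/

/-- The measure `τ^{-α} dτ` on `(0, ∞)`. -/
def weakSing (α : ℝ) : Measure ℝ :=
  (volume.restrict (Set.Ioi 0)).withDensity fun τ => ENNReal.ofReal (τ ^ (-α))

lemma measurable_weakSing_density (α : ℝ) :
    Measurable fun τ : ℝ => ENNReal.ofReal (τ ^ (-α)) := by
  fun_prop

instance (α : ℝ) : SFinite (weakSing α) := by
  unfold weakSing
  infer_instance

lemma ae_weakSing_pos (α : ℝ) : ∀ᵐ τ ∂(weakSing α), 0 < τ :=
  (withDensity_absolutelyContinuous _ _).ae_le (ae_restrict_mem measurableSet_Ioi)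

lemma lintegral_weakSing (α : ℝ) {f : ℝ → ℝ≥0∞} (hf : Measurable f) :
    ∫⁻ τ, f τ ∂(weakSing α) = ∫⁻ τ in Set.Ioi 0, ENNReal.ofReal (τ ^ (-α)) * f τ := by
  rw [weakSing, lintegral_withDensity_eq_lintegral_mul _ (measurable_weakSing_density α) hf]
  rfl

lemma lintegral_exp_weakSing {α γ : ℝ} (hα : α < 1) (hγ : 0 < γ) :
    ∫⁻ τ, ENNReal.ofReal (Real.exp (-γ * τ)) ∂(weakSing α) =
      ENNReal.ofReal ((1 / γ) ^ (1 - α) * Real.Gamma (1 - α)) := by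
  rw [lintegral_weakSing α (by fun_prop)]
  have h := Real.integral_rpow_mul_exp_neg_mul_Ioi (a := 1 - α) (r := γ) (by linarith) hγ
  have hpos : 0 < (1 / γ) ^ (1 - α) * Real.Gamma (1 - α) :=
    mul_pos (by positivity) (Real.Gamma_pos_of_pos (by linarith))
  -- The integral of a non-integrable function is `0` by convention, so the positive value of the
  -- Gamma integral forces integrability.
  have hint : Integrable (fun t : ℝ => t ^ (1 - α - 1) * Real.exp (-(γ * t)))
      (volume.restrict (Set.Ioi 0)) := by
    by_contra hcon
    rw [integral_undef hcon] at h
    exact hpos.ne h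
  rw [← h, ofReal_integral_eq_lintegral_ofReal hint]
  · refine setLIntegral_congr_fun measurableSet_Ioi fun τ hτ => ?_
    rw [← ENNReal.ofReal_mul (Real.rpow_nonneg (le_of_lt hτ) _)]
    congr 2
    · congr 1
      ring
    · ring_nf
  · filter_upwards [ae_restrict_mem measurableSet_Ioi] with τ hτ
    have : 0 < τ := hτ
    simp only [Pi.zero_apply]
    positivity

lemma integrable_exp_weakSing {α γ : ℝ} (hα : α < 1) (hγ : 0 < γ) :
    Integrable (fun τ => Real.exp (-γ * τ)) (weakSing α) := by
  refine ⟨by fun_prop, ?_⟩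
  rw [HasFiniteIntegral]
  have : ∀ τ, ‖Real.exp (-γ * τ)‖ₑ = ENNReal.ofReal (Real.exp (-γ * τ)) := fun τ =>
    Real.enorm_of_nonneg (Real.exp_pos _).le
  simp_rw [this, lintegral_exp_weakSing hα hγ]
  exact ENNReal.ofReal_lt_top

/-- The damped mass is `γ^{-(1-α)} Γ(1-α)`. A strong exponential weight therefore makes the Volterra
operator a contraction on an interval of any length, without splitting time into short steps. -/
lemma eventually_lintegral_exp_le {α : ℝ} (hα : α < 1) (K : ℝ) :
    ∀ᶠ γ : ℝ in atTop, 0 < γ ∧ ENNReal.ofReal K *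
      ∫⁻ τ, ENNReal.ofReal (Real.exp (-γ * τ)) ∂(weakSing α) ≤ 2⁻¹ := by
  have h1 : Tendsto (fun γ : ℝ => γ ^ (-(1 - α))) atTop (𝓝 0) :=
    tendsto_rpow_neg_atTop (by linarith)
  have h2 : Tendsto (fun γ : ℝ => K * (γ ^ (-(1 - α)) * Real.Gamma (1 - α))) atTop (𝓝 0) := by
    simpa using (h1.mul_const (Real.Gamma (1 - α))).const_mul K
  filter_upwards [h2.eventually (gt_mem_nhds (by norm_num : (0 : ℝ) < 2⁻¹)),
    eventually_gt_atTop 0] with γ h3 h4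
  refine ⟨h4, ?_⟩
  rcases le_total K 0 with hK | hK
  · rw [ENNReal.ofReal_of_nonpos hK, zero_mul]
    exact zero_le
  rw [lintegral_exp_weakSing hα h4, ← ENNReal.ofReal_mul hK, one_div, Real.inv_rpow h4.le,
    ← Real.rpow_neg h4.le]
  refine (ENNReal.ofReal_le_ofReal h3.le).trans ?_
  rw [ENNReal.ofReal_inv_of_pos two_pos]
  simp

/-- Gronwall's lemma for weakly singular Volterra inequalities, with exponential weights. -/
lemma eq_zero_of_le_lintegral_weakSing {α γ : ℝ} {K C : ℝ≥0∞} {e : ℝ → ℝ≥0∞} {b : ℝ}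
    (hC : C ≠ ⊤)
    (hγ : K * ∫⁻ τ, ENNReal.ofReal (Real.exp (-γ * τ)) ∂(weakSing α) ≤ 2⁻¹)
    (hbd : ∀ t ≤ b, e t ≤ C * ENNReal.ofReal (Real.exp (γ * t)))
    (he : ∀ t ≤ b, e t ≤ K * ∫⁻ τ, e (t - τ) ∂(weakSing α)) :
    ∀ t ≤ b, e t = 0 := by
  -- Each insertion of the inequality into itself reproduces the weight `e^{γt}` and gains a factor
  -- `1/2`.
  have key : ∀ n : ℕ, ∀ t ≤ b, e t ≤ 2⁻¹ ^ n * C * ENNReal.ofReal (Real.exp (γ * t)) := by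
    intro n
    induction n with
    | zero => simpa using hbd
    | succ n ih =>
      intro t ht
      calc e t ≤ K * ∫⁻ τ, e (t - τ) ∂(weakSing α) := he t ht
        _ ≤ K * ∫⁻ τ, (2⁻¹ ^ n * C * ENNReal.ofReal (Real.exp (γ * t))) *
            ENNReal.ofReal (Real.exp (-γ * τ)) ∂(weakSing α) := by
            refine mul_le_mul_right (lintegral_mono_ae ?_) _
            filter_upwards [ae_weakSing_pos α] with τ hτ
            refine (ih (t - τ) (by linarith)).trans (le_of_eq ?_)
            rw [mul_assoc (2⁻¹ ^ n * C), ← ENNReal.ofReal_mul (Real.exp_pos _).le, ← Real.exp_add]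
            ring_nf
        _ = (2⁻¹ ^ n * C * ENNReal.ofReal (Real.exp (γ * t))) *
            (K * ∫⁻ τ, ENNReal.ofReal (Real.exp (-γ * τ)) ∂(weakSing α)) := by
            rw [lintegral_const_mul _ (by fun_prop)]
            ring
        _ ≤ (2⁻¹ ^ n * C * ENNReal.ofReal (Real.exp (γ * t))) * 2⁻¹ := by gcongr
        _ = _ := by rw [pow_succ]; ring
  intro t ht
  have hlim : Tendsto (fun n : ℕ => (2⁻¹ : ℝ≥0∞) ^ n * (C * ENNReal.ofReal (Real.exp (γ * t))))
      atTop (𝓝 0) := by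
    have h := ENNReal.Tendsto.mul_const (b := C * ENNReal.ofReal (Real.exp (γ * t)))
      (ENNReal.tendsto_pow_atTop_nhds_zero_of_lt_one (r := 2⁻¹) (by simp))
      (Or.inr (ENNReal.mul_ne_top hC ENNReal.ofReal_ne_top))
    simpa using h
  refine le_antisymm (ge_of_tendsto' hlim fun n => ?_) (zero_le)
  rw [← mul_assoc]
  exact key n t ht

/-- Since `e` vanishes before `a`, a uniform bound `C` is also the exponential bound `C e^{-γa}
e^{γt}` required for the weighted argument. -/
lemma eq_zero_of_le_lintegral_weakSing_of_bounded {α : ℝ} (hα : α < 1) {K : ℝ} {C : ℝ≥0∞}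
    {e : ℝ → ℝ≥0∞} {a b : ℝ} (hC : C ≠ ⊤) (hbd : ∀ t ≤ b, e t ≤ C) (ha : ∀ t < a, e t = 0)
    (he : ∀ t ≤ b, e t ≤ ENNReal.ofReal K * ∫⁻ τ, e (t - τ) ∂(weakSing α)) :
    ∀ t ≤ b, e t = 0 := by
  obtain ⟨γ, hγ0, hγ⟩ := (eventually_lintegral_exp_le hα K).exists
  refine eq_zero_of_le_lintegral_weakSing (C := C * ENNReal.ofReal (Real.exp (-γ * a)))
    (ENNReal.mul_ne_top hC ENNReal.ofReal_ne_top) hγ (fun t ht => ?_) he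
  rcases lt_or_ge t a with h | h
  · rw [ha t h]
    exact zero_le
  · calc e t ≤ C * 1 := by rw [mul_one]; exact hbd t ht
      _ ≤ C * ENNReal.ofReal (Real.exp (-γ * a) * Real.exp (γ * t)) := by
        gcongr
        rw [← Real.exp_add, ENNReal.one_le_ofReal, Real.one_le_exp_iff]
        nlinarith
      _ = _ := by rw [ENNReal.ofReal_mul (Real.exp_pos _).le, mul_assoc]

lemma integral_weakSing (α : ℝ) (f : ℝ → ℂ) :
    ∫ τ, f τ ∂(weakSing α) = ∫ τ in Set.Ioi 0, ((τ ^ (-α) : ℝ) : ℂ) * f τ := by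
  rw [weakSing, integral_withDensity_eq_integral_toReal_smul (measurable_weakSing_density α)
    (Eventually.of_forall fun _ => ENNReal.ofReal_lt_top)]
  refine setIntegral_congr_fun measurableSet_Ioi fun τ hτ => ?_
  rw [ENNReal.toReal_ofReal (Real.rpow_nonneg (le_of_lt hτ) _), Complex.real_smul]

/-- The Volterra integral of a function that vanishes for negative times. -/
lemma integral_weakSing_eq {α : ℝ} {u : ℝ → ℂ} (hu : ∀ t ≤ 0, u t = 0) {t : ℝ} (ht : 0 ≤ t) :
    ∫ τ, u (t - τ) ∂(weakSing α) =
      ∫ τ in (0 : ℝ)..t, u τ / (((t - τ) ^ α : ℝ) : ℂ) := by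
  rw [integral_weakSing]
  have h1 : ∫ τ in Set.Ioi 0, ((τ ^ (-α) : ℝ) : ℂ) * u (t - τ) =
      ∫ τ in Set.Ioc 0 t, ((τ ^ (-α) : ℝ) : ℂ) * u (t - τ) := by
    refine setIntegral_eq_of_subset_of_forall_sdiff_eq_zero measurableSet_Ioi
      Set.Ioc_subset_Ioi_self fun τ hτ => ?_
    have : t < τ := by
      by_contra! h
      exact hτ.2 ⟨hτ.1, h⟩
    rw [hu (t - τ) (by linarith), mul_zero]
  rw [h1, ← intervalIntegral.integral_of_le ht]
  have h2 := intervalIntegral.integral_comp_sub_left (a := 0) (b := t)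
    (fun τ => ((((t - τ) ^ (-α) : ℝ) : ℂ)) * u τ) t
  simp only [sub_sub_cancel, sub_self, sub_zero] at h2
  rw [h2]
  refine intervalIntegral.integral_congr fun τ hτ => ?_
  rw [Set.uIcc_of_le ht] at hτ
  rw [Real.rpow_neg (by linarith [hτ.2]), Complex.ofReal_inv, div_eq_mul_inv, mul_comm]

/-- Global solutions of weakly singular Volterra equations with Lipschitz nonlinearity. -/
lemma exists_volterra {α : ℝ} (hα : α < 1) (c : ℂ) {P : ℂ → ℂ} {L : NNReal}
    (hP : LipschitzWith L P) (hP0 : P 0 = 0) {G : ℝ → ℂ} (hG : Continuous G)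
    (hG0 : ∀ t ≤ 0, G t = 0) {B : ℝ} (hGB : ∀ t, ‖G t‖ ≤ B * Real.exp t) :
    ∃ p : ℝ → ℂ, Continuous p ∧ (∀ t ≤ 0, p t = 0) ∧
      ∀ t, p t = G t - c * ∫ τ, P (p (t - τ)) ∂(weakSing α) := by
  -- The smallness gives contraction constant `1/2`; the condition `γ ≥ 1` keeps `e^{-γt} G`
  -- bounded.
  obtain ⟨γ, ⟨hγ0, hγ⟩, hγ1⟩ := ((eventually_lintegral_exp_le hα (‖c‖ * L)).and
    (eventually_ge_atTop 1)).exists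
  set ν := weakSing α with hν
  set I := ∫ τ, Real.exp (-γ * τ) ∂ν with hI
  have hexp := integrable_exp_weakSing hα hγ0
  have hI0 : 0 ≤ I := integral_nonneg fun τ => (Real.exp_pos _).le
  have hθ : ‖c‖ * L * I ≤ 2⁻¹ := by
    have h1 : ENNReal.ofReal I = ∫⁻ τ, ENNReal.ofReal (Real.exp (-γ * τ)) ∂ν :=
      ofReal_integral_eq_lintegral_ofReal hexp (Eventually.of_forall fun τ => (Real.exp_pos _).le)
    rw [← h1, ← ENNReal.ofReal_mul (by positivity)] at hγ
    have h2 : (2⁻¹ : ℝ≥0∞) = ENNReal.ofReal 2⁻¹ := by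
      rw [ENNReal.ofReal_inv_of_pos two_pos]
      simp
    rw [h2] at hγ
    exact (ENNReal.ofReal_le_ofReal_iff (by norm_num)).1 hγ
  -- The unknown is `b = e^{-γt} p`, bounded and continuous on the whole line. Conjugating `P` by
  -- the weight does not change its Lipschitz constant.
  let w : (BoundedContinuousFunction ℝ ℂ) → ℝ → ℂ := fun b x =>
    (Real.exp (-γ * x) : ℂ) * P ((Real.exp (γ * x) : ℂ) * b x)
  have hwc : ∀ b, Continuous (w b) := fun b => by
    have := hP.continuous
    have := b.continuous
    simp only [w]
    fun_prop
  have hwd : ∀ b b' x, ‖w b x - w b' x‖ ≤ L * ‖b x - b' x‖ := by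
    intro b b' x
    simp only [w]
    rw [← mul_sub, norm_mul, Complex.norm_real, Real.norm_of_nonneg (Real.exp_pos _).le]
    have h := hP.norm_sub_le ((Real.exp (γ * x) : ℂ) * b x) ((Real.exp (γ * x) : ℂ) * b' x)
    rw [← mul_sub, norm_mul, Complex.norm_real, Real.norm_of_nonneg (Real.exp_pos _).le] at h
    calc _ ≤ Real.exp (-γ * x) * (L * (Real.exp (γ * x) * ‖b x - b' x‖)) := by
          gcongr
      _ = (Real.exp (-γ * x) * Real.exp (γ * x)) * (L * ‖b x - b' x‖) := by ring
      _ = _ := by rw [← Real.exp_add]; simp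
  have hwb : ∀ b x, ‖w b x‖ ≤ L * ‖b‖ := by
    intro b x
    have h := hwd b 0 x
    have h0 : w 0 x = 0 := by simp [w, hP0]
    rw [h0, sub_zero] at h
    refine h.trans ?_
    gcongr
    simpa using b.norm_coe_le_norm x
  let V : (BoundedContinuousFunction ℝ ℂ) → ℝ → ℂ := fun b t =>
    ∫ τ, (Real.exp (-γ * τ) : ℂ) * w b (t - τ) ∂ν
  have hnexp : ∀ τ : ℝ, ‖(Real.exp (-γ * τ) : ℂ)‖ = Real.exp (-γ * τ) := fun τ => by
    rw [Complex.norm_real, Real.norm_of_nonneg (Real.exp_pos _).le]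
  have hVint : ∀ b t, Integrable (fun τ => (Real.exp (-γ * τ) : ℂ) * w b (t - τ)) ν := by
    intro b t
    have := hwc b
    refine (hexp.mul_const (L * ‖b‖)).mono' ?_ (Eventually.of_forall fun τ => ?_)
    · exact Continuous.aestronglyMeasurable (by fun_prop)
    · rw [norm_mul, hnexp]
      gcongr
      exact hwb b _
  have hVc : ∀ b, Continuous (V b) := by
    intro b
    have := hwc b
    refine continuous_of_dominated (bound := fun τ => Real.exp (-γ * τ) * (L * ‖b‖))
      (fun t => (hVint b t).1) (fun t => Eventually.of_forall fun τ => ?_)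
      (hexp.mul_const (L * ‖b‖)) (Eventually.of_forall fun τ => by fun_prop)
    rw [norm_mul, hnexp]
    gcongr
    exact hwb b _
  have hVd : ∀ b b' t, ‖V b t - V b' t‖ ≤ L * ‖b - b'‖ * I := by
    intro b b' t
    simp only [V]
    rw [← integral_sub (hVint b t) (hVint b' t), mul_comm, hI, ← integral_mul_const]
    refine norm_integral_le_of_norm_le (hexp.mul_const _) (Eventually.of_forall fun τ => ?_)
    rw [← mul_sub, norm_mul, hnexp]
    gcongr
    refine (hwd b b' _).trans ?_
    gcongr
    exact (b - b').norm_coe_le_norm (t - τ)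
  have hV0 : ∀ t, V 0 t = 0 := fun t => by simp [V, w, hP0]
  have hgb : ∀ t, ‖(Real.exp (-γ * t) : ℂ) * G t‖ ≤ |B| := by
    intro t
    rcases le_total t 0 with h | h
    · rw [hG0 t h, mul_zero, norm_zero]
      positivity
    · rw [norm_mul, hnexp]
      calc _ ≤ Real.exp (-γ * t) * (|B| * Real.exp t) := by
            gcongr
            exact (hGB t).trans (by gcongr; exact le_abs_self B)
        _ = |B| * Real.exp (-γ * t + t) := by rw [Real.exp_add]; ring
        _ ≤ |B| * 1 := by
            gcongr
            rw [Real.exp_le_one_iff]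
            nlinarith
        _ = _ := mul_one _
  let Φ : (BoundedContinuousFunction ℝ ℂ) → (BoundedContinuousFunction ℝ ℂ) := fun b =>
    BoundedContinuousFunction.ofNormedAddCommGroup
      (fun t => (Real.exp (-γ * t) : ℂ) * G t - c * V b t)
      (by have := hVc b; fun_prop) (|B| + ‖c‖ * (L * ‖b‖ * I)) (fun t => by
        refine (norm_sub_le _ _).trans (add_le_add (hgb t) ?_)
        rw [norm_mul]
        gcongr
        have h := hVd b 0 t
        rwa [hV0, sub_zero, sub_zero] at h)
  have hcontr : ContractingWith 2⁻¹ Φ := by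
    refine ⟨by norm_num, LipschitzWith.of_dist_le_mul fun b b' => ?_⟩
    rw [dist_eq_norm, dist_eq_norm]
    refine (BoundedContinuousFunction.norm_le (by positivity)).2 fun t => ?_
    have e : (Φ b - Φ b') t = -(c * (V b t - V b' t)) := by
      simp only [Φ, BoundedContinuousFunction.coe_sub, Pi.sub_apply,
        BoundedContinuousFunction.coe_ofNormedAddCommGroup]
      ring
    rw [e, norm_neg, norm_mul]
    calc _ ≤ ‖c‖ * (L * ‖b - b'‖ * I) := by gcongr; exact hVd b b' t
      _ = (‖c‖ * L * I) * ‖b - b'‖ := by ring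
      _ ≤ _ := by
        gcongr
        simpa using hθ
  obtain ⟨b, hb⟩ : ∃ b, Φ b = b := ⟨_, hcontr.fixedPoint_isFixedPt⟩
  have hbt : ∀ t, b t = (Real.exp (-γ * t) : ℂ) * G t - c * V b t := fun t => by
    nth_rewrite 1 [← hb]
    rfl
  set p : ℝ → ℂ := fun t => (Real.exp (γ * t) : ℂ) * b t with hp
  have hpeq : ∀ t, p t = G t - c * ∫ τ, P (p (t - τ)) ∂ν := by
    intro t
    have hee : (Real.exp (γ * t) : ℂ) * (Real.exp (-γ * t) : ℂ) = 1 := by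
      rw [← Complex.ofReal_mul, ← Real.exp_add]
      simp
    have hV : (Real.exp (γ * t) : ℂ) * V b t = ∫ τ, P (p (t - τ)) ∂ν := by
      simp only [V]
      rw [← integral_const_mul]
      refine integral_congr_ae (Eventually.of_forall fun τ => ?_)
      simp only [w, hp]
      rw [← mul_assoc, ← mul_assoc, ← Complex.ofReal_mul, ← Complex.ofReal_mul, ← Real.exp_add,
        ← Real.exp_add]
      rw [show γ * t + -γ * τ + -γ * (t - τ) = 0 by ring, Real.exp_zero, Complex.ofReal_one,
        one_mul]
    rw [← hV]
    simp only [hp]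
    rw [hbt t]
    linear_combination G t * hee
  refine ⟨p, by have := b.continuous; simp only [hp]; fun_prop, ?_, hpeq⟩
  -- The fixed point was sought on the whole line. For `t ≤ 0` the forcing vanishes, so `p`
  -- satisfies the homogeneous inequality there and is zero.
  have hz := eq_zero_of_le_lintegral_weakSing (α := α) (γ := γ) (K := ENNReal.ofReal (‖c‖ * L))
    (C := ENNReal.ofReal ‖b‖) (e := fun t => ‖p t‖ₑ) (b := 0) ENNReal.ofReal_ne_top hγ
    (fun t _ => ?_) (fun t ht => ?_)
  · intro t ht
    simpa using hz t ht
  · rw [← ENNReal.ofReal_mul (norm_nonneg _), ← ofReal_norm]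
    apply ENNReal.ofReal_le_ofReal
    simp only [hp]
    rw [norm_mul, Complex.norm_real, Real.norm_of_nonneg (Real.exp_pos _).le, mul_comm]
    gcongr
    exact b.norm_coe_le_norm t
  · rw [hpeq t, hG0 t ht, zero_sub, enorm_neg, enorm_mul, ENNReal.ofReal_mul (norm_nonneg _),
      ofReal_norm, mul_assoc]
    gcongr
    refine (enorm_integral_le_lintegral_enorm _).trans ?_
    rw [← lintegral_const_mul' _ _ ENNReal.ofReal_ne_top]
    refine lintegral_mono fun τ => ?_
    have h := hP.norm_sub_le (p (t - τ)) 0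
    rw [hP0, sub_zero, sub_zero] at h
    rw [← ofReal_norm, ← ofReal_norm, ← ENNReal.ofReal_mul (by positivity)]
    exact ENNReal.ofReal_le_ofReal h

/-! ### The nonlinearity -/

/-- Bernoulli's inequality for `(ρ/r)^{p+1}`. The extra factor `r` on the left compensates for `r ↦
r^p` not being Lipschitz at `0` when `p < 1`. -/
lemma mul_rpow_sub_rpow_le {p r ρ : ℝ} (hp : 0 < p) (hρ : 0 ≤ ρ) (hr : ρ ≤ r) :
    r * (r ^ p - ρ ^ p) ≤ (p + 1) * r ^ p * (r - ρ) := by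
  rcases hρ.eq_or_lt with rfl | hρ0
  · rw [Real.zero_rpow hp.ne', sub_zero, sub_zero]
    have : 0 ≤ r * r ^ p := mul_nonneg hr (Real.rpow_nonneg hr _)
    nlinarith
  have hr0 : 0 < r := hρ0.trans_le hr
  have h := one_add_mul_self_le_rpow_one_add (s := ρ / r - 1) (p := p + 1)
    (by have := div_pos hρ0 hr0; linarith) (by linarith)
  rw [add_sub_cancel, Real.div_rpow hρ hr0.le, Real.rpow_add_one hr0.ne',
    Real.rpow_add_one hρ0.ne'] at h
  have hrp : 0 < r ^ p := by positivity
  have h2 : (1 + (p + 1) * (ρ / r - 1)) * (r ^ p * r) ≤ ρ ^ p * ρ := by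
    have := mul_le_mul_of_nonneg_right h (by positivity : 0 ≤ r ^ p * r)
    rwa [div_mul_cancel₀ _ (by positivity)] at this
  have h3 : (1 + (p + 1) * (ρ / r - 1)) * (r ^ p * r) =
      r ^ p * r + (p + 1) * r ^ p * (ρ - r) := by field_simp
  rw [h3] at h2
  have h4 : ρ ^ p * ρ ≤ ρ ^ p * r := by gcongr
  nlinarith

lemma norm_nonlin_sub_le {σ β B : ℝ} (hσ : 0 < σ) {z w : ℂ} (hz : ‖z‖ ≤ B) (hw : ‖w‖ ≤ B) :
    ‖nonlin σ β z - nonlin σ β w‖ ≤ |β| * ((2 * σ + 2) * B ^ (2 * σ)) * ‖z - w‖ := by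
  wlog h : ‖w‖ ≤ ‖z‖ generalizing z w
  · rw [norm_sub_rev, norm_sub_rev z]
    exact this hw hz (le_of_not_ge h)
  have hB : 0 ≤ B := (norm_nonneg z).trans hz
  -- The difference of powers is attached to `z`, the point of larger modulus, as
  -- `mul_rpow_sub_rpow_le` requires.
  have e : nonlin σ β z - nonlin σ β w = (β : ℂ) * (((‖w‖ ^ (2 * σ) : ℝ) : ℂ) * (z - w) +
      ((‖z‖ ^ (2 * σ) - ‖w‖ ^ (2 * σ) : ℝ) : ℂ) * z) := by
    simp only [nonlin]
    push_cast
    ring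
  have hmono : ‖w‖ ^ (2 * σ) ≤ ‖z‖ ^ (2 * σ) :=
    Real.rpow_le_rpow (norm_nonneg _) h (by linarith)
  rw [e, norm_mul, Complex.norm_real, Real.norm_eq_abs, mul_assoc]
  gcongr
  refine (norm_add_le _ _).trans ?_
  rw [norm_mul, norm_mul, Complex.norm_real, Complex.norm_real, Real.norm_of_nonneg (by positivity),
    Real.norm_of_nonneg (by linarith)]
  have h1 : ‖w‖ ^ (2 * σ) ≤ B ^ (2 * σ) := Real.rpow_le_rpow (norm_nonneg _) hw (by linarith)
  have h2 : ‖z‖ ^ (2 * σ) ≤ B ^ (2 * σ) := Real.rpow_le_rpow (norm_nonneg _) hz (by linarith)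
  have h3 := mul_rpow_sub_rpow_le (p := 2 * σ) (by linarith) (norm_nonneg w) h
  have h4 : ‖z‖ - ‖w‖ ≤ ‖z - w‖ := norm_sub_norm_le _ _
  calc _ ≤ B ^ (2 * σ) * ‖z - w‖ + (2 * σ + 1) * ‖z‖ ^ (2 * σ) * (‖z‖ - ‖w‖) := by
        rw [mul_comm (_ - _)]
        exact add_le_add (by gcongr) h3
    _ ≤ B ^ (2 * σ) * ‖z - w‖ + (2 * σ + 1) * B ^ (2 * σ) * ‖z - w‖ := by
        gcongr
    _ = _ := by ring

/-- The nonlinearity agrees with a globally Lipschitz function on every ball. -/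
lemma exists_lipschitz_nonlin {σ β : ℝ} (hσ : 0 < σ) (B : ℝ) :
    ∃ (P : ℂ → ℂ) (L : NNReal), LipschitzWith L P ∧ ∀ z, ‖z‖ ≤ B → P z = nonlin σ β z := by
  have h : LipschitzOnWith (Real.toNNReal (|β| * ((2 * σ + 2) * |B| ^ (2 * σ)))) (nonlin σ β)
      (Metric.closedBall 0 B) := by
    refine LipschitzOnWith.of_dist_le_mul fun z hz w hw => ?_
    rw [mem_closedBall_zero_iff] at hz hw
    rw [dist_eq_norm, dist_eq_norm, Real.coe_toNNReal _ (by positivity)]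
    exact norm_nonlin_sub_le hσ (hz.trans (le_abs_self B)) (hw.trans (le_abs_self B))
  obtain ⟨P, hP, heq⟩ := h.extend_finite_dimension
  exact ⟨P, _, hP, fun z hz => (heq (by simpa using hz)).symm⟩

lemma continuous_nonlin {σ β : ℝ} (hσ : 0 < σ) : Continuous (nonlin σ β) := by
  unfold nonlin
  have : Continuous fun z : ℂ => ‖z‖ ^ (2 * σ) :=
    Continuous.rpow_const continuous_norm fun x => Or.inr (by linarith)
  fun_prop

/-! ### The smoothing estimate -/

/-- The phase integral `∫ e^{i|k|^{2s}τ} n(τ) dτ` of a density `n`. -/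
def phaseInt (s : ℝ) (n : ℝ → ℂ) (ξ : ℝ) : ℂ := ∫ τ, phase s (-τ) ξ * n τ

lemma integrable_phase_mul {s : ℝ} {n : ℝ → ℂ} (hn : Integrable n) (ξ : ℝ) :
    Integrable fun τ => phase s (-τ) ξ * n τ := by
  refine hn.bdd_mul (c := 1) ?_ (Eventually.of_forall fun τ => (norm_phase _ _ _).le)
  exact ((continuous_phase_left ξ).comp continuous_neg).aestronglyMeasurable

lemma continuous_phaseInt {s : ℝ} (hs : 0 ≤ s) {n : ℝ → ℂ} (hn : Integrable n) :
    Continuous (phaseInt s n) := by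
  refine continuous_of_dominated (bound := fun τ => ‖n τ‖)
    (fun ξ => (integrable_phase_mul hn ξ).1) (fun ξ => Eventually.of_forall fun τ => ?_) hn.norm
    (Eventually.of_forall fun τ => (continuous_phase_right hs _).mul continuous_const)
  rw [norm_mul, norm_phase, one_mul]

/-- The `TT*` identity: expanding the square and integrating first over the frequencies leaves the
truncated kernel at the time difference. The truncation makes Fubini legitimate, since the phases
have modulus one. -/
lemma integral_norm_phaseInt_sq {s : ℝ} (hs : 0 ≤ s) {n : ℝ → ℂ} (hn : Integrable n) {R : ℝ}
    (hR : 0 ≤ R) :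
    ((∫ ξ in (-R)..R, ‖phaseInt s n ξ‖ ^ 2 : ℝ) : ℂ) =
      ∫ τ, n τ * ∫ r, (starRingEnd ℂ) (n r) * kernelCut s R (r - τ) := by
  set v := phaseInt s n with hv
  have hvc : Continuous v := continuous_phaseInt hs hn
  have hfin : IsFiniteMeasure ((volume : Measure ℝ).restrict (Set.uIoc (-R) R)) := by
    rw [Set.uIoc_of_le (by linarith)]
    infer_instance
  have hph : ∀ f : ℝ × ℝ → ℝ, Measurable f → AEStronglyMeasurable
      (fun p : ℝ × ℝ => phase s (f p) p.1) ((volume.restrict (Set.uIoc (-R) R)).prod volume) := by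
    intro f hf
    have := (measurable_phase s).comp (hf.prodMk measurable_fst)
    exact this.aestronglyMeasurable
  have hW : ∀ τ, ∫ r, (starRingEnd ℂ) (n r) * kernelCut s R (r - τ) =
      ∫ ξ in (-R)..R, (starRingEnd ℂ) (v ξ) * phase s (-τ) ξ := by
    intro τ
    have h1 : ∀ ξ, (starRingEnd ℂ) (v ξ) * phase s (-τ) ξ =
        ∫ r, phase s (r - τ) ξ * (starRingEnd ℂ) (n r) := by
      intro ξ
      rw [hv, phaseInt, ← integral_conj, ← integral_mul_const]
      congr 1
      funext r
      rw [map_mul, conj_phase, neg_neg, phase_sub]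
      ring
    simp_rw [h1]
    have hc : Integrable (fun r => (starRingEnd ℂ) (n r)) := by
      refine hn.norm.mono' ?_ (Eventually.of_forall fun r => by simp)
      exact Complex.continuous_conj.comp_aestronglyMeasurable hn.1
    rw [intervalIntegral_integral_swap]
    · congr 1
      funext r
      rw [intervalIntegral.integral_mul_const, mul_comm]
      rfl
    · have h2 : Integrable (fun p : ℝ × ℝ => (1 : ℂ) * (starRingEnd ℂ) (n p.2))
          ((volume.restrict (Set.uIoc (-R) R)).prod volume) :=
        (integrable_const (1 : ℂ)).mul_prod hc
      simp only [one_mul] at h2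
      exact h2.bdd_mul (c := 1) (hph (fun p => p.2 - τ) (by fun_prop))
        (Eventually.of_forall fun p => (norm_phase _ _ _).le)
  simp_rw [hW]
  have h1 : ((∫ ξ in (-R)..R, ‖v ξ‖ ^ 2 : ℝ) : ℂ) =
      ∫ ξ in (-R)..R, ∫ τ, (starRingEnd ℂ) (v ξ) * phase s (-τ) ξ * n τ := by
    rw [← intervalIntegral.integral_ofReal]
    congr 1
    funext ξ
    simp_rw [mul_assoc]
    rw [integral_const_mul]
    change _ = (starRingEnd ℂ) (v ξ) * v ξ
    rw [Complex.conj_mul']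
    push_cast
    rfl
  rw [h1, intervalIntegral_integral_swap]
  · congr 1
    funext τ
    rw [intervalIntegral.integral_mul_const, mul_comm]
  · have hvi : Integrable (fun ξ => (starRingEnd ℂ) (v ξ)) (volume.restrict (Set.uIoc (-R) R)) := by
      have : Continuous fun ξ => (starRingEnd ℂ) (v ξ) := Complex.continuous_conj.comp hvc
      exact (this.intervalIntegrable (-R) R).def'
    have h2 := hvi.mul_prod hn
    refine (h2.bdd_mul (c := 1) (hph (fun p => -p.2) (by fun_prop))
      (Eventually.of_forall fun p => (norm_phase _ _ _).le)).congr
      (Eventually.of_forall fun p => ?_)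
    simp only [Function.uncurry]
    ring

/-- Schur's test for an even convolution kernel, from `f(τ) f(r) ≤ f(τ)² + f(r)²`; the lost factor
is harmless. -/
lemma lintegral_lintegral_mul_kernel_le {f k : ℝ → ℝ≥0∞} (hf : AEMeasurable f)
    (hk : Measurable k) (hsymm : ∀ x, k (-x) = k x) :
    ∫⁻ τ, f τ * ∫⁻ r, f r * k (r - τ) ≤ 2 * (∫⁻ x, k x) * ∫⁻ τ, f τ ^ 2 := by
  have h1 : ∀ τ r, f τ * (f r * k (r - τ)) ≤ f τ ^ 2 * k (r - τ) + f r ^ 2 * k (r - τ) := by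
    intro τ r
    rw [← mul_assoc, ← add_mul]
    gcongr
    rcases le_total (f τ) (f r) with h | h
    · calc _ ≤ f r * f r := by gcongr
        _ = f r ^ 2 := (sq _).symm
        _ ≤ _ := le_add_self
    · calc _ ≤ f τ * f τ := by gcongr
        _ = f τ ^ 2 := (sq _).symm
        _ ≤ _ := le_self_add
  have hA : ∀ τ, ∫⁻ r, f τ ^ 2 * k (r - τ) = f τ ^ 2 * ∫⁻ x, k x := by
    intro τ
    rw [lintegral_const_mul _ (by fun_prop), lintegral_sub_right_eq_self]
  have hB : ∫⁻ τ, ∫⁻ r, f r ^ 2 * k (r - τ) = ∫⁻ r, f r ^ 2 * ∫⁻ x, k x := by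
    rw [lintegral_lintegral_swap]
    · congr 1
      funext r
      rw [lintegral_const_mul _ (by fun_prop)]
      congr 1
      rw [← lintegral_sub_right_eq_self k r]
      refine lintegral_congr fun τ => ?_
      rw [← hsymm, neg_sub]
    · have := (hf.pow_const 2).comp_snd (μ := (volume : Measure ℝ))
      exact this.mul (by fun_prop)
  calc _ ≤ ∫⁻ τ, ∫⁻ r, (f τ ^ 2 * k (r - τ) + f r ^ 2 * k (r - τ)) := by
        refine lintegral_mono fun τ => ?_
        calc _ ≤ ∫⁻ r, f τ * (f r * k (r - τ)) :=
              lintegral_const_mul_le _ _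
          _ ≤ _ := lintegral_mono fun r => h1 τ r
    _ = ∫⁻ τ, (f τ ^ 2 * (∫⁻ x, k x) + ∫⁻ r, f r ^ 2 * k (r - τ)) := by
        refine lintegral_congr fun τ => ?_
        rw [lintegral_add_left (by fun_prop), hA]
    _ = (∫⁻ τ, f τ ^ 2 * (∫⁻ x, k x)) + ∫⁻ τ, ∫⁻ r, f r ^ 2 * k (r - τ) := by
        rw [lintegral_add_left' ((hf.pow_const 2).mul_const _)]
    _ = _ := by
        rw [hB, lintegral_mul_const'' _ (hf.pow_const 2)]
        ring

lemma integrable_of_memLp_of_support {n : ℝ → ℂ} {T : ℝ} (hn : MemLp n 2 volume)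
    (hsupp : ∀ τ, τ ∉ Set.Ioc 0 T → n τ = 0) : Integrable n := by
  have h1 : IntegrableOn n (Set.Ioc 0 T) :=
    (hn.restrict (Set.Ioc 0 T)).integrable (by norm_num)
  exact (integrableOn_iff_integrable_of_support_subset fun τ hτ => by
    by_contra h
    exact hτ (hsupp τ h)).1 h1

lemma lintegral_enorm_sq {E : Type*} [NormedAddCommGroup E] {n : ℝ → E}
    (hn : MemLp n 2 volume) :
    ∫⁻ τ, ‖n τ‖ₑ ^ 2 = ENNReal.ofReal (∫ τ, ‖n τ‖ ^ 2) := by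
  rw [ofReal_integral_eq_lintegral_ofReal ((memLp_two_iff_integrable_sq_norm hn.1).1 hn)
    (Eventually.of_forall fun τ => by positivity)]
  refine lintegral_congr fun τ => ?_
  rw [ENNReal.ofReal_pow (norm_nonneg _), ofReal_norm]

/-- The smoothing estimate: the phase integral maps `L²(0,T)` to `L²`. -/
lemma exists_phaseInt_bound {s : ℝ} (hs : 1 / 2 < s) (T : ℝ) :
    ∃ C : ℝ, 0 ≤ C ∧ ∀ n : ℝ → ℂ, MemLp n 2 volume → (∀ τ, τ ∉ Set.Ioc 0 T → n τ = 0) →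
      MemLp (phaseInt s n) 2 volume ∧
      ∫ ξ, ‖phaseInt s n ξ‖ ^ 2 ≤ C * ∫ τ, ‖n τ‖ ^ 2 := by
  obtain ⟨C, hC, hK⟩ := exists_norm_kernelCut_le hs
  have hα : 1 / (2 * s) < 1 := by
    rw [div_lt_one (by linarith)]
    linarith
  -- Differences of two points of `(0, T]` stay in `[-T, T]`, so only the integrable singularity at
  -- `0` matters and the slow decay at infinity plays no role.
  set k : ℝ → ℝ≥0∞ := (Set.Icc (-T) T).indicator
    (fun x => ENNReal.ofReal (C * |x| ^ (-(1 / (2 * s))))) with hk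
  have hkm : Measurable k := by
    rw [hk]
    exact Measurable.indicator (by fun_prop) measurableSet_Icc
  have hsymm : ∀ x, k (-x) = k x := by
    intro x
    simp only [hk, Set.indicator, Set.mem_Icc, abs_neg]
    congr 1
    rw [eq_iff_iff]
    constructor <;> rintro ⟨h1, h2⟩ <;> constructor <;> linarith
  have hkfin : ∫⁻ x, k x ≠ ⊤ := by
    rw [hk, lintegral_indicator measurableSet_Icc]
    have h0 : IntervalIntegrable (fun x : ℝ => C * |x| ^ (-(1 / (2 * s)))) volume (-T) T := by
      have h1 : ∀ b : ℝ, IntervalIntegrable (fun x : ℝ => |x| ^ (-(1 / (2 * s)))) volume 0 |b| := by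
        intro b
        refine (intervalIntegral.intervalIntegrable_rpow' (by linarith)).congr (f := fun x : ℝ =>
          x ^ (-(1 / (2 * s)))) ?_
        intro x hx
        rw [Set.uIoc_of_le (abs_nonneg b)] at hx
        simp [abs_of_pos hx.1]
      have h2 : IntervalIntegrable (fun x : ℝ => |x| ^ (-(1 / (2 * s)))) volume (-|T|) |T| := by
        refine IntervalIntegrable.trans (b := 0) ?_ (h1 T)
        have := (h1 T).comp_sub_left 0
        simp only [zero_sub, abs_neg, sub_zero] at this
        simpa using this.symm
      refine (h2.const_mul C).mono_set ?_
      rw [Set.uIcc_of_le (a := -|T|) (by linarith [abs_nonneg T])]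
      intro x hx
      rw [Set.mem_uIcc] at hx
      constructor <;> rcases hx with h | h <;> linarith [le_abs_self T, neg_abs_le T]
    rcases le_total (-T) T with hT | hT
    · rw [intervalIntegrable_iff_integrableOn_Icc_of_le hT] at h0
      have := h0.2
      rw [HasFiniteIntegral] at this
      refine (lt_of_le_of_lt (lintegral_mono fun x => ?_) this).ne
      rw [← ofReal_norm]
      exact ENNReal.ofReal_le_ofReal (le_abs_self _)
    · rcases hT.eq_or_lt with h | h
      · rw [← h, Set.Icc_self, Measure.restrict_singleton]
        simp
      · rw [Set.Icc_eq_empty (by linarith)]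
        simp
  set A := (2 * ∫⁻ x, k x).toReal with hA
  refine ⟨A, ENNReal.toReal_nonneg, fun n hn hsupp => ?_⟩
  have hni := integrable_of_memLp_of_support hn hsupp
  set v := phaseInt s n with hv
  have hvc : Continuous v := continuous_phaseInt (by linarith) hni
  have hbound : ∀ R : ℝ, 0 ≤ R → ∫ ξ in (-R)..R, ‖v ξ‖ ^ 2 ≤ A * ∫ τ, ‖n τ‖ ^ 2 := by
    intro R hR
    have h0 : 0 ≤ ∫ ξ in (-R)..R, ‖v ξ‖ ^ 2 :=
      intervalIntegral.integral_nonneg (by linarith) fun ξ _ => by positivity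
    have h1 := integral_norm_phaseInt_sq (s := s) (by linarith) hni hR
    have h2 : ENNReal.ofReal (∫ ξ in (-R)..R, ‖v ξ‖ ^ 2) ≤
        ENNReal.ofReal (A * ∫ τ, ‖n τ‖ ^ 2) := by
      calc ENNReal.ofReal (∫ ξ in (-R)..R, ‖v ξ‖ ^ 2)
          = ‖((∫ ξ in (-R)..R, ‖v ξ‖ ^ 2 : ℝ) : ℂ)‖ₑ := by
            rw [← ofReal_norm, Complex.norm_real, Real.norm_of_nonneg h0]
        _ ≤ ∫⁻ τ, ‖n τ‖ₑ * ∫⁻ r, ‖n r‖ₑ * k (r - τ) := by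
            rw [h1]
            refine (enorm_integral_le_lintegral_enorm _).trans (lintegral_mono fun τ => ?_)
            rw [enorm_mul]
            by_cases hτ : τ ∈ Set.Ioc 0 T
            swap
            · simp [hsupp τ hτ]
            gcongr
            refine (enorm_integral_le_lintegral_enorm _).trans (lintegral_mono_ae ?_)
            have hne : ∀ᵐ r : ℝ, r ≠ τ := by simp [ae_iff]
            filter_upwards [hne] with r hr
            rw [enorm_mul, RCLike.enorm_conj]
            by_cases hr' : r ∈ Set.Ioc 0 T
            swap
            · simp [hsupp r hr']
            gcongr
            have hmem : r - τ ∈ Set.Icc (-T) T :=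
              ⟨by linarith [hτ.2, hr'.1], by linarith [hτ.1, hr'.2]⟩
            rw [hk, Set.indicator_of_mem hmem, ← ofReal_norm]
            exact ENNReal.ofReal_le_ofReal (hK R hR _ (sub_ne_zero.2 hr))
        _ ≤ 2 * (∫⁻ x, k x) * ∫⁻ τ, ‖n τ‖ₑ ^ 2 :=
            lintegral_lintegral_mul_kernel_le hni.1.enorm hkm hsymm
        _ = _ := by
            rw [lintegral_enorm_sq hn, ENNReal.ofReal_mul ENNReal.toReal_nonneg,
              ENNReal.ofReal_toReal (ENNReal.mul_ne_top (by simp) hkfin)]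
    exact (ENNReal.ofReal_le_ofReal_iff (mul_nonneg ENNReal.toReal_nonneg
      (integral_nonneg fun τ => by positivity))).1 h2
  have hint : Integrable fun ξ => ‖v ξ‖ ^ 2 := by
    refine integrable_of_intervalIntegral_norm_bounded (l := atTop) (a := fun R : ℝ => -R)
      (b := fun R : ℝ => R) (A * ∫ τ, ‖n τ‖ ^ 2) (fun R => ?_) tendsto_neg_atTop_atBot
      tendsto_id ?_
    · exact ((hvc.norm.pow 2).integrableOn_Icc (a := -R) (b := R)).mono_set Set.Ioc_subset_Icc_self
    · filter_upwards [eventually_ge_atTop 0] with R hR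
      refine le_trans (le_of_eq ?_) (hbound R hR)
      congr 1
      funext ξ
      simp
  refine ⟨(memLp_two_iff_integrable_sq_norm hvc.aestronglyMeasurable).2 hint, ?_⟩
  refine le_of_tendsto (intervalIntegral_tendsto_integral hint
    tendsto_neg_atTop_atBot tendsto_id) ?_
  filter_upwards [eventually_ge_atTop 0] with R hR using hbound R hR

/-! ### The free evolution at the origin -/

lemma integrable_mul_of_memLp {f g : ℝ → ℂ} (hf : MemLp f 2 volume) (hg : MemLp g 2 volume) :
    Integrable fun ξ => f ξ * g ξ :=
  hf.integrable_mul hg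

lemma norm_integral_mul_le {f g : ℝ → ℂ} (hf : MemLp f 2 volume) (hg : MemLp g 2 volume) :
    ‖∫ ξ, f ξ * g ξ‖ ≤ (∫ ξ, ‖f ξ‖ ^ 2) ^ (1 / 2 : ℝ) * (∫ ξ, ‖g ξ‖ ^ 2) ^ (1 / 2 : ℝ) := by
  have h := integral_mul_norm_le_Lp_mul_Lq (μ := volume) (f := f) (g := g)
    Real.HolderConjugate.two_two (by simpa using hf) (by simpa using hg)
  simp only [Real.rpow_two] at h
  refine (norm_integral_le_integral_norm _).trans ?_
  simpa only [norm_mul] using h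

lemma intervalIntegral_swap_of_continuous {E : Type*} [NormedAddCommGroup E] [NormedSpace ℝ E]
    {F : ℝ → ℝ → E} (hF : Continuous (Function.uncurry F))
    (a b c d : ℝ) :
    ∫ x in a..b, ∫ y in c..d, F x y = ∫ y in c..d, ∫ x in a..b, F x y := by
  refine intervalIntegral_intervalIntegral_swap ?_
  exact (hF.continuousOn.integrableOn_compact (isCompact_uIcc.prod isCompact_uIcc)).mono_set
    (Set.prod_mono Set.uIoc_subset_uIcc Set.uIoc_subset_uIcc)

lemma phaseInt_indicator {s t : ℝ} (ht : 0 ≤ t) (ξ : ℝ) :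
    phaseInt s ((Set.Ioc 0 t).indicator fun _ => 1) ξ =
      ∫ τ in (0 : ℝ)..t, phase s (-τ) ξ := by
  rw [phaseInt, intervalIntegral.integral_of_le ht, ← integral_indicator measurableSet_Ioc]
  congr 1
  funext τ
  by_cases h : τ ∈ Set.Ioc 0 t <;> simp [h]

/-- The time density of the free evolution at the origin. -/
lemma exists_smoothing_density {s : ℝ} (hs : 1 / 2 < s) (T : ℝ) (H : L2) :
    ∃ g : L2, ∀ t ∈ Set.Icc 0 T, ∫ τ in (0 : ℝ)..t, g τ =
      ∫ ξ, H ξ * ∫ τ in (0 : ℝ)..t, phase s τ ξ := by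
  obtain ⟨C, hC, hB⟩ := exists_phaseInt_bound hs T
  let χ : L2 → ℝ → ℂ := fun n => (Set.Ioc 0 T).indicator n
  have hχ : ∀ n, MemLp (χ n) 2 volume := fun n => (Lp.memLp n).indicator measurableSet_Ioc
  have hsupp : ∀ n τ, τ ∉ Set.Ioc 0 T → χ n τ = 0 := fun n τ hτ => Set.indicator_of_notMem hτ _
  have hv := fun n => hB (χ n) (hχ n) (hsupp n)
  have hi := fun n => integrable_of_memLp_of_support (hχ n) (hsupp n)
  have hH : MemLp (fun ξ => (starRingEnd ℂ) (H ξ)) 2 volume :=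
    (Lp.memLp H).norm.mono' (Complex.continuous_conj.comp_aestronglyMeasurable (Lp.memLp H).1)
      (Eventually.of_forall fun ξ => by simp)
  -- Duality: `n ↦ ∫ conj H · phaseInt n` is bounded on `L²` by the smoothing estimate. Its Riesz
  -- representative is the density `g`, as testing against the indicator of `(0, t]` and conjugating
  -- show.
  let ℓ : L2 →ₗ[ℂ] ℂ :=
    { toFun := fun n => ∫ ξ, (starRingEnd ℂ) (H ξ) * phaseInt s (χ n) ξ
      map_add' := fun n m => by
        rw [← integral_add (integrable_mul_of_memLp hH (hv n).1)
          (integrable_mul_of_memLp hH (hv m).1)]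
        congr 1
        funext ξ
        rw [← mul_add]
        congr 1
        simp only [phaseInt]
        rw [← integral_add (integrable_phase_mul (hi n) ξ) (integrable_phase_mul (hi m) ξ)]
        refine integral_congr_ae ?_
        filter_upwards [Lp.coeFn_add n m] with τ hτ
        rw [← mul_add]
        congr 1
        simp only [χ, Set.indicator]
        split_ifs
        · exact hτ
        · simp
      map_smul' := fun c n => by
        simp only [RingHom.id_apply, smul_eq_mul]
        rw [← integral_const_mul]
        congr 1
        funext ξ
        rw [mul_left_comm]
        congr 1
        simp only [phaseInt]
        rw [← integral_const_mul]
        refine integral_congr_ae ?_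
        filter_upwards [Lp.coeFn_smul c n] with τ hτ
        rw [mul_left_comm]
        congr 1
        simp only [χ, Set.indicator]
        split_ifs
        · exact hτ
        · simp }
  let ℓ' : L2 →L[ℂ] ℂ := ℓ.mkContinuous ((∫ ξ, ‖(starRingEnd ℂ) (H ξ)‖ ^ 2) ^ (1 / 2 : ℝ) *
      C ^ (1 / 2 : ℝ)) fun n => by
    refine (norm_integral_mul_le hH (hv n).1).trans ?_
    rw [mul_assoc]
    refine mul_le_mul_of_nonneg_left ?_ (Real.rpow_nonneg (integral_nonneg fun ξ => by positivity) _)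
    have h1 : ∫ τ, ‖χ n τ‖ ^ 2 ≤ ‖n‖ ^ 2 := by
      rw [norm_sq_eq_integral]
      refine integral_mono ((memLp_two_iff_integrable_sq_norm (hχ n).1).1 (hχ n))
        (integrable_norm_sq n) fun τ => ?_
      simp only [χ]
      gcongr
      exact norm_indicator_le_norm_self _ _
    calc _ ≤ (C * ‖n‖ ^ 2) ^ (1 / 2 : ℝ) :=
          Real.rpow_le_rpow (integral_nonneg fun ξ => by positivity)
            ((hv n).2.trans (by gcongr)) (by norm_num)
      _ = _ := by
          rw [Real.mul_rpow hC (by positivity), ← Real.sqrt_eq_rpow (‖n‖ ^ 2),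
            Real.sqrt_sq (norm_nonneg n)]
  refine ⟨(InnerProductSpace.toDual ℂ L2).symm ℓ', fun t ht => ?_⟩
  set g := (InnerProductSpace.toDual ℂ L2).symm ℓ' with hg
  have hI : MemLp ((Set.Ioc 0 t).indicator fun _ : ℝ => (1 : ℂ)) 2 volume :=
    memLp_indicator_const 2 measurableSet_Ioc 1 (Or.inr (by simp))
  have h1 : inner ℂ g (hI.toLp _) = ℓ' (hI.toLp _) := by
    rw [hg, InnerProductSpace.toDual_symm_apply]
  have h2 : inner ℂ g (hI.toLp _) = ∫ τ in (0 : ℝ)..t, (starRingEnd ℂ) (g τ) := by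
    rw [L2.inner_def, intervalIntegral.integral_of_le ht.1, ← integral_indicator measurableSet_Ioc]
    refine integral_congr_ae ?_
    filter_upwards [hI.coeFn_toLp] with τ hτ
    rw [RCLike.inner_apply, hτ]
    by_cases h : τ ∈ Set.Ioc 0 t <;> simp [h]
  have h3 : ℓ' (hI.toLp _) = ∫ ξ, (starRingEnd ℂ) (H ξ) * ∫ τ in (0 : ℝ)..t, phase s (-τ) ξ := by
    change ∫ ξ, (starRingEnd ℂ) (H ξ) * phaseInt s (χ (hI.toLp _)) ξ = _
    congr 1
    funext ξ
    rw [← phaseInt_indicator ht.1]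
    congr 1
    simp only [phaseInt]
    refine integral_congr_ae ?_
    filter_upwards [hI.coeFn_toLp] with τ hτ
    congr 1
    simp only [χ]
    by_cases h : τ ∈ Set.Ioc 0 T
    · rw [Set.indicator_of_mem h, hτ]
    · rw [Set.indicator_of_notMem h, Set.indicator_of_notMem]
      exact fun h' => h ⟨h'.1, h'.2.trans ht.2⟩
  have h4 := congrArg (starRingEnd ℂ) (h2.symm.trans (h1.trans h3))
  rw [intervalIntegral.integral_of_le ht.1, ← integral_conj, ← integral_conj] at h4
  rw [intervalIntegral.integral_of_le ht.1]
  simp only [Complex.conj_conj, map_mul] at h4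
  rw [h4]
  congr 1
  funext ξ
  rw [intervalIntegral.integral_of_le ht.1, intervalIntegral.integral_of_le ht.1, ← integral_conj]
  simp [conj_phase]

lemma symb_mul_integral_phase (s t ξ : ℝ) :
    (symb s ξ : ℂ) * ∫ τ in (0 : ℝ)..t, phase s τ ξ = Complex.I * (phase s t ξ - 1) := by
  have h := intervalIntegral.integral_eq_sub_of_hasDerivAt (a := 0) (b := t)
    (fun τ _ => hasDerivAt_phase s τ ξ)
    ((continuous_const.mul (continuous_phase_left ξ)).intervalIntegrable 0 t)
  rw [intervalIntegral.integral_const_mul, phase_zero] at h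
  linear_combination Complex.I * h + (symb s ξ : ℂ) * (∫ τ in (0 : ℝ)..t, phase s τ ξ) *
    (Complex.I_mul_I)

lemma memLp_integral_phase {s : ℝ} (hs : 1 / 2 < s) {t : ℝ} (ht : 0 ≤ t) :
    MemLp (fun ξ => ∫ τ in (0 : ℝ)..t, phase s τ ξ) 2 volume := by
  obtain ⟨C, -, hB⟩ := exists_phaseInt_bound hs t
  have hI : MemLp ((Set.Ioc 0 t).indicator fun _ : ℝ => (1 : ℂ)) 2 volume :=
    memLp_indicator_const 2 measurableSet_Ioc 1 (Or.inr (by simp))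
  have h := (hB _ hI fun τ hτ => Set.indicator_of_notMem hτ _).1
  have e : ∀ ξ, (∫ τ in (0 : ℝ)..t, phase s τ ξ) =
      (starRingEnd ℂ) (phaseInt s ((Set.Ioc 0 t).indicator fun _ => 1) ξ) := by
    intro ξ
    rw [phaseInt_indicator ht, intervalIntegral.integral_of_le ht,
      intervalIntegral.integral_of_le ht, ← integral_conj]
    simp [conj_phase]
  simp_rw [e]
  exact h.norm.mono' (Complex.continuous_conj.comp_aestronglyMeasurable h.1)
    (Eventually.of_forall fun ξ => by simp)

lemma integrable_phase_mul_of_integrable {s : ℝ} {U : ℝ → ℂ} (hU : Integrable U) (t : ℝ) :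
    Integrable fun ξ => phase s t ξ * U ξ :=
  hU.bdd_mul (c := 1) (measurable_phase_right s t).aestronglyMeasurable
    (Eventually.of_forall fun _ => (norm_phase _ _ _).le)

/-- The free evolution at the origin, corrected by the charge term, is an integral in time. -/
lemma free_sub_eq_integral {s : ℝ} (hs : 1 / 2 < s) {U H : L2} {z : ℂ} (h : Graph s U H z)
    {t : ℝ} (ht : 0 ≤ t) :
    (∫ ξ, phase s t ξ * U ξ) - (∫ ξ, U ξ) -
        Complex.I * kernelConst s * ∫ τ in (0 : ℝ)..t, z / (((t - τ) ^ (1 / (2 * s)) : ℝ) : ℂ) =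
      -Complex.I * ∫ ξ, H ξ * ∫ τ in (0 : ℝ)..t, phase s τ ξ := by
  have hUi := (h.formInt hs).integrable hs
  have h1 := intervalIntegral_tendsto_integral
    (integrable_mul_of_memLp (Lp.memLp H) (memLp_integral_phase hs ht))
    tendsto_neg_atTop_atBot tendsto_id (l := atTop)
  have hd : Integrable fun ξ => phase s t ξ * U ξ - U ξ :=
    (integrable_phase_mul_of_integrable hUi t).sub hUi
  have h2 := intervalIntegral_tendsto_integral hd tendsto_neg_atTop_atBot tendsto_id (l := atTop)
  have h3 := tendsto_integral_kernelCut hs ht (N := fun _ => z) continuousOn_const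
  -- On `|ξ| ≤ R` the graph relation replaces `H` by `symb · U + z`. The first term integrates
  -- exactly in time, and Fubini turns the second into `kernelCut`, whose limit is known.
  have h4 : ∀ R : ℝ, -Complex.I * ∫ ξ in (-R)..R, H ξ * ∫ τ in (0 : ℝ)..t, phase s τ ξ =
      (∫ ξ in (-R)..R, (phase s t ξ * U ξ - U ξ)) -
        Complex.I * ∫ τ in (0 : ℝ)..t, z * kernelCut s R (t - τ) := by
    intro R
    have e1 : ∫ ξ in (-R)..R, H ξ * ∫ τ in (0 : ℝ)..t, phase s τ ξ =
        ∫ ξ in (-R)..R, (Complex.I * (phase s t ξ * U ξ - U ξ) +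
          z * ∫ τ in (0 : ℝ)..t, phase s τ ξ) := by
      refine intervalIntegral.integral_congr_ae ?_
      filter_upwards [h] with ξ hξ _
      rw [hξ]
      linear_combination U ξ * symb_mul_integral_phase s t ξ
    have hc : Continuous fun ξ => ∫ τ in (0 : ℝ)..t, phase s τ ξ :=
      intervalIntegral.continuous_parametric_intervalIntegral_of_continuous'
        (f := fun ξ τ => phase s τ ξ)
        ((continuous_phase (by linarith : 0 ≤ s)).comp continuous_swap) _ _
    have e2 : ∫ τ in (0 : ℝ)..t, z * kernelCut s R (t - τ) =
        z * ∫ ξ in (-R)..R, ∫ τ in (0 : ℝ)..t, phase s τ ξ := by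
      rw [intervalIntegral.integral_const_mul,
        intervalIntegral.integral_comp_sub_left (fun τ => kernelCut s R τ) t, sub_self, sub_zero]
      congr 1
      simp only [kernelCut]
      refine intervalIntegral_swap_of_continuous ?_ _ _ _ _
      exact (continuous_phase (by linarith : 0 ≤ s))
    rw [e1, e2, intervalIntegral.integral_add, intervalIntegral.integral_const_mul,
      intervalIntegral.integral_const_mul]
    · linear_combination -(∫ ξ in (-R)..R, (phase s t ξ * U ξ - U ξ)) * Complex.I_mul_I
    · exact (hd.intervalIntegrable).const_mul _
    · exact (hc.intervalIntegrable _ _).const_mul _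
  have h5 := (h2.sub (h3.const_mul Complex.I))
  have h6 := h1.const_mul (-Complex.I)
  have h7 := tendsto_nhds_unique (h6.congr h4) h5
  rw [h7, integral_sub (integrable_phase_mul_of_integrable hUi t) hUi]
  ring

/-! ### Absolute continuity of the charge -/

lemma lintegral_sq_le_of_measure {ρ : Measure ℝ} {f : ℝ → ℝ≥0∞} (hf : AEMeasurable f ρ) :
    (∫⁻ τ, f τ ∂ρ) ^ 2 ≤ ρ Set.univ * ∫⁻ τ, f τ ^ 2 ∂ρ := by
  have h := ENNReal.lintegral_mul_le_Lp_mul_Lq ρ Real.HolderConjugate.two_two hf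
    (aemeasurable_const (b := (1 : ℝ≥0∞)))
  simp only [Pi.mul_apply, mul_one, ENNReal.rpow_two, one_pow, lintegral_one] at h
  calc _ ≤ ((∫⁻ τ, f τ ^ 2 ∂ρ) ^ (1 / 2 : ℝ) * ρ Set.univ ^ (1 / 2 : ℝ)) ^ 2 := by gcongr
    _ = _ := by
      rw [mul_pow, ← ENNReal.rpow_natCast, ← ENNReal.rpow_natCast, ← ENNReal.rpow_mul,
        ← ENNReal.rpow_mul]
      norm_num
      rw [mul_comm]

lemma add_sq_le_two_mul (a b : ℝ≥0∞) : (a + b) ^ 2 ≤ 2 * a ^ 2 + 2 * b ^ 2 := by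
  have h := ENNReal.rpow_add_le_mul_rpow_add_rpow a b (p := 2) (by norm_num)
  simp only [ENNReal.rpow_two] at h
  refine h.trans (le_of_eq ?_)
  norm_num
  rw [mul_add]

lemma measurable_comp_const_sub {m : ℝ → ℝ≥0∞} (hm : Measurable m) (t : ℝ) :
    Measurable fun τ => m (t - τ) :=
  hm.comp (measurable_const.sub measurable_id)

lemma measurable_comp_sub {m : ℝ → ℝ≥0∞} (hm : Measurable m) :
    Measurable fun p : ℝ × ℝ => m (p.1 - p.2) :=
  hm.comp (measurable_fst.sub measurable_snd)

lemma measurable_lintegral_sub {ρ : Measure ℝ} [SFinite ρ] {m : ℝ → ℝ≥0∞} (hm : Measurable m) :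
    Measurable fun t => ∫⁻ τ, m (t - τ) ∂ρ :=
  Measurable.lintegral_prod_right' (measurable_comp_sub hm)

/-- The resolvent of a convolution equation with a small finite measure, in `L²`. -/
lemma exists_resolvent {ρ : Measure ℝ} [IsFiniteMeasure ρ] (hρ : ρ Set.univ ≤ 2⁻¹) {g : ℝ → ℝ≥0∞}
    (hg : Measurable g) (hg2 : ∫⁻ t, g t ^ 2 ≠ ⊤) :
    ∃ m : ℝ → ℝ≥0∞, Measurable m ∧ (∀ t, m t = g t + ∫⁻ τ, m (t - τ) ∂ρ) ∧
      ∫⁻ t, m t ^ 2 ≠ ⊤ := by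
  -- Picard iteration from `0`. It increases, so its supremum solves the equation by monotone
  -- convergence, without any a priori finiteness.
  let step : (ℝ → ℝ≥0∞) → ℝ → ℝ≥0∞ := fun m t => g t + ∫⁻ τ, m (t - τ) ∂ρ
  let M : ℕ → ℝ → ℝ≥0∞ := fun n => step^[n] 0
  have hsucc : ∀ n t, M (n + 1) t = g t + ∫⁻ τ, M n (t - τ) ∂ρ := by
    intro n t
    simp only [M, Function.iterate_succ_apply']
    rfl
  have hmeas : ∀ n, Measurable (M n) := by
    intro n
    induction n with
    | zero => exact measurable_zero
    | succ n ih =>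
      have : M (n + 1) = fun t => g t + ∫⁻ τ, M n (t - τ) ∂ρ := funext (hsucc n)
      rw [this]
      exact hg.add (measurable_lintegral_sub ih)
  have hmono1 : ∀ n t, M n t ≤ M (n + 1) t := by
    intro n
    induction n with
    | zero => exact fun t => zero_le
    | succ n ih =>
      intro t
      rw [hsucc, hsucc]
      gcongr
      exact ih _
  have hmono : ∀ t, Monotone fun n => M n t := fun t => monotone_nat_of_le_succ fun n => hmono1 n t
  -- The constant `4` is self-reproducing: convolution costs at most `1/4` in the squared norm, and
  -- `2 + 2 · (1/4) · 4 = 4`.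
  have hbound : ∀ n, ∫⁻ t, M n t ^ 2 ≤ 4 * ∫⁻ t, g t ^ 2 := by
    intro n
    induction n with
    | zero =>
      have : ∀ t, M 0 t = 0 := fun t => rfl
      simp [this]
    | succ n ih =>
      have h1 : ∫⁻ t, (∫⁻ τ, M n (t - τ) ∂ρ) ^ 2 ≤ 4⁻¹ * ∫⁻ t, M n t ^ 2 := by
        calc _ ≤ ∫⁻ t, ρ Set.univ * ∫⁻ τ, M n (t - τ) ^ 2 ∂ρ := by
              refine lintegral_mono fun t => lintegral_sq_le_of_measure ?_
              exact (measurable_comp_const_sub (hmeas n) t).aemeasurable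
          _ = ρ Set.univ * ∫⁻ t, ∫⁻ τ, M n (t - τ) ^ 2 ∂ρ :=
              lintegral_const_mul _ (measurable_lintegral_sub ((hmeas n).pow_const 2))
          _ = ρ Set.univ * ∫⁻ τ, (∫⁻ t, M n (t - τ) ^ 2) ∂ρ := by
              rw [lintegral_lintegral_swap]
              exact (measurable_comp_sub ((hmeas n).pow_const 2)).aemeasurable
          _ = ρ Set.univ * (ρ Set.univ * ∫⁻ t, M n t ^ 2) := by
              congr 1
              have : ∀ τ, ∫⁻ t, M n (t - τ) ^ 2 = ∫⁻ t, M n t ^ 2 := fun τ =>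
                lintegral_sub_right_eq_self (fun t => M n t ^ 2) τ
              rw [lintegral_congr this, lintegral_const, mul_comm]
          _ ≤ 2⁻¹ * (2⁻¹ * ∫⁻ t, M n t ^ 2) := by gcongr
          _ = _ := by
              rw [← mul_assoc, ← ENNReal.mul_inv (by simp) (by simp)]
              norm_num
      calc ∫⁻ t, M (n + 1) t ^ 2
          ≤ ∫⁻ t, (2 * g t ^ 2 + 2 * (∫⁻ τ, M n (t - τ) ∂ρ) ^ 2) := by
            refine lintegral_mono fun t => ?_
            rw [hsucc]
            exact add_sq_le_two_mul _ _
        _ = 2 * (∫⁻ t, g t ^ 2) + 2 * ∫⁻ t, (∫⁻ τ, M n (t - τ) ∂ρ) ^ 2 := by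
            rw [lintegral_add_left (by fun_prop), lintegral_const_mul _ (by fun_prop),
              lintegral_const_mul _ ((measurable_lintegral_sub (hmeas n)).pow_const 2)]
        _ ≤ 2 * (∫⁻ t, g t ^ 2) + 2 * (4⁻¹ * (4 * ∫⁻ t, g t ^ 2)) := by
            gcongr
            exact h1.trans (by gcongr)
        _ = _ := by
            rw [← mul_assoc 4⁻¹, ENNReal.inv_mul_cancel (by simp) (by simp), one_mul, ← add_mul]
            norm_num
  refine ⟨fun t => ⨆ n, M n t, Measurable.iSup hmeas, fun t => ?_, ?_⟩
  · change ⨆ n, M n t = g t + ∫⁻ τ, ⨆ n, M n (t - τ) ∂ρ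
    rw [lintegral_iSup (fun n => measurable_comp_const_sub (hmeas n) t)
      (fun i j h τ => hmono (t - τ) h),
      ENNReal.add_iSup, ← (hmono t).iSup_nat_add 1]
    simp_rw [hsucc]
  · have h2 : ∀ t, (⨆ n, M n t) ^ 2 = ⨆ n, M n t ^ 2 := by
      intro t
      exact Monotone.map_iSup_of_continuousAt (f := fun x : ℝ≥0∞ => x ^ 2)
        (ENNReal.continuous_pow 2).continuousAt (fun a b h => pow_le_pow_left' h 2) (by simp)
    simp_rw [h2]
    rw [lintegral_iSup (fun n => (hmeas n).pow_const 2)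
      (fun i j h t => pow_le_pow_left' (hmono t h) 2)]
    exact ((iSup_le hbound).trans_lt (ENNReal.mul_lt_top (by simp) hg2.lt_top)).ne

/-- The resolvent of a weakly singular convolution equation, in `L²` on bounded time intervals. -/
lemma exists_majorant {α : ℝ} (hα : α < 1) (K T : ℝ) {g : ℝ → ℝ≥0∞}
    (hg : Measurable g) (hg2 : ∫⁻ t, g t ^ 2 ≠ ⊤) (hg0 : ∀ t ≤ 0, g t = 0) :
    ∃ m : ℝ → ℝ≥0∞, Measurable m ∧
      (∀ t, m t = g t + ENNReal.ofReal K * ∫⁻ τ, m (t - τ) ∂(weakSing α)) ∧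
      ∫⁻ t in Set.Iic T, m t ^ 2 ≠ ⊤ := by
  obtain ⟨γ, hγ0, hγ⟩ := (eventually_lintegral_exp_le hα K).exists
  set w : ℝ → ℝ≥0∞ := fun t => ENNReal.ofReal (Real.exp (γ * t)) with hw
  set w' : ℝ → ℝ≥0∞ := fun t => ENNReal.ofReal (Real.exp (-γ * t)) with hw'
  have hwm : Measurable w := by fun_prop
  have hwm' : Measurable w' := by fun_prop
  have hww : ∀ t τ, w t * w' τ = w (t - τ) := fun t τ => by
    simp only [hw, hw']
    rw [← ENNReal.ofReal_mul (Real.exp_pos _).le, ← Real.exp_add]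
    ring_nf
  -- The damped kernel has mass at most `1/2`, so the resolvent applies to the weighted unknown
  -- `e^{-γt} m`.
  set ρ : Measure ℝ := ENNReal.ofReal K • (weakSing α).withDensity w' with hρ
  have hρu : ρ Set.univ ≤ 2⁻¹ := by
    rw [hρ, Measure.smul_apply, withDensity_apply _ MeasurableSet.univ, Measure.restrict_univ]
    exact hγ
  have : IsFiniteMeasure ρ := ⟨hρu.trans_lt (by simp)⟩
  have hgw : ∫⁻ t, (g t * w' t) ^ 2 ≠ ⊤ := by
    refine ne_top_of_le_ne_top hg2 (lintegral_mono fun t => ?_)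
    rcases le_total t 0 with h | h
    · simp [hg0 t h]
    · rw [mul_pow]
      refine mul_le_of_le_one_right zero_le (pow_le_one₀ zero_le ?_)
      simp only [hw']
      rw [ENNReal.ofReal_le_one, Real.exp_le_one_iff]
      nlinarith
  obtain ⟨m, hm, hmeq, hm2⟩ := exists_resolvent hρu (hg.mul hwm') hgw
  have hcan : ∀ t, w' t * w t = 1 := fun t => by
    simp only [hw, hw']
    rw [← ENNReal.ofReal_mul (Real.exp_pos _).le, ← Real.exp_add]
    simp
  refine ⟨fun t => m t * w t, hm.mul hwm, fun t => ?_, ?_⟩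
  · have h1 : ∫⁻ τ, m (t - τ) ∂ρ =
        ENNReal.ofReal K * ∫⁻ τ, w' τ * m (t - τ) ∂(weakSing α) := by
      rw [hρ, lintegral_smul_measure, lintegral_withDensity_eq_lintegral_mul _ hwm'
        (measurable_comp_const_sub hm t)]
      rfl
    change m t * w t = g t + ENNReal.ofReal K * ∫⁻ τ, m (t - τ) * w (t - τ) ∂(weakSing α)
    rw [hmeq t, add_mul, Pi.mul_apply, mul_assoc, hcan, mul_one, h1, mul_assoc,
      ← lintegral_mul_const (w t) (show Measurable fun τ => w' τ * m (t - τ) from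
        hwm'.mul (measurable_comp_const_sub hm t))]
    congr 2
    refine lintegral_congr fun τ => ?_
    rw [← hww]
    ring
  · refine ne_top_of_le_ne_top (ENNReal.mul_ne_top (ENNReal.pow_ne_top (n := 2)
      (ENNReal.ofReal_ne_top (r := Real.exp (γ * T)))) hm2) ?_
    rw [← lintegral_const_mul _ (hm.pow_const 2)]
    refine (setLIntegral_mono (by fun_prop) fun t ht => ?_).trans
      (setLIntegral_le_lintegral (Set.Iic T) _)
    rw [mul_pow, mul_comm]
    gcongr
    exact ENNReal.ofReal_le_ofReal (Real.exp_le_exp.2 (mul_le_mul_of_nonneg_left ht hγ0.le))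

lemma lintegral_Ioc_eq (f : ℝ → ℝ≥0∞) (x h : ℝ) :
    ∫⁻ y in Set.Ioc x (x + h), f y = ∫⁻ y in Set.Ioc 0 h, f (x + y) := by
  rw [← lintegral_indicator measurableSet_Ioc, ← lintegral_indicator measurableSet_Ioc,
    ← lintegral_add_left_eq_self _ x]
  refine lintegral_congr fun y => ?_
  simp only [Set.indicator, Set.mem_Ioc, lt_add_iff_pos_right, add_le_add_iff_left]

/-- Comparison of the increments of the solution of a weakly singular Volterra equation with
the integral of the majorant. -/
lemma enorm_sub_le_lintegral_majorant {α : ℝ} (hα : α < 1) {K T B : ℝ} {g m : ℝ → ℝ≥0∞}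
    {Q : ℝ → ℂ} (hg : Measurable g) (hm : Measurable m)
    (hmeq : ∀ t, m t = g t + ENNReal.ofReal K * ∫⁻ τ, m (t - τ) ∂(weakSing α))
    (hQB : ∀ t, ‖Q t‖ ≤ B) (hQ0 : ∀ t ≤ 0, Q t = Q 0)
    (hineq : ∀ h, 0 ≤ h → ∀ x, x + h ≤ T → ‖Q (x + h) - Q x‖ₑ ≤ (∫⁻ y in Set.Ioc x (x + h), g y) +
      ENNReal.ofReal K * ∫⁻ τ, ‖Q (x + h - τ) - Q (x - τ)‖ₑ ∂(weakSing α))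
    {r t : ℝ} (hrt : r ≤ t) (htT : t ≤ T) : ‖Q t - Q r‖ₑ ≤ ∫⁻ y in Set.Ioc r t, m y := by
  set h := t - r with hh
  have hh0 : 0 ≤ h := sub_nonneg.2 hrt
  set D : ℝ → ℝ≥0∞ := fun x => ∫⁻ y in Set.Ioc x (x + h), m y with hD
  set d : ℝ → ℝ≥0∞ := fun x => ‖Q (x + h) - Q x‖ₑ with hd
  have hDm : Measurable D := by
    have : D = fun x => ∫⁻ y in Set.Ioc 0 h, m (x + y) := funext fun x => lintegral_Ioc_eq m x h
    rw [this]
    exact Measurable.lintegral_prod_right' (f := fun p : ℝ × ℝ => m (p.1 + p.2))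
      (hm.comp (measurable_fst.add measurable_snd))
  have hDeq : ∀ x, D x = (∫⁻ y in Set.Ioc x (x + h), g y) +
      ENNReal.ofReal K * ∫⁻ τ, D (x - τ) ∂(weakSing α) := by
    intro x
    have h1 : D x = ∫⁻ y in Set.Ioc x (x + h),
        (g y + ENNReal.ofReal K * ∫⁻ τ, m (y - τ) ∂(weakSing α)) := by
      simp only [hD]
      exact lintegral_congr fun y => hmeq y
    rw [h1, lintegral_add_left hg, lintegral_const_mul _ (measurable_lintegral_sub hm), lintegral_lintegral_swap]
    · congr 2
      refine lintegral_congr fun τ => ?_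
      simp only [hD]
      rw [lintegral_Ioc_eq, lintegral_Ioc_eq]
      refine lintegral_congr fun y => ?_
      congr 1
      ring
    · exact (measurable_comp_sub hm).aemeasurable
  -- The window integrals `D` satisfy with equality the relation that the increments `d` satisfy as
  -- an inequality. The truncated difference `d - D` thus obeys the homogeneous inequality. It
  -- vanishes before `-h`, where both ends of the window lie in the range on which `Q` is constant.
  have key := eq_zero_of_le_lintegral_weakSing_of_bounded hα (K := K)
    (C := ENNReal.ofReal (B + B)) (e := fun x => d x - D x) (a := -h) (b := T - h)
    ENNReal.ofReal_ne_top (fun x _ => ?_) (fun x hx => ?_) (fun x hx => ?_)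
  · have h2 := key r (by linarith)
    simp only [hd, hD] at h2
    rw [show r + h = t by rw [hh]; ring] at h2
    exact tsub_eq_zero_iff_le.1 h2
  · refine tsub_le_self.trans ?_
    simp only [hd]
    rw [← ofReal_norm]
    exact ENNReal.ofReal_le_ofReal ((norm_sub_le _ _).trans (add_le_add (hQB _) (hQB _)))
  · have : d x = 0 := by
      simp only [hd]
      rw [hQ0 (x + h) (by linarith), hQ0 x (by linarith), sub_self, enorm_zero]
    simp [this]
  · have h3 := hineq h hh0 x (by linarith)
    have h4 : ∀ τ, ‖Q (x + h - τ) - Q (x - τ)‖ₑ = d (x - τ) := fun τ => by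
      simp only [hd]
      congr 2
      congr 1
      ring
    simp_rw [h4] at h3
    calc d x - D x ≤ ((∫⁻ y in Set.Ioc x (x + h), g y) +
          ENNReal.ofReal K * ∫⁻ τ, d (x - τ) ∂(weakSing α)) -
          ((∫⁻ y in Set.Ioc x (x + h), g y) +
          ENNReal.ofReal K * ∫⁻ τ, D (x - τ) ∂(weakSing α)) :=
          tsub_le_tsub h3 (hDeq x).ge
      _ ≤ ENNReal.ofReal K * (∫⁻ τ, d (x - τ) ∂(weakSing α)) -
          ENNReal.ofReal K * ∫⁻ τ, D (x - τ) ∂(weakSing α) := add_tsub_add_le_tsub_left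
      _ = ENNReal.ofReal K * ((∫⁻ τ, d (x - τ) ∂(weakSing α)) -
          ∫⁻ τ, D (x - τ) ∂(weakSing α)) := by
          rw [ENNReal.mul_sub]
          exact fun _ _ => ENNReal.ofReal_ne_top
      _ ≤ _ := by
          gcongr
          exact lintegral_sub_le _ _ (measurable_comp_const_sub hDm x)

/-- Absolute continuity is inherited from the primitive of `m`. At almost every point both functions
are differentiable, and comparing right difference quotients bounds the derivative. -/
lemma integral_deriv_of_majorant {f m : ℝ → ℝ} {T : ℝ} (hT : 0 ≤ T)
    (hm : IntervalIntegrable m volume 0 T)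
    (h : ∀ r t, 0 ≤ r → r ≤ t → t ≤ T → |f t - f r| ≤ ∫ τ in r..t, m τ) :
    (∀ t ∈ Set.Icc 0 T, ∫ τ in (0 : ℝ)..t, deriv f τ = f t - f 0) ∧
      IntervalIntegrable (deriv f) volume 0 T ∧
      ∀ᵐ x, x ∈ Set.Ioo 0 T → |deriv f x| ≤ m x := by
  have hmM : ∀ r t, 0 ≤ r → r ≤ t → t ≤ T →
      (∫ τ in (0 : ℝ)..t, m τ) - ∫ τ in (0 : ℝ)..r, m τ = ∫ τ in r..t, m τ := by
    intro r t hr hrt ht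
    refine intervalIntegral.integral_interval_sub_left (hm.mono_set ?_) (hm.mono_set ?_) <;>
    · rw [Set.uIcc_of_le (by linarith), Set.uIcc_of_le hT]
      exact Set.Icc_subset_Icc_right (by linarith)
  have hAC : AbsolutelyContinuousOnInterval f 0 T := by
    have hM := hm.absolutelyContinuousOnInterval_intervalIntegral (c := 0) (by simp)
    rw [absolutelyContinuousOnInterval_iff] at hM ⊢
    intro ε hε
    obtain ⟨δ, hδ, hE⟩ := hM ε hε
    refine ⟨δ, hδ, fun E hEm hEd => lt_of_le_of_lt (Finset.sum_le_sum fun i hi => ?_)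
      (hE E hEm hEd)⟩
    have hmem := hEm.1 i hi
    rw [Set.uIcc_of_le hT] at hmem
    rw [Real.dist_eq, Real.dist_eq]
    rcases le_total (E.2 i).1 (E.2 i).2 with hle | hle
    · rw [abs_sub_comm, abs_sub_comm (∫ τ in (0 : ℝ)..(E.2 i).1, m τ),
        hmM _ _ hmem.1.1 hle hmem.2.2]
      exact (h _ _ hmem.1.1 hle hmem.2.2).trans (le_abs_self _)
    · rw [hmM _ _ hmem.2.1 hle hmem.1.2]
      exact (h _ _ hmem.2.1 hle hmem.1.2).trans (le_abs_self _)
  refine ⟨fun t ht => ?_, hAC.intervalIntegrable_deriv, ?_⟩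
  · refine (hAC.mono ?_).integral_deriv_eq_sub
    rw [Set.uIcc_of_le ht.1, Set.uIcc_of_le hT]
    exact Set.Icc_subset_Icc_right ht.2
  · filter_upwards [hAC.ae_differentiableAt, hm.ae_hasDerivAt_integral] with x hx1 hx2 hx
    have hxI : x ∈ Set.uIcc 0 T := by
      rw [Set.uIcc_of_le hT]
      exact ⟨hx.1.le, hx.2.le⟩
    have h1 := (hx1 hxI).hasDerivAt.tendsto_slope_zero_right
    have h2 := (hx2 hxI 0 (by simp)).tendsto_slope_zero_right
    refine le_of_tendsto_of_tendsto h1.abs h2 ?_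
    have hev : ∀ᶠ t : ℝ in 𝓝[>] 0, t < T - x :=
      eventually_nhdsWithin_of_eventually_nhds (gt_mem_nhds (by linarith [hx.2]))
    filter_upwards [hev, self_mem_nhdsWithin] with t ht ht0
    have ht0' : 0 < t := ht0
    rw [smul_eq_mul, smul_eq_mul, abs_mul, abs_of_pos (inv_pos.2 ht0')]
    gcongr
    rw [hmM x (x + t) hx.1.le (by linarith) (by linarith)]
    exact h x (x + t) hx.1.le (by linarith) (by linarith)

/-- A function whose increments are dominated by the integral of an `L²` function is the integral
of an `L²` function. -/
lemma exists_density_of_majorant {N : ℝ → ℂ} {m : ℝ → ℝ≥0∞} {T : ℝ} (hT : 0 ≤ T)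
    (hm : Measurable m) (hm2 : ∫⁻ t in Set.Iic T, m t ^ 2 ≠ ⊤)
    (h : ∀ r t, 0 ≤ r → r ≤ t → t ≤ T → ‖N t - N r‖ₑ ≤ ∫⁻ y in Set.Ioc r t, m y) :
    ∃ n : ℝ → ℂ, MemLp n 2 volume ∧ (∀ τ, τ ∉ Set.Ioc 0 T → n τ = 0) ∧
      ∀ t ∈ Set.Icc 0 T, N t = N 0 + ∫ τ in (0 : ℝ)..t, n τ := by
  set m' : ℝ → ℝ := fun t => (m t).toReal with hm'
  have hm2' : ∫⁻ t in Set.Ioc 0 T, m t ^ 2 ≠ ⊤ :=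
    ne_top_of_le_ne_top hm2 (lintegral_mono_set Set.Ioc_subset_Iic_self)
  have hfin : ∀ᵐ t ∂(volume.restrict (Set.Ioc 0 T)), m t < ⊤ := by
    filter_upwards [ae_lt_top (by fun_prop) hm2'] with t ht
    by_contra hcon
    rw [not_lt, top_le_iff] at hcon
    simp [hcon] at ht
  have hmL : MemLp m' 2 (volume.restrict (Set.Ioc 0 T)) := by
    have hmm : Measurable m' := hm.ennreal_toReal
    rw [memLp_two_iff_integrable_sq_norm hmm.aestronglyMeasurable]
    refine ⟨(hmm.norm.pow_const 2).aestronglyMeasurable, ?_⟩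
    rw [HasFiniteIntegral]
    refine lt_of_le_of_lt (lintegral_mono fun t => ?_) hm2'.lt_top
    rw [Real.norm_of_nonneg ENNReal.toReal_nonneg, Real.enorm_of_nonneg (by positivity),
      ENNReal.ofReal_pow ENNReal.toReal_nonneg]
    gcongr
    exact ENNReal.ofReal_toReal_le
  have hmi : IntervalIntegrable m' volume 0 T := by
    rw [intervalIntegrable_iff_integrableOn_Ioc_of_le hT]
    exact hmL.integrable (by norm_num)
  have h' : ∀ r t, 0 ≤ r → r ≤ t → t ≤ T → ‖N t - N r‖ ≤ ∫ τ in r..t, m' τ := by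
    intro r t hr hrt ht
    have hsub : Set.Ioc r t ⊆ Set.Ioc 0 T := Set.Ioc_subset_Ioc hr ht
    have hfin' : ∀ᵐ t ∂(volume.restrict (Set.Ioc r t)), m t < ⊤ :=
      ae_restrict_of_ae_restrict_of_subset hsub hfin
    rw [intervalIntegral.integral_of_le hrt, integral_toReal hm.aemeasurable hfin']
    have h1 := h r t hr hrt ht
    have hne : ∫⁻ y in Set.Ioc r t, m y ≠ ⊤ := by
      have h2 : IntegrableOn m' (Set.Ioc r t) := by
        rw [intervalIntegrable_iff_integrableOn_Ioc_of_le hT] at hmi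
        exact hmi.mono_set hsub
      have h3 := h2.2
      rw [HasFiniteIntegral] at h3
      refine ne_top_of_le_ne_top h3.ne (lintegral_mono_ae ?_)
      filter_upwards [hfin'] with y hy
      rw [Real.enorm_of_nonneg ENNReal.toReal_nonneg, ENNReal.ofReal_toReal hy.ne]
    have h2 := ENNReal.toReal_mono hne h1
    rwa [toReal_enorm] at h2
  obtain ⟨hre, hrei, hreb⟩ := integral_deriv_of_majorant (f := fun t => (N t).re) hT hmi
    fun r t hr hrt ht => by
      rw [← Complex.sub_re]
      exact (Complex.abs_re_le_norm _).trans (h' r t hr hrt ht)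
  obtain ⟨him, himi, himb⟩ := integral_deriv_of_majorant (f := fun t => (N t).im) hT hmi
    fun r t hr hrt ht => by
      rw [← Complex.sub_im]
      exact (Complex.abs_im_le_norm _).trans (h' r t hr hrt ht)
  -- Differentiation of absolutely continuous functions is applied to the real and imaginary parts,
  -- which is why `m` is doubled in the bound for `d`.
  set d : ℝ → ℂ := fun t => ((deriv (fun t => (N t).re) t : ℝ) : ℂ) +
    ((deriv (fun t => (N t).im) t : ℝ) : ℂ) * Complex.I with hd
  have hdm : Measurable d := by
    have h1 := measurable_deriv fun t => (N t).re
    have h2 := measurable_deriv fun t => (N t).im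
    exact (Complex.measurable_ofReal.comp h1).add
      ((Complex.measurable_ofReal.comp h2).mul_const _)
  refine ⟨(Set.Ioc 0 T).indicator d, ?_, fun τ hτ => Set.indicator_of_notMem hτ _,
    fun t ht => ?_⟩
  · rw [memLp_indicator_iff_restrict measurableSet_Ioc]
    refine (hmL.const_mul 2).mono' hdm.aestronglyMeasurable ?_
    have hne : ∀ᵐ x : ℝ, x ≠ T := by simp [ae_iff]
    rw [ae_restrict_iff' measurableSet_Ioc]
    filter_upwards [hreb, himb, hne] with x h1 h2 h3 hx
    have hx' : x ∈ Set.Ioo 0 T := ⟨hx.1, lt_of_le_of_ne hx.2 h3⟩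
    simp only [hd]
    refine (norm_add_le _ _).trans ?_
    rw [norm_mul, Complex.norm_I, mul_one, Complex.norm_real, Complex.norm_real]
    have := h1 hx'
    have := h2 hx'
    simp only [Real.norm_eq_abs]
    linarith
  · have hsub : Set.uIcc 0 t ⊆ Set.uIcc 0 T := by
      rw [Set.uIcc_of_le ht.1, Set.uIcc_of_le hT]
      exact Set.Icc_subset_Icc_right ht.2
    have h1 : ∫ τ in (0 : ℝ)..t, (Set.Ioc 0 T).indicator d τ = ∫ τ in (0 : ℝ)..t, d τ := by
      refine intervalIntegral.integral_congr_ae (Eventually.of_forall fun τ hτ => ?_)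
      rw [Set.uIoc_of_le ht.1] at hτ
      exact Set.indicator_of_mem (show τ ∈ Set.Ioc 0 T from ⟨hτ.1, hτ.2.trans ht.2⟩) _
    have h2 : IntervalIntegrable (fun τ => ((deriv (fun t => (N t).re) τ : ℝ) : ℂ)) volume 0 t :=
      ⟨(hrei.mono_set hsub).1.ofReal, (hrei.mono_set hsub).2.ofReal⟩
    have h3 : IntervalIntegrable (fun τ => ((deriv (fun t => (N t).im) τ : ℝ) : ℂ)) volume 0 t :=
      ⟨(himi.mono_set hsub).1.ofReal, (himi.mono_set hsub).2.ofReal⟩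
    rw [h1, hd, intervalIntegral.integral_add h2 (h3.mul_const _),
      intervalIntegral.integral_mul_const, intervalIntegral.integral_ofReal,
      intervalIntegral.integral_ofReal, hre t ht, him t ht]
    apply Complex.ext <;> simp

/-! ### The charge equation as a Volterra equation -/

lemma integrable_weakSing_comp_sub {α : ℝ} (hα : α < 1) {u : ℝ → ℂ} (hu : Continuous u)
    (hu0 : ∀ t ≤ 0, u t = 0) (x : ℝ) : Integrable (fun τ => u (x - τ)) (weakSing α) := by
  obtain ⟨C, hC⟩ := (isCompact_Icc (a := 0) (b := x)).exists_bound_of_continuousOn hu.continuousOn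
  refine ((integrable_exp_weakSing hα one_pos).const_mul (|C| * Real.exp x)).mono'
    (Continuous.aestronglyMeasurable (by fun_prop)) ?_
  filter_upwards [ae_weakSing_pos α] with τ hτ
  rw [mul_assoc, ← Real.exp_add]
  rcases le_total τ x with h | h
  · calc _ ≤ |C| * 1 := by
          rw [mul_one]
          exact (hC _ ⟨by linarith, by linarith⟩).trans (le_abs_self C)
      _ ≤ _ := by
          gcongr
          rw [Real.one_le_exp_iff]
          linarith
  · rw [hu0 _ (by linarith), norm_zero]
    positivity

lemma intervalIntegrable_div_rpow {α : ℝ} (hα : α < 1) {N : ℝ → ℂ} {t : ℝ} (ht : 0 ≤ t)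
    (hN : ContinuousOn N (Set.Icc 0 t)) :
    IntervalIntegrable (fun τ => N τ / (((t - τ) ^ α : ℝ) : ℂ)) volume 0 t := by
  have h1 := (intervalIntegral.intervalIntegrable_rpow' (a := 0) (b := t)
    (r := -α) (by linarith)).comp_sub_left t
  simp only [sub_zero, sub_self] at h1
  have h2 : IntervalIntegrable (fun τ => (((t - τ) ^ (-α) : ℝ) : ℂ)) volume 0 t :=
    ⟨h1.2.ofReal, h1.1.ofReal⟩
  rw [← Set.uIcc_of_le ht] at hN
  refine (h2.continuousOn_mul hN).congr fun τ hτ => ?_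
  rw [Set.uIoc_of_le ht] at hτ
  rw [Real.rpow_neg (by linarith [hτ.2]), Complex.ofReal_inv, div_eq_mul_inv]

/-- Subtracting the initial value makes the integrand vanish at negative times, so the convolution
with the infinite measure `weakSing α` converges and commutes with time shifts. -/
lemma integral_div_rpow_eq {α : ℝ} (hα : α < 1) {N : ℝ → ℂ} (hN : Continuous N)
    (hN0 : ∀ t ≤ 0, N t = N 0) {t : ℝ} (ht : 0 ≤ t) :
    ∫ τ in (0 : ℝ)..t, N τ / (((t - τ) ^ α : ℝ) : ℂ) =
      (∫ τ in (0 : ℝ)..t, N 0 / (((t - τ) ^ α : ℝ) : ℂ)) +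
        ∫ τ, (N (t - τ) - N 0) ∂(weakSing α) := by
  rw [integral_weakSing_eq (u := fun x => N x - N 0) (fun x hx => by simp [hN0 x hx]) ht,
    ← intervalIntegral.integral_add (intervalIntegrable_div_rpow hα ht continuousOn_const)
    (intervalIntegrable_div_rpow (N := fun x => N x - N 0) hα ht
      (hN.sub continuous_const).continuousOn)]
  congr 1
  funext τ
  ring

lemma value_propagator {s : ℝ} (hs : 1 / 2 < s) {u : L2} (hu : FormInt s (𝓕 u : L2)) (t : ℝ) :
    value (propagator s t u) 0 = ∫ ξ, phase s t ξ * (𝓕 u : L2) ξ := by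
  have h := fourier_propagator s t u
  have h' : (𝓕 (propagator s t u) : L2) =ᵐ[volume] fun ξ => phase s t ξ * (𝓕 u : L2) ξ := by
    filter_upwards [h] with ξ hξ
    rw [hξ, phase]
  rw [value_eq_integral, integral_congr_ae h']
  exact (integrable_phase_mul_of_integrable (hu.integrable hs) t).congr h'.symm

lemma one_div_two_mul_lt_one {s : ℝ} (hs : 1 / 2 < s) : 1 / (2 * s) < 1 := by
  rw [div_lt_one (by linarith)]
  linarith

/-- The time density of the corrected free evolution at the origin. -/
lemma exists_free_density {s : ℝ} (hs : 1 / 2 < s) {U H : L2} {z : ℂ} (h : Graph s U H z) (T : ℝ) :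
    ∃ g : ℝ → ℂ, MemLp g 2 volume ∧ (∀ τ, τ ∉ Set.Ioc 0 T → g τ = 0) ∧
      ∀ t ∈ Set.Icc 0 T, (∫ ξ, phase s t ξ * U ξ) - (∫ ξ, U ξ) -
        Complex.I * kernelConst s *
          ∫ τ in (0 : ℝ)..t, z / (((t - τ) ^ (1 / (2 * s)) : ℝ) : ℂ) =
        ∫ τ in (0 : ℝ)..t, g τ := by
  obtain ⟨g, hg⟩ := exists_smoothing_density hs T H
  refine ⟨(Set.Ioc 0 T).indicator fun τ => -Complex.I * g τ,
    ((Lp.memLp g).const_mul _).indicator measurableSet_Ioc,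
    fun τ hτ => Set.indicator_of_notMem hτ _, fun t ht => ?_⟩
  rw [free_sub_eq_integral hs h ht.1, ← hg t ht, ← intervalIntegral.integral_const_mul]
  refine intervalIntegral.integral_congr_ae (Eventually.of_forall fun τ hτ => ?_)
  rw [Set.uIoc_of_le ht.1] at hτ
  rw [Set.indicator_of_mem (show τ ∈ Set.Ioc 0 T from ⟨hτ.1, hτ.2.trans ht.2⟩)]

/-- A charge extended by constants to the real line. -/
def extend {T : ℝ} (hT : 0 ≤ T) (q : ℝ → ℂ) : ℝ → ℂ := Set.IccExtend hT (Set.domRestrict _ q)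

lemma extend_of_mem {T : ℝ} (hT : 0 ≤ T) (q : ℝ → ℂ) {t : ℝ} (ht : t ∈ Set.Icc 0 T) :
    extend hT q t = q t := by
  rw [extend, Set.IccExtend_of_mem hT _ ht]
  rfl

lemma extend_of_le {T : ℝ} (hT : 0 ≤ T) (q : ℝ → ℂ) {t : ℝ} (ht : t ≤ 0) :
    extend hT q t = q 0 := by
  rw [extend, Set.IccExtend_of_le_left hT _ ht]
  rfl

lemma extend_zero {T : ℝ} (hT : 0 ≤ T) (q : ℝ → ℂ) : extend hT q 0 = q 0 :=
  extend_of_le hT q le_rfl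

lemma continuous_extend {T : ℝ} (hT : 0 ≤ T) {q : ℝ → ℂ} (hq : ContinuousOn q (Set.Icc 0 T)) :
    Continuous (extend hT q) :=
  (continuousOn_iff_continuous_domRestrict.1 hq).Icc_extend'

lemma exists_bound_extend {T : ℝ} (hT : 0 ≤ T) {q : ℝ → ℂ} (hq : ContinuousOn q (Set.Icc 0 T)) :
    ∃ B, ∀ t, ‖extend hT q t‖ ≤ B := by
  obtain ⟨B, hB⟩ := isCompact_Icc.exists_bound_of_continuousOn hq
  exact ⟨B, fun t => hB _ (Set.projIcc 0 T hT t).2⟩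

/-- The shifted form of the charge equation. -/
lemma IsChargeSolution.extend_eq {s σ β T : ℝ} (hs : 1 / 2 < s) (hσ : 0 < σ) (hT : 0 ≤ T)
    {ψ₀ : L2} {q : ℝ → ℂ} (hq : IsChargeSolution s σ β T ψ₀ q) {t : ℝ} (ht : t ∈ Set.Icc 0 T) :
    extend hT q t = value (propagator s t ψ₀) 0 -
      Complex.I * kernelConst s * (∫ τ in (0 : ℝ)..t,
        nonlin σ β (q 0) / (((t - τ) ^ (1 / (2 * s)) : ℝ) : ℂ)) -
      Complex.I * kernelConst s * ∫ τ, (nonlin σ β (extend hT q (t - τ)) - nonlin σ β (q 0))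
        ∂(weakSing (1 / (2 * s))) := by
  have hc := (continuous_nonlin (β := β) hσ).comp (continuous_extend hT hq.continuousOn)
  have h := integral_div_rpow_eq (one_div_two_mul_lt_one hs) hc
    (fun t ht => by simp [extend_of_le hT q ht, extend_zero]) ht.1
  simp only [Function.comp, extend_zero] at h
  have h2 : ∫ τ in (0 : ℝ)..t, nonlin σ β (q τ) / (((t - τ) ^ (1 / (2 * s)) : ℝ) : ℂ) =
      ∫ τ in (0 : ℝ)..t, nonlin σ β (extend hT q τ) / (((t - τ) ^ (1 / (2 * s)) : ℝ) : ℂ) := by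
    refine intervalIntegral.integral_congr fun τ hτ => ?_
    rw [Set.uIcc_of_le ht.1] at hτ
    rw [extend_of_mem hT q ⟨hτ.1, hτ.2.trans ht.2⟩]
  have h3 := hq.eqn t ht
  rw [h2, h] at h3
  rw [extend_of_mem hT q ht, ← h3]
  ring

lemma IsChargeSolution.apply_zero {s σ β T : ℝ} (hT : 0 ≤ T) {ψ₀ : L2} {q : ℝ → ℂ}
    (hq : IsChargeSolution s σ β T ψ₀ q) : q 0 = value (propagator s 0 ψ₀) 0 := by
  have h := hq.eqn 0 ⟨le_rfl, hT⟩
  simpa using h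

lemma propagator_zero (s : ℝ) (u : L2) : propagator s 0 u = u := by
  apply (Lp.fourierTransformₗᵢ ℝ ℂ).injective
  refine Lp.ext ?_
  filter_upwards [fourier_propagator s 0 u] with ξ hξ
  exact hξ.trans (by simp; rfl)

/-- The charge equation has at most one continuous solution. -/
lemma IsChargeSolution.eqOn {s σ β T : ℝ} (hs : 1 / 2 < s) (hσ : 0 < σ) (hT : 0 ≤ T)
    {ψ₀ : L2} {q q' : ℝ → ℂ} (hq : IsChargeSolution s σ β T ψ₀ q)
    (hq' : IsChargeSolution s σ β T ψ₀ q') : Set.EqOn q q' (Set.Icc 0 T) := by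
  have hα := one_div_two_mul_lt_one hs
  obtain ⟨B, hB⟩ := exists_bound_extend hT hq.continuousOn
  obtain ⟨B', hB'⟩ := exists_bound_extend hT hq'.continuousOn
  obtain ⟨P, L, hP, hPeq⟩ := exists_lipschitz_nonlin (β := β) hσ (max B B')
  have h0 : q 0 = q' 0 := by rw [hq.apply_zero hT, hq'.apply_zero hT]
  have hcont : ∀ {q}, IsChargeSolution s σ β T ψ₀ q → Continuous fun t =>
      nonlin σ β (extend hT q t) - nonlin σ β (q 0) := fun h =>
    ((continuous_nonlin hσ).comp (continuous_extend hT h.continuousOn)).sub continuous_const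
  have hz : ∀ q : ℝ → ℂ, ∀ t ≤ 0, nonlin σ β (extend hT q t) - nonlin σ β (q 0) = 0 :=
    fun q t ht => by rw [extend_of_le hT q ht, sub_self]
  -- Subtracting the two shifted equations cancels the free evolution and the initial-charge term;
  -- the difference satisfies a homogeneous Volterra inequality.
  have key := eq_zero_of_le_lintegral_weakSing_of_bounded hα (K := ‖kernelConst s‖ * L)
    (C := ENNReal.ofReal (B + B')) (e := fun t => ‖extend hT q t - extend hT q' t‖ₑ) (a := 0)
    (b := T) ENNReal.ofReal_ne_top (fun t _ => ?_) (fun t ht => ?_) (fun t ht => ?_)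
  · intro t ht
    have h := key t ht.2
    rw [enorm_eq_zero, sub_eq_zero, extend_of_mem hT q ht, extend_of_mem hT q' ht] at h
    exact h
  · rw [← ofReal_norm]
    exact ENNReal.ofReal_le_ofReal ((norm_sub_le _ _).trans (add_le_add (hB t) (hB' t)))
  · simp [extend_of_le hT _ ht.le, h0]
  · rcases le_total t 0 with ht0 | ht0
    · simp [extend_of_le hT _ ht0, h0]
    · have e : extend hT q t - extend hT q' t = -(Complex.I * kernelConst s) *
          ∫ τ, (nonlin σ β (extend hT q (t - τ)) - nonlin σ β (extend hT q' (t - τ)))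
            ∂(weakSing (1 / (2 * s))) := by
        have h1 := integral_sub
          (integrable_weakSing_comp_sub hα (hcont hq) (hz q) t)
          (integrable_weakSing_comp_sub hα (hcont hq') (hz q') t)
        have h2 : ∀ τ, nonlin σ β (extend hT q (t - τ)) - nonlin σ β (extend hT q' (t - τ)) =
            (nonlin σ β (extend hT q (t - τ)) - nonlin σ β (q 0)) -
            (nonlin σ β (extend hT q' (t - τ)) - nonlin σ β (q' 0)) := fun τ => by rw [h0]; ring
        simp_rw [h2]
        rw [h1, hq.extend_eq hs hσ hT ⟨ht0, ht⟩, hq'.extend_eq hs hσ hT ⟨ht0, ht⟩, h0]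
        ring
      rw [e, enorm_mul, enorm_neg, enorm_mul, ENNReal.ofReal_mul (norm_nonneg _), ofReal_norm,
        mul_assoc, mul_assoc]
      have hI : ‖Complex.I‖ₑ = 1 := by rw [← ofReal_norm]; simp
      rw [hI, one_mul]
      gcongr
      refine (enorm_integral_le_lintegral_enorm _).trans ?_
      rw [← lintegral_const_mul' _ _ ENNReal.ofReal_ne_top]
      refine lintegral_mono fun τ => ?_
      rw [← hPeq _ ((hB _).trans (le_max_left _ _)), ← hPeq _ ((hB' _).trans (le_max_right _ _)),
        ← ofReal_norm, ← ofReal_norm, ← ENNReal.ofReal_mul (by positivity)]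
      exact ENNReal.ofReal_le_ofReal (hP.norm_sub_le _ _)

/-- The nonlinear charge is the integral of an `L²` function. -/
lemma IsChargeSolution.exists_density {s σ β T : ℝ} (hs : 1 / 2 < s) (hσ : 0 < σ) (hT : 0 ≤ T)
    {ψ₀ : L2} (hψ : ψ₀ ∈ domain s σ β) {q : ℝ → ℂ} (hq : IsChargeSolution s σ β T ψ₀ q) :
    ∃ n : ℝ → ℂ, MemLp n 2 volume ∧ (∀ τ, τ ∉ Set.Ioc 0 T → n τ = 0) ∧
      ∀ t ∈ Set.Icc 0 T, nonlin σ β (q t) = nonlin σ β (q 0) + ∫ τ in (0 : ℝ)..t, n τ := by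
  have hα := one_div_two_mul_lt_one hs
  obtain ⟨B, hB⟩ := exists_bound_extend hT hq.continuousOn
  obtain ⟨P, L, hP, hPeq⟩ := exists_lipschitz_nonlin (β := β) hσ B
  have hF := formInt_of_mem_domain hs hψ
  have hv : value (propagator s 0 ψ₀) 0 = value ψ₀ 0 := by rw [propagator_zero]
  have hgr := graph_of_mem_domain hs hψ
  -- The compatibility that membership in the domain provides: the charge term in the graph of the
  -- datum is the nonlinearity at `q 0`, so the singular start-up term of the charge equation is
  -- cancelled exactly by that of the free evolution.
  rw [← hv, ← hq.apply_zero hT] at hgr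
  obtain ⟨g, hg2, hg0, hg⟩ := exists_free_density hs hgr T
  have hgi := integrable_of_memLp_of_support hg2 hg0
  obtain ⟨g', hg'm, hgg'⟩ : ∃ g' : ℝ → ℂ, StronglyMeasurable g' ∧ g =ᵐ[volume] g' := hg2.1
  set Q := extend hT q with hQ
  have hQc : Continuous Q := continuous_extend hT hq.continuousOn
  set u : ℝ → ℂ := fun t => nonlin σ β (Q t) - nonlin σ β (q 0) with hu
  have huc : Continuous u := ((continuous_nonlin hσ).comp hQc).sub continuous_const
  have hu0 : ∀ t ≤ 0, u t = 0 := fun t ht => by simp [hu, hQ, extend_of_le hT q ht]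
  -- Initial value plus primitive minus convolution, valid on all of `(-∞, T]`. In this form
  -- increments of `Q` involve only increments of the two parts.
  have hQeq : ∀ t ≤ T, Q t = q 0 + (∫ τ in (0 : ℝ)..t, g τ) -
      Complex.I * kernelConst s * ∫ τ, u (t - τ) ∂(weakSing (1 / (2 * s))) := by
    intro t ht
    rcases le_total 0 t with h | h
    · rw [hQ, hq.extend_eq hs hσ hT ⟨h, ht⟩, ← hg t ⟨h, ht⟩, value_propagator hs hF,
        hq.apply_zero hT, hv, value_of_mem_domain hs hψ]
      simp only [hu]
      rw [hq.apply_zero hT, hv, value_of_mem_domain hs hψ]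
      ring
    · have h1 : ∫ τ in (0 : ℝ)..t, g τ = 0 := by
        rw [intervalIntegral.integral_of_ge h]
        have : ∫ τ in Set.Ioc t 0, g τ = ∫ τ in Set.Ioc t 0, (0 : ℂ) :=
          setIntegral_congr_fun measurableSet_Ioc fun τ hτ => hg0 τ fun h' => by
            linarith [h'.1, hτ.2]
        rw [this]
        simp
      have h2 : ∫ τ, u (t - τ) ∂(weakSing (1 / (2 * s))) = 0 := by
        rw [integral_eq_zero_of_ae]
        filter_upwards [ae_weakSing_pos (1 / (2 * s))] with τ hτ
        exact hu0 _ (by linarith)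
      rw [h1, h2, hQ, extend_of_le hT q h]
      ring
  set ge : ℝ → ℝ≥0∞ := (Set.Ioi 0).indicator fun t => ‖g' t‖ₑ with hge
  have hgem : Measurable ge := hg'm.measurable.enorm.indicator measurableSet_Ioi
  have hgeg : ∀ᵐ t : ℝ, ‖g t‖ₑ = ge t := by
    filter_upwards [hgg'] with t ht
    by_cases h : 0 < t
    · rw [hge, Set.indicator_of_mem (show t ∈ Set.Ioi 0 from h), ht]
    · rw [hge, Set.indicator_of_notMem (show t ∉ Set.Ioi 0 from h), hg0 t fun h' => h h'.1,
        enorm_zero]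
  have hge2 : ∫⁻ t, ge t ^ 2 ≠ ⊤ := by
    have h1 := lintegral_enorm_sq hg2
    rw [lintegral_congr_ae (g := fun t => ge t ^ 2) (hgeg.mono fun t ht => by simp only [ht])] at h1
    rw [h1]
    exact ENNReal.ofReal_ne_top
  obtain ⟨m, hm, hmeq, hm2⟩ := exists_majorant hα (‖kernelConst s‖ * L) T hgem hge2
    fun t ht => Set.indicator_of_notMem (by simpa using ht) _
  have hmaj := @enorm_sub_le_lintegral_majorant (1 / (2 * s)) hα (‖kernelConst s‖ * L) T B ge m Q
    hgem hm hmeq hB (fun t ht => by rw [hQ, extend_of_le hT q ht, extend_zero]) ?_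
  · refine exists_density_of_majorant (N := fun t => nonlin σ β (q t)) (m := fun t => L * m t) hT
      (hm.const_mul _) ?_ fun r t hr hrt ht => ?_
    · simp_rw [mul_pow]
      rw [lintegral_const_mul _ (hm.pow_const 2)]
      exact ENNReal.mul_ne_top (by simp) hm2
    · have h1 := hmaj hrt ht
      rw [lintegral_const_mul _ hm, ← extend_of_mem hT q ⟨hr, hrt.trans ht⟩,
        ← extend_of_mem hT q ⟨hr.trans hrt, ht⟩, ← hPeq _ (hB _), ← hPeq _ (hB _)]
      calc _ ≤ (L : ℝ≥0∞) * ‖Q t - Q r‖ₑ := by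
            have := hP.norm_sub_le (Q t) (Q r)
            rw [← ofReal_norm, ← ofReal_norm, ← ENNReal.ofReal_coe_nnreal,
              ← ENNReal.ofReal_mul (by positivity)]
            exact ENNReal.ofReal_le_ofReal this
        _ ≤ _ := by gcongr
  · intro h hh x hx
    have hi1 := integrable_weakSing_comp_sub hα huc hu0 (x + h)
    have hi2 := integrable_weakSing_comp_sub hα huc hu0 x
    have e : Q (x + h) - Q x = (∫ τ in x..(x + h), g τ) - Complex.I * kernelConst s *
        ∫ τ, (u (x + h - τ) - u (x - τ)) ∂(weakSing (1 / (2 * s))) := by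
      rw [integral_sub hi1 hi2, hQeq _ hx, hQeq x (by linarith),
        ← intervalIntegral.integral_interval_sub_left (hgi.intervalIntegrable (a := 0) (b := x + h))
          (hgi.intervalIntegrable (a := 0) (b := x))]
      ring
    rw [e]
    refine (enorm_sub_le).trans (add_le_add ?_ ?_)
    · rw [intervalIntegral.integral_of_le (by linarith)]
      refine (enorm_integral_le_lintegral_enorm _).trans (le_of_eq ?_)
      exact lintegral_congr_ae (ae_restrict_of_ae hgeg)
    · rw [enorm_mul, enorm_mul, ENNReal.ofReal_mul (norm_nonneg _), ofReal_norm, mul_assoc,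
        mul_assoc]
      have hI : ‖Complex.I‖ₑ = 1 := by rw [← ofReal_norm]; simp
      rw [hI, one_mul]
      gcongr
      refine (enorm_integral_le_lintegral_enorm _).trans ?_
      rw [← lintegral_const_mul' _ _ ENNReal.ofReal_ne_top]
      refine lintegral_mono fun τ => ?_
      have h1 : u (x + h - τ) - u (x - τ) = P (Q (x + h - τ)) - P (Q (x - τ)) := by
        simp only [hu]
        rw [hPeq _ (hB _), hPeq _ (hB _)]
        ring
      rw [h1, ← ofReal_norm, ← ofReal_norm, ← ENNReal.ofReal_mul (by positivity)]
      exact ENNReal.ofReal_le_ofReal (hP.norm_sub_le _ _)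

/-! ### Evolution on the Fourier side -/

/-- Integration by parts against the primitive of a merely integrable function, by Fubini on the
triangle `r ≤ τ`. -/
lemma integral_deriv_mul_integral {E E' n : ℝ → ℂ} (hE : ∀ τ, HasDerivAt E (E' τ) τ)
    (hE' : Continuous E') (hn : Integrable n) {t : ℝ} (ht : 0 ≤ t) :
    ∫ τ in (0 : ℝ)..t, E' τ * ∫ r in (0 : ℝ)..τ, n r =
      E t * (∫ r in (0 : ℝ)..t, n r) - ∫ r in (0 : ℝ)..t, E r * n r := by
  have hEc : Continuous E := continuous_iff_continuousAt.2 fun τ => (hE τ).continuousAt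
  set μ : Measure ℝ := volume.restrict (Set.Ioc 0 t) with hμ
  have hi : Integrable (fun p : ℝ × ℝ => E' p.1 * n p.2) (μ.prod μ) :=
    Integrable.mul_prod (f := E') (g := n)
      (hE'.integrableOn_Icc.mono_set Set.Ioc_subset_Icc_self) hn.restrict
  have hs : MeasurableSet {p : ℝ × ℝ | p.2 ≤ p.1} := measurableSet_le measurable_snd measurable_fst
  have hsw := integral_integral_swap (μ := μ) (ν := μ)
    (f := fun τ r => ({p : ℝ × ℝ | p.2 ≤ p.1}).indicator (fun p => E' p.1 * n p.2) (τ, r))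
    (hi.indicator hs)
  have e1 : ∀ τ ∈ Set.Ioc 0 t, ∫ r, ({p : ℝ × ℝ | p.2 ≤ p.1}).indicator
      (fun p => E' p.1 * n p.2) (τ, r) ∂μ = E' τ * ∫ r in (0 : ℝ)..τ, n r := by
    intro τ hτ
    have : ∀ r, ({p : ℝ × ℝ | p.2 ≤ p.1}).indicator (fun p => E' p.1 * n p.2) (τ, r) =
        (Set.Iic τ).indicator (fun r => E' τ * n r) r := fun r => by
      by_cases h : r ≤ τ <;> simp [Set.indicator, h]
    simp_rw [this]
    rw [integral_indicator measurableSet_Iic, hμ, Measure.restrict_restrict measurableSet_Iic,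
      integral_const_mul, intervalIntegral.integral_of_le hτ.1.le]
    congr 3
    ext r
    simp only [Set.mem_inter_iff, Set.mem_Iic, Set.mem_Ioc]
    exact ⟨fun h => ⟨h.2.1, h.1⟩, fun h => ⟨h.2, h.1, h.2.trans hτ.2⟩⟩
  have e2 : ∀ r ∈ Set.Ioc 0 t, ∫ τ, ({p : ℝ × ℝ | p.2 ≤ p.1}).indicator
      (fun p => E' p.1 * n p.2) (τ, r) ∂μ = (E t - E r) * n r := by
    intro r hr
    have : ∀ τ, ({p : ℝ × ℝ | p.2 ≤ p.1}).indicator (fun p => E' p.1 * n p.2) (τ, r) =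
        (Set.Ici r).indicator (fun τ => E' τ * n r) τ := fun τ => by
      by_cases h : r ≤ τ <;> simp [Set.indicator, h]
    simp_rw [this]
    rw [integral_indicator measurableSet_Ici, hμ, Measure.restrict_restrict measurableSet_Ici,
      integral_mul_const, ← intervalIntegral.integral_eq_sub_of_hasDerivAt
        (fun τ _ => hE τ) (hE'.intervalIntegrable r t), intervalIntegral.integral_of_le hr.2,
      ← integral_Icc_eq_integral_Ioc]
    congr 3
    ext τ
    simp only [Set.mem_inter_iff, Set.mem_Ici, Set.mem_Ioc, Set.mem_Icc]
    exact ⟨fun h => ⟨h.1, h.2.2⟩, fun h => ⟨h.1, hr.1.trans_le h.1, h.2⟩⟩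
  have h1 : ∫ τ in (0 : ℝ)..t, E' τ * ∫ r in (0 : ℝ)..τ, n r =
      ∫ r in (0 : ℝ)..t, (E t - E r) * n r := by
    rw [intervalIntegral.integral_of_le ht, intervalIntegral.integral_of_le ht,
      ← setIntegral_congr_fun measurableSet_Ioc e1, ← setIntegral_congr_fun measurableSet_Ioc e2]
    exact hsw
  have h2 : IntervalIntegrable (fun r => E r * n r) volume 0 t :=
    hn.intervalIntegrable.continuousOn_mul hEc.continuousOn
  simp_rw [h1, sub_mul]
  rw [intervalIntegral.integral_sub (hn.intervalIntegrable.const_mul _) h2,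
    intervalIntegral.integral_const_mul]

/-- The free evolution of `V` with the source `m` at the origin, switched on between the times `0`
and `t`. -/
def evol (s : ℝ) (V : L2) (m : ℝ → ℂ) (t ξ : ℝ) : ℂ :=
  phase s t ξ * (V ξ + phaseInt s ((Set.Ioc 0 t).indicator m) ξ)

section Evol

variable {s T : ℝ} {V : L2} {m : ℝ → ℂ}

lemma indicator_memLp (hm : MemLp m 2 volume) (hsupp : ∀ τ, τ ∉ Set.Ioc 0 T → m τ = 0) (A : Set ℝ)
    (hA : MeasurableSet A) : MemLp (A.indicator m) 2 volume ∧
      (∀ τ, τ ∉ Set.Ioc 0 T → A.indicator m τ = 0) :=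
  ⟨hm.indicator hA, fun τ hτ => by simp [Set.indicator, hsupp τ hτ]⟩

lemma memLp_evol (hs : 1 / 2 < s) (hm : MemLp m 2 volume)
    (hsupp : ∀ τ, τ ∉ Set.Ioc 0 T → m τ = 0) (t : ℝ) : MemLp (evol s V m t) 2 volume := by
  obtain ⟨C, hC, hB⟩ := exists_phaseInt_bound hs T
  obtain ⟨h1, h2⟩ := indicator_memLp hm hsupp (Set.Ioc 0 t) measurableSet_Ioc
  have h := (Lp.memLp V).add (hB _ h1 h2).1
  refine h.norm.mono' ((measurable_phase_right s t).aestronglyMeasurable.mul h.1)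
    (Eventually.of_forall fun ξ => ?_)
  rw [evol, norm_mul, norm_phase, one_mul]
  rfl

lemma phaseInt_sub {n n' : ℝ → ℂ} (hn : Integrable n) (hn' : Integrable n') (ξ : ℝ) :
    phaseInt s n ξ - phaseInt s n' ξ = phaseInt s (fun τ => n τ - n' τ) ξ := by
  simp only [phaseInt, mul_sub]
  rw [integral_sub (integrable_phase_mul hn ξ) (integrable_phase_mul hn' ξ)]

/-- Continuity of the evolution in `L²`. -/
lemma tendsto_integral_evol_sub (hs : 1 / 2 < s) (hm : MemLp m 2 volume)
    (hsupp : ∀ τ, τ ∉ Set.Ioc 0 T → m τ = 0) (t₀ : ℝ) :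
    Tendsto (fun t => ∫ ξ, ‖evol s V m t ξ - evol s V m t₀ ξ‖ ^ 2) (𝓝 t₀) (𝓝 0) := by
  obtain ⟨C, hC, hB⟩ := exists_phaseInt_bound hs T
  have hi : ∀ t, Integrable ((Set.Ioc 0 t).indicator m) := fun t =>
    (integrable_of_memLp_of_support hm hsupp).indicator measurableSet_Ioc
  have hI := fun t => indicator_memLp hm hsupp (Set.Ioc 0 t) measurableSet_Ioc
  set W : ℝ → ℂ := fun ξ => V ξ + phaseInt s ((Set.Ioc 0 t₀).indicator m) ξ with hW
  have hW2 : MemLp W 2 volume := (Lp.memLp V).add (hB _ (hI t₀).1 (hI t₀).2).1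
  set n : ℝ → ℝ → ℂ := fun t τ => (Set.Ioc 0 t).indicator m τ - (Set.Ioc 0 t₀).indicator m τ with hn
  have hn2 : ∀ t, MemLp (n t) 2 volume := fun t => (hI t).1.sub (hI t₀).1
  have hns : ∀ t τ, τ ∉ Set.Ioc 0 T → n t τ = 0 := fun t τ hτ => by
    simp [hn, (hI t).2 τ hτ, (hI t₀).2 τ hτ]
  have hsq : ∀ {f : ℝ → ℂ}, MemLp f 2 volume → Integrable fun ξ => ‖f ξ‖ ^ 2 := fun h =>
    (memLp_two_iff_integrable_sq_norm h.1).1 h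
  have hP : ∀ t, MemLp (fun ξ => (phase s t ξ - phase s t₀ ξ) * W ξ) 2 volume := fun t => by
    refine (hW2.norm.const_mul 2).mono' (((measurable_phase_right s t).sub
      (measurable_phase_right s t₀)).aestronglyMeasurable.mul hW2.1)
      (Eventually.of_forall fun ξ => ?_)
    rw [norm_mul]
    gcongr
    refine (norm_sub_le _ _).trans ?_
    rw [norm_phase, norm_phase]
    norm_num
  -- The increment is the change of phase on the fixed profile `W`, which tends to zero by dominated
  -- convergence, plus the source between the two times, which the smoothing estimate controls.
  have hle : ∀ t, ∫ ξ, ‖evol s V m t ξ - evol s V m t₀ ξ‖ ^ 2 ≤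
      2 * (∫ ξ, ‖(phase s t ξ - phase s t₀ ξ) * W ξ‖ ^ 2) + 2 * (C * ∫ τ, ‖n t τ‖ ^ 2) := by
    intro t
    calc _ ≤ ∫ ξ, (2 * ‖(phase s t ξ - phase s t₀ ξ) * W ξ‖ ^ 2 +
          2 * ‖phaseInt s (n t) ξ‖ ^ 2) := by
          refine integral_mono (hsq ((memLp_evol hs hm hsupp t).sub (memLp_evol hs hm hsupp t₀)))
            (((hsq (hP t)).const_mul 2).add ((hsq (hB _ (hn2 t) (hns t)).1).const_mul 2))
            fun ξ => ?_
          have e : evol s V m t ξ - evol s V m t₀ ξ = (phase s t ξ - phase s t₀ ξ) * W ξ +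
              phase s t ξ * phaseInt s (n t) ξ := by
            rw [hn, ← phaseInt_sub (hi t) (hi t₀), evol, evol, hW]
            ring
          simp only
          rw [e]
          have h1 := norm_add_le ((phase s t ξ - phase s t₀ ξ) * W ξ)
            (phase s t ξ * phaseInt s (n t) ξ)
          have h2 : ‖phase s t ξ * phaseInt s (n t) ξ‖ = ‖phaseInt s (n t) ξ‖ := by
            rw [norm_mul, norm_phase, one_mul]
          rw [h2] at h1
          nlinarith [sq_nonneg (‖(phase s t ξ - phase s t₀ ξ) * W ξ‖ - ‖phaseInt s (n t) ξ‖),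
            norm_nonneg ((phase s t ξ - phase s t₀ ξ) * W ξ + phase s t ξ * phaseInt s (n t) ξ)]
      _ = 2 * (∫ ξ, ‖(phase s t ξ - phase s t₀ ξ) * W ξ‖ ^ 2) +
          2 * ∫ ξ, ‖phaseInt s (n t) ξ‖ ^ 2 := by
          rw [integral_add ((hsq (hP t)).const_mul 2)
            ((hsq (hB _ (hn2 t) (hns t)).1).const_mul 2), integral_const_mul, integral_const_mul]
      _ ≤ _ := by
          have := (hB _ (hn2 t) (hns t)).2
          gcongr
  have l1 : Tendsto (fun t => ∫ ξ, ‖(phase s t ξ - phase s t₀ ξ) * W ξ‖ ^ 2) (𝓝 t₀) (𝓝 0) := by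
    have := tendsto_integral_filter_of_dominated_convergence (μ := volume) (l := 𝓝 t₀)
      (F := fun t ξ => ‖(phase s t ξ - phase s t₀ ξ) * W ξ‖ ^ 2) (f := fun _ => (0 : ℝ))
      (fun ξ => 4 * ‖W ξ‖ ^ 2) (Eventually.of_forall fun t => (hsq (hP t)).1)
      (Eventually.of_forall fun t => Eventually.of_forall fun ξ => ?_)
      ((hsq hW2).const_mul 4) (Eventually.of_forall fun ξ => ?_)
    · simpa using this
    · rw [Real.norm_of_nonneg (by positivity), norm_mul, mul_pow]
      gcongr
      have h1 := norm_sub_le (phase s t ξ) (phase s t₀ ξ)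
      rw [norm_phase, norm_phase] at h1
      nlinarith [norm_nonneg (phase s t ξ - phase s t₀ ξ)]
    · have hc : Continuous fun t => ‖(phase s t ξ - phase s t₀ ξ) * W ξ‖ ^ 2 := by
        have := continuous_phase_left (s := s) ξ
        fun_prop
      simpa using hc.tendsto t₀
  have l2 : Tendsto (fun t => ∫ τ, ‖n t τ‖ ^ 2) (𝓝 t₀) (𝓝 0) := by
    have hne : ∀ᵐ x : ℝ, x ≠ t₀ := by simp [ae_iff]
    have := tendsto_integral_filter_of_dominated_convergence (μ := volume) (l := 𝓝 t₀)
      (F := fun t τ => ‖n t τ‖ ^ 2) (f := fun _ => (0 : ℝ))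
      (fun τ => ‖m τ‖ ^ 2) (Eventually.of_forall fun t => (hsq (hn2 t)).1)
      (Eventually.of_forall fun t => Eventually.of_forall fun τ => ?_)
      (hsq hm) ?_
    · simpa using this
    · rw [Real.norm_of_nonneg (by positivity)]
      gcongr
      simp only [hn, Set.indicator]
      split_ifs <;> simp
    · filter_upwards [hne] with τ hτ
      refine tendsto_const_nhds.congr' ?_
      rcases lt_or_gt_of_ne hτ with h | h
      · filter_upwards [lt_mem_nhds h] with t ht
        simp [hn, Set.indicator, h.le, ht.le]
      · filter_upwards [gt_mem_nhds h] with t ht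
        simp [hn, Set.indicator, h.not_ge, ht.not_ge]
  refine squeeze_zero (fun t => integral_nonneg fun ξ => by positivity) hle ?_
  simpa using (l1.const_mul 2).add ((l2.const_mul C).const_mul 2)

end Evol

/-- A curve in `L²` that is pointwise the primitive of a continuous curve is differentiable. -/
lemma hasDerivWithinAt_of_pointwise {ψ h : ℝ → ℝ → ℂ} {Ψ H : ℝ → L2} {S : Set ℝ}
    (hS : S.OrdConnected)
    (hm : AEStronglyMeasurable (fun p : ℝ × ℝ => h p.1 p.2) (volume.prod volume))
    (hH : ∀ t ∈ S, H t =ᵐ[volume] h t) (hΨ : ∀ t ∈ S, Ψ t =ᵐ[volume] ψ t)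
    (hd : ∀ᵐ ξ, ∀ t ∈ S, ∀ r ∈ S, ψ t ξ - ψ r ξ = ∫ τ in r..t, h τ ξ)
    (hint : ∀ᵐ ξ, ∀ t ∈ S, ∀ r ∈ S, IntervalIntegrable (fun τ => h τ ξ) volume r t)
    {r : ℝ} (hr : r ∈ S) (hc : ContinuousWithinAt H S r) : HasDerivWithinAt Ψ (H r) S r := by
  rw [hasDerivWithinAt_iff_isLittleO, Asymptotics.isLittleO_iff]
  intro ε hε
  rw [Metric.continuousWithinAt_iff] at hc
  obtain ⟨δ, hδ, hc⟩ := hc ε hε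
  filter_upwards [self_mem_nhdsWithin, mem_nhdsWithin_of_mem_nhds (Metric.ball_mem_nhds r hδ)]
    with t ht hball
  have hsub : Set.uIoc r t ⊆ S := Set.uIoc_subset_uIcc.trans (hS.uIcc_subset hr ht)
  have hsq : ‖Ψ t - Ψ r - (t - r) • H r‖ₑ ^ 2 ≤ ENNReal.ofReal (ε * ‖t - r‖) ^ 2 := by
    have e1 : ∀ᵐ ξ, (Ψ t - Ψ r - (t - r) • H r : L2) ξ = ∫ τ in r..t, (h τ ξ - h r ξ) := by
      filter_upwards [Lp.coeFn_sub (Ψ t - Ψ r) ((t - r) • H r), Lp.coeFn_sub (Ψ t) (Ψ r),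
        Lp.coeFn_smul (t - r) (H r), hΨ t ht, hΨ r hr, hH r hr, hd, hint] with
        ξ h1 h2 h3 h4 h5 h6 h7 h8
      rw [h1, Pi.sub_apply, h2, Pi.sub_apply, h3, Pi.smul_apply, h4, h5, h6, h7 t ht r hr,
        intervalIntegral.integral_sub (h8 t ht r hr) intervalIntegrable_const,
        intervalIntegral.integral_const]
    have e0 : ∀ F : L2, ‖F‖ₑ ^ 2 = ∫⁻ ξ, ‖F ξ‖ₑ ^ 2 := fun F => by
      rw [lintegral_enorm_sq (Lp.memLp F), ← norm_sq_eq_integral, ENNReal.ofReal_pow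
        (norm_nonneg _), ofReal_norm]
    have hm2 : AEStronglyMeasurable (fun p : ℝ × ℝ => h p.1 p.2)
        ((volume.restrict (Set.uIoc r t)).prod volume) :=
      hm.mono_measure (by
        rw [← Measure.restrict_univ (μ := (volume : Measure ℝ)),
          Measure.restrict_univ (μ := (volume : Measure ℝ))]
        exact Measure.prod_mono Measure.restrict_le_self le_rfl)
    have hmr : AEStronglyMeasurable (h r) volume :=
      (Lp.aestronglyMeasurable (H r)).congr (hH r hr)
    rw [e0]
    -- Cauchy–Schwarz in time and Tonelli bound the squared remainder by `|t - r|²` times the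
    -- supremum of `‖H τ - H r‖²`, which continuity of `H` at `r` makes small.
    calc ∫⁻ ξ, ‖(Ψ t - Ψ r - (t - r) • H r : L2) ξ‖ₑ ^ 2
        ≤ ∫⁻ ξ, (ENNReal.ofReal |t - r|) * ∫⁻ τ in Set.uIoc r t, ‖h τ ξ - h r ξ‖ₑ ^ 2 := by
          refine lintegral_mono_ae ?_
          filter_upwards [e1, hint] with ξ h1 h2
          rw [h1]
          have h3 : ‖∫ τ in r..t, (h τ ξ - h r ξ)‖ₑ ≤
              ∫⁻ τ in Set.uIoc r t, ‖h τ ξ - h r ξ‖ₑ := by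
            rw [← ofReal_norm, intervalIntegral.norm_intervalIntegral_eq, ofReal_norm]
            exact enorm_integral_le_lintegral_enorm _
          refine (pow_le_pow_left₀ zero_le h3 2).trans ?_
          refine (lintegral_sq_le_of_measure ?_).trans ?_
          · exact (((h2 t ht r hr).def'.1.aemeasurable).sub_const _).enorm
          · rw [Measure.restrict_apply MeasurableSet.univ, Set.univ_inter, Set.uIoc,
              Real.volume_Ioc, max_sub_min_eq_abs]
      _ = ENNReal.ofReal |t - r| * ∫⁻ ξ, ∫⁻ τ in Set.uIoc r t, ‖h τ ξ - h r ξ‖ₑ ^ 2 :=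
          lintegral_const_mul' _ _ ENNReal.ofReal_ne_top
      _ = ENNReal.ofReal |t - r| * ∫⁻ τ in Set.uIoc r t, ∫⁻ ξ, ‖h τ ξ - h r ξ‖ₑ ^ 2 := by
          congr 1
          refine (lintegral_lintegral_swap ?_).symm
          exact ((hm2.sub (hmr.comp_snd)).enorm.pow_const 2)
      _ ≤ ENNReal.ofReal |t - r| * ∫⁻ τ in Set.uIoc r t, ENNReal.ofReal ε ^ 2 := by
          refine mul_le_mul_right ?_ _
          refine setLIntegral_mono' (show MeasurableSet (Set.uIoc r t) from measurableSet_uIoc) fun τ hτ => ?_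
          have h1 : ∫⁻ ξ, ‖h τ ξ - h r ξ‖ₑ ^ 2 = ‖H τ - H r‖ₑ ^ 2 := by
            rw [e0]
            refine lintegral_congr_ae ?_
            filter_upwards [Lp.coeFn_sub (H τ) (H r), hH τ (hsub hτ), hH r hr] with ξ h1 h2 h3
            rw [h1, Pi.sub_apply, h2, h3]
          rw [h1]
          gcongr
          rw [← ofReal_norm, ← dist_eq_norm]
          refine ENNReal.ofReal_le_ofReal (hc (hsub hτ) ?_).le
          have h2 := Set.abs_sub_left_of_mem_uIcc (Set.uIoc_subset_uIcc hτ)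
          rw [Real.dist_eq]
          rw [Metric.mem_ball, Real.dist_eq] at hball
          exact lt_of_le_of_lt h2 hball
      _ = _ := by
          rw [setLIntegral_const, Set.uIoc, Real.volume_Ioc, max_sub_min_eq_abs,
            ENNReal.ofReal_mul hε.le, Real.norm_eq_abs]
          ring
  have h3 := (ENNReal.pow_le_pow_left_iff two_ne_zero).1 hsq
  rwa [← ofReal_norm, ENNReal.ofReal_le_ofReal_iff (by positivity)] at h3

/-! ### From the charge to the wave function -/

lemma phaseInt_indicator_eq (s : ℝ) (m : ℝ → ℂ) {t : ℝ} (ht : 0 ≤ t) (ξ : ℝ) :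
    phaseInt s ((Set.Ioc 0 t).indicator m) ξ = ∫ τ in (0 : ℝ)..t, phase s (-τ) ξ * m τ := by
  rw [phaseInt, intervalIntegral.integral_of_le ht, ← integral_indicator measurableSet_Ioc]
  congr 1
  funext τ
  by_cases h : τ ∈ Set.Ioc 0 t <;> simp [h]

lemma hasDerivAt_phase_neg (s t ξ : ℝ) :
    HasDerivAt (fun t => phase s (-t) ξ) (Complex.I * (symb s ξ : ℂ) * phase s (-t) ξ) t := by
  have h := (hasDerivAt_phase s (-t) ξ).scomp t (hasDerivAt_neg t)
  refine h.congr_deriv ?_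
  rw [neg_smul, one_smul]
  ring

/-- The Fourier transform of the right hand side of the Duhamel formula. -/
def duhamelHat (s : ℝ) (U : ℝ → ℂ) (N : ℝ → ℂ) (t ξ : ℝ) : ℂ :=
  phase s t ξ * (U ξ - Complex.I * ∫ τ in (0 : ℝ)..t, phase s (-τ) ξ * N τ)

lemma duhamelHat_congr {s : ℝ} {U N N' : ℝ → ℂ} {t : ℝ} (ht : 0 ≤ t)
    (h : ∀ τ ∈ Set.Icc 0 t, N τ = N' τ) (ξ : ℝ) : duhamelHat s U N t ξ = duhamelHat s U N' t ξ := by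
  simp only [duhamelHat]
  congr 3
  refine intervalIntegral.integral_congr fun τ hτ => ?_
  rw [Set.uIcc_of_le ht] at hτ
  simp only [h τ hτ]

lemma hasDerivAt_duhamelHat {s : ℝ} {U N : ℝ → ℂ} (hN : Continuous N) (t ξ : ℝ) :
    HasDerivAt (fun t => duhamelHat s U N t ξ)
      (-Complex.I * ((symb s ξ : ℂ) * duhamelHat s U N t ξ + N t)) t := by
  have hc : Continuous fun τ => phase s (-τ) ξ * N τ :=
    ((continuous_phase_left (s := s) ξ).comp continuous_neg).mul hN
  have h := (hasDerivAt_phase s t ξ).mul (((intervalIntegral.integral_hasDerivAt_right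
    (hc.intervalIntegrable 0 t) (hc.stronglyMeasurableAtFilter _ _)
    hc.continuousAt).const_mul Complex.I).const_sub (U ξ))
  have h1 : phase s t ξ * phase s (-t) ξ = 1 := by
    rw [← phase_add, add_neg_cancel, phase_zero]
  refine h.congr_deriv ?_
  simp only [duhamelHat]
  linear_combination (-Complex.I * N t) * h1

/-- Integration by parts in the Duhamel formula. -/
lemma symb_mul_duhamelHat_add {s : ℝ} {U n : ℝ → ℂ} {z : ℂ} (hn : Integrable n) {t : ℝ}
    (ht : 0 ≤ t) (ξ : ℝ) :
    (symb s ξ : ℂ) * duhamelHat s U (fun τ => z + ∫ r in (0 : ℝ)..τ, n r) t ξ +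
        (z + ∫ r in (0 : ℝ)..t, n r) =
      phase s t ξ * (((symb s ξ : ℂ) * U ξ + z) + ∫ τ in (0 : ℝ)..t, phase s (-τ) ξ * n τ) := by
  have hc : Continuous fun τ => phase s (-τ) ξ := (continuous_phase_left (s := s) ξ).comp
    continuous_neg
  have hcp := intervalIntegral.continuous_primitive (fun a b => hn.intervalIntegrable) 0
  have h1 := integral_deriv_mul_integral (hasDerivAt_phase_neg s · ξ) (by fun_prop) hn ht
  have h2 := intervalIntegral.integral_eq_sub_of_hasDerivAt (a := 0) (b := t)
    (fun τ _ => hasDerivAt_phase_neg s τ ξ) ((hc.const_mul _).intervalIntegrable 0 t)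
  have h3 : phase s t ξ * phase s (-t) ξ = 1 := by
    rw [← phase_add, add_neg_cancel, phase_zero]
  -- The factor `i · symb · phase(-τ)` is the time derivative of `phase(-τ)`: the constant `z`
  -- integrates directly, and the primitive of `n` by parts.
  have h4 : (Complex.I * (symb s ξ : ℂ)) * ∫ τ in (0 : ℝ)..t, phase s (-τ) ξ *
      (z + ∫ r in (0 : ℝ)..τ, n r) =
      (∫ τ in (0 : ℝ)..t, Complex.I * (symb s ξ : ℂ) * phase s (-τ) ξ) * z +
      ∫ τ in (0 : ℝ)..t, Complex.I * (symb s ξ : ℂ) * phase s (-τ) ξ * ∫ r in (0 : ℝ)..τ, n r := by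
    rw [← intervalIntegral.integral_mul_const, ← intervalIntegral.integral_const_mul,
      ← intervalIntegral.integral_add (Continuous.intervalIntegrable (by fun_prop) _ _)
        (Continuous.intervalIntegrable (by fun_prop) _ _)]
    congr 1
    funext τ
    ring
  rw [h1, h2, neg_zero, phase_zero] at h4
  simp only [duhamelHat]
  linear_combination (-phase s t ξ) * h4 - (z + ∫ r in (0 : ℝ)..t, n r) * h3

/-- The value at the origin in the Duhamel formula. -/
lemma integral_duhamelHat {s : ℝ} (hs : 1 / 2 < s) {U N : ℝ → ℂ} (hU : Integrable U)
    (hN : Continuous N) {t : ℝ} (ht : 0 ≤ t) (hi : Integrable (duhamelHat s U N t)) :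
    ∫ ξ, duhamelHat s U N t ξ = (∫ ξ, phase s t ξ * U ξ) - Complex.I * kernelConst s *
      ∫ τ in (0 : ℝ)..t, N τ / (((t - τ) ^ (1 / (2 * s)) : ℝ) : ℂ) := by
  have hs0 : 0 ≤ s := by linarith
  have h1 := intervalIntegral_tendsto_integral hi tendsto_neg_atTop_atBot tendsto_id (l := atTop)
  have h2 := intervalIntegral_tendsto_integral (integrable_phase_mul_of_integrable (s := s) hU t)
    tendsto_neg_atTop_atBot tendsto_id (l := atTop)
  have h3 := tendsto_integral_kernelCut hs ht hN.continuousOn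
  have hp := continuous_phase hs0
  have hF : Continuous (Function.uncurry fun ξ τ => phase s (t - τ) ξ * N τ) :=
    (hp.comp (f := fun p : ℝ × ℝ => (t - p.2, p.1)) (by fun_prop)).mul (by fun_prop)
  have hFc : Continuous fun ξ => ∫ τ in (0 : ℝ)..t, phase s (t - τ) ξ * N τ :=
    intervalIntegral.continuous_parametric_intervalIntegral_of_continuous' hF _ _
  have h4 : ∀ R : ℝ, ∫ ξ in (-R)..R, duhamelHat s U N t ξ =
      (∫ ξ in (-R)..R, phase s t ξ * U ξ) -
        Complex.I * ∫ τ in (0 : ℝ)..t, N τ * kernelCut s R (t - τ) := by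
    intro R
    have e1 : ∀ ξ, duhamelHat s U N t ξ = phase s t ξ * U ξ -
        Complex.I * ∫ τ in (0 : ℝ)..t, phase s (t - τ) ξ * N τ := by
      intro ξ
      simp_rw [phase_sub s t, mul_assoc]
      rw [intervalIntegral.integral_const_mul, duhamelHat]
      ring
    have e2 : ∫ τ in (0 : ℝ)..t, N τ * kernelCut s R (t - τ) =
        ∫ ξ in (-R)..R, ∫ τ in (0 : ℝ)..t, phase s (t - τ) ξ * N τ := by
      rw [intervalIntegral_swap_of_continuous hF]
      congr 1
      funext τ
      rw [intervalIntegral.integral_mul_const, mul_comm]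
      rfl
    rw [e2, ← intervalIntegral.integral_const_mul, ← intervalIntegral.integral_sub]
    · simp_rw [e1]
    · exact (integrable_phase_mul_of_integrable hU t).intervalIntegrable
    · exact (hFc.intervalIntegrable _ _).const_mul _
  have h5 := tendsto_nhds_unique (h1.congr h4) (h2.sub (h3.const_mul Complex.I))
  rw [h5]
  ring

/-- The wave function with charge `q`. -/
def duhamelState (s σ β : ℝ) (ψ₀ : L2) (q : ℝ → ℂ) (t : ℝ) : L2 :=
  open Classical in
  if h : MemLp (duhamelHat s (𝓕 ψ₀ : L2) (fun τ => nonlin σ β (q τ)) t) 2 (volume : Measure ℝ) then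
    𝓕⁻ (h.toLp _ : L2)
  else 0

lemma fourier_duhamelState {s σ β : ℝ} {ψ₀ : L2} {q : ℝ → ℂ} {t : ℝ}
    (h : MemLp (duhamelHat s (𝓕 ψ₀ : L2) (fun τ => nonlin σ β (q τ)) t) 2 (volume : Measure ℝ)) :
    (𝓕 (duhamelState s σ β ψ₀ q t) : L2) =ᵐ[volume]
      duhamelHat s (𝓕 ψ₀ : L2) (fun τ => nonlin σ β (q τ)) t := by
  unfold duhamelState
  rw [dif_pos h, fourier_fourierInv_eq]
  exact h.coeFn_toLp

/-- The wave function of a charge, together with the image under the operator, on the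
Fourier side. -/
structure IsDuhamelPair (s σ β T : ℝ) (ψ₀ : L2) (q : ℝ → ℂ) (N : ℝ → ℂ) (H : ℝ → L2) : Prop where
  continuous_charge : Continuous N
  charge_eq : ∀ t ∈ Set.Icc 0 T, N t = nonlin σ β (q t)
  continuous_image : Continuous H
  fourier_state : ∀ t ∈ Set.Icc 0 T,
    (𝓕 (duhamelState s σ β ψ₀ q t) : L2) =ᵐ[volume] duhamelHat s (𝓕 ψ₀ : L2) N t
  graph : ∀ t ∈ Set.Icc 0 T, Graph s (𝓕 (duhamelState s σ β ψ₀ q t) : L2) (H t) (N t)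
  integral_eq : ∀ t ∈ Set.Icc 0 T, ∫ ξ, (𝓕 (duhamelState s σ β ψ₀ q t) : L2) ξ = q t

/-- The image is built before it is known to be one: `H` is the evolution of the image of the datum
with source `N'`, continuous in `L²` by the smoothing estimate. The integrated-by-parts Duhamel
formula then places the state and `H` on the graph. -/
lemma IsChargeSolution.exists_pair {s σ β T : ℝ} (hs : 1 / 2 < s) (hσ : 0 < σ) (hT : 0 ≤ T)
    {ψ₀ : L2} (hψ : ψ₀ ∈ domain s σ β) {q : ℝ → ℂ} (hq : IsChargeSolution s σ β T ψ₀ q) :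
    ∃ N H, IsDuhamelPair s σ β T ψ₀ q N H := by
  obtain ⟨n, hn2, hns, hnq⟩ := hq.exists_density hs hσ hT hψ
  have hni := integrable_of_memLp_of_support hn2 hns
  have hF := formInt_of_mem_domain hs hψ
  have hv : value (propagator s 0 ψ₀) 0 = value ψ₀ 0 := by rw [propagator_zero]
  have hgr := graph_of_mem_domain hs hψ
  rw [← hv, ← hq.apply_zero hT] at hgr
  set U := (𝓕 ψ₀ : L2) with hU
  set V := (𝓕 (opH s σ β ψ₀) : L2) with hV
  set z := nonlin σ β (q 0) with hz
  set N : ℝ → ℂ := fun t => z + ∫ r in (0 : ℝ)..t, n r with hN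
  have hNc : Continuous N := continuous_const.add
    (intervalIntegral.continuous_primitive (fun a b => hni.intervalIntegrable) 0)
  have hNq : ∀ t ∈ Set.Icc 0 T, N t = nonlin σ β (q t) := fun t ht => (hnq t ht).symm
  -- The source of the state itself is `-iN`; it is bounded on a bounded interval, hence in `L²`.
  set m : ℝ → ℂ := (Set.Ioc 0 T).indicator fun τ => -Complex.I * N τ with hm
  have hms : ∀ τ, τ ∉ Set.Ioc 0 T → m τ = 0 := fun τ hτ => Set.indicator_of_notMem hτ _
  have hm2 : MemLp m 2 volume := by
    rw [hm, memLp_indicator_iff_restrict measurableSet_Ioc]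
    obtain ⟨B, hB⟩ := (isCompact_Icc (a := 0) (b := T)).exists_bound_of_continuousOn
      hNc.continuousOn
    refine MemLp.of_bound (by fun_prop) B ?_
    rw [ae_restrict_iff' measurableSet_Ioc]
    refine Eventually.of_forall fun τ hτ => ?_
    rw [norm_mul, norm_neg, Complex.norm_I, one_mul]
    exact hB τ (Set.Ioc_subset_Icc_self hτ)
  have e1 : ∀ t ∈ Set.Icc 0 T, duhamelHat s U N t = evol s U m t := by
    intro t ht
    funext ξ
    rw [duhamelHat, evol, phaseInt_indicator_eq s m ht.1, ← intervalIntegral.integral_const_mul,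
      sub_eq_add_neg, ← intervalIntegral.integral_neg]
    congr 2
    refine intervalIntegral.integral_congr_ae (Eventually.of_forall fun τ hτ => ?_)
    rw [Set.uIoc_of_le ht.1] at hτ
    rw [hm, Set.indicator_of_mem (show τ ∈ Set.Ioc 0 T from ⟨hτ.1, hτ.2.trans ht.2⟩)]
    ring
  have hmem : ∀ t ∈ Set.Icc 0 T, MemLp (duhamelHat s U N t) 2 volume := fun t ht => by
    rw [e1 t ht]
    exact memLp_evol hs hm2 hms t
  have e2 : ∀ t ∈ Set.Icc 0 T, (𝓕 (duhamelState s σ β ψ₀ q t) : L2) =ᵐ[volume]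
      duhamelHat s U N t := by
    intro t ht
    have e : duhamelHat s U N t = duhamelHat s U (fun τ => nonlin σ β (q τ)) t := by
      funext ξ
      exact duhamelHat_congr ht.1 (fun τ hτ => hNq τ ⟨hτ.1, hτ.2.trans ht.2⟩) ξ
    have h := hmem t ht
    rw [e] at h ⊢
    exact fourier_duhamelState h
  set H : ℝ → L2 := fun t => (memLp_evol (V := V) hs hn2 hns t).toLp _ with hH
  have hHt : ∀ t, H t =ᵐ[volume] evol s V n t := fun t => MemLp.coeFn_toLp _
  have hg : ∀ t ∈ Set.Icc 0 T, Graph s (𝓕 (duhamelState s σ β ψ₀ q t) : L2) (H t) (N t) := by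
    intro t ht
    filter_upwards [e2 t ht, hHt t, hgr] with ξ h1 h2 h3
    rw [h1, h2, symb_mul_duhamelHat_add hni ht.1, ← h3, evol, phaseInt_indicator_eq s n ht.1]
  refine ⟨N, H, hNc, hNq, ?_, e2, hg, fun t ht => ?_⟩
  · rw [continuous_iff_continuousAt]
    intro t₀
    rw [ContinuousAt, tendsto_iff_norm_sub_tendsto_zero]
    have h := (tendsto_integral_evol_sub (V := V) hs hn2 hns t₀).sqrt
    rw [Real.sqrt_zero] at h
    refine h.congr fun t => ?_
    rw [← Real.sqrt_sq (norm_nonneg (H t - H t₀)), norm_sq_eq_integral]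
    congr 1
    refine integral_congr_ae ?_
    filter_upwards [Lp.coeFn_sub (H t) (H t₀), hHt t, hHt t₀] with ξ h1 h2 h3
    rw [h1, Pi.sub_apply, h2, h3]
  -- The charge equation enters here: it says exactly that the frequency integral of the state is `q
  -- t`.
  · have hint : Integrable (duhamelHat s U N t) :=
      (((hg t ht).formInt hs).integrable hs).congr (e2 t ht)
    rw [integral_congr_ae (e2 t ht), integral_duhamelHat hs (hF.integrable hs) hNc ht.1 hint,
      ← value_propagator hs hF, ← hq.eqn t ht]
    have e3 : ∫ τ in (0 : ℝ)..t, N τ / (((t - τ) ^ (1 / (2 * s)) : ℝ) : ℂ) =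
        ∫ τ in (0 : ℝ)..t, nonlin σ β (q τ) / (((t - τ) ^ (1 / (2 * s)) : ℝ) : ℂ) := by
      refine intervalIntegral.integral_congr fun τ hτ => ?_
      rw [Set.uIcc_of_le ht.1] at hτ
      simp only [hNq τ ⟨hτ.1, hτ.2.trans ht.2⟩]
    rw [e3]
    ring

section Pair

variable {s σ β T : ℝ} {ψ₀ : L2} {q N : ℝ → ℂ} {H : ℝ → L2}

lemma IsDuhamelPair.mem_domain (h : IsDuhamelPair s σ β T ψ₀ q N H) (hs : 1 / 2 < s) {t : ℝ}
    (ht : t ∈ Set.Icc 0 T) : duhamelState s σ β ψ₀ q t ∈ domain s σ β ∧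
      (𝓕 (opH s σ β (duhamelState s σ β ψ₀ q t)) : L2) = H t := by
  refine mem_domain_of_graph hs ?_
  rw [h.integral_eq t ht, ← h.charge_eq t ht]
  exact h.graph t ht

lemma IsDuhamelPair.value_eq (h : IsDuhamelPair s σ β T ψ₀ q N H) (hs : 1 / 2 < s) {t : ℝ}
    (ht : t ∈ Set.Icc 0 T) : value (duhamelState s σ β ψ₀ q t) 0 = q t := by
  rw [value_of_mem_domain hs (h.mem_domain hs ht).1, h.integral_eq t ht]

lemma IsDuhamelPair.isDuhamel (h : IsDuhamelPair s σ β T ψ₀ q N H) :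
    IsDuhamel s σ β T ψ₀ q (duhamelState s σ β ψ₀ q) := by
  intro t ht
  filter_upwards [h.fourier_state t ht, fourier_propagator s t ψ₀] with ξ h1 h2
  rw [h1, h2, duhamelHat_congr ht.1
    (fun τ hτ => h.charge_eq τ ⟨hτ.1, hτ.2.trans ht.2⟩) ξ, duhamelHat]
  have e : ∫ τ in (0 : ℝ)..t, Complex.exp (-Complex.I * (symb s ξ : ℂ) * ((t - τ : ℝ) : ℂ)) *
      nonlin σ β (q τ) = phase s t ξ * ∫ τ in (0 : ℝ)..t, phase s (-τ) ξ * nonlin σ β (q τ) := by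
    rw [← intervalIntegral.integral_const_mul]
    congr 1
    funext τ
    rw [← mul_assoc, ← phase_sub, phase]
  rw [e, show Complex.exp (-Complex.I * (symb s ξ : ℂ) * (t : ℂ)) = phase s t ξ by rw [phase]]
  ring

/-- At each frequency the time derivative is `-i(symb · U + N)`, which the graph relation identifies
with `-iH`. The continuity of `H` in `L²` upgrades this to a derivative in `L²`. -/
lemma IsDuhamelPair.hasDerivWithinAt (h : IsDuhamelPair s σ β T ψ₀ q N H) (hs : 1 / 2 < s) {t : ℝ}
    (ht : t ∈ Set.Icc 0 T) : HasDerivWithinAt (duhamelState s σ β ψ₀ q)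
      (-Complex.I • opH s σ β (duhamelState s σ β ψ₀ q t)) (Set.Icc 0 T) t := by
  have hs0 : 0 ≤ s := by linarith
  set U := (𝓕 ψ₀ : L2) with hU
  have hd : ∀ t ξ, HasDerivAt (fun t => duhamelHat s U N t ξ)
      (-Complex.I * ((symb s ξ : ℂ) * duhamelHat s U N t ξ + N t)) t :=
    fun t ξ => hasDerivAt_duhamelHat h.continuous_charge t ξ
  have hdc : ∀ ξ, Continuous fun t =>
      -Complex.I * ((symb s ξ : ℂ) * duhamelHat s U N t ξ + N t) := fun ξ => by
    have h1 : Continuous fun t => duhamelHat s U N t ξ :=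
      continuous_iff_continuousAt.2 fun t => (hd t ξ).continuousAt
    have h2 := h.continuous_charge
    fun_prop
  have hJ : Continuous fun p : ℝ × ℝ => ∫ τ in (0 : ℝ)..p.2, phase s (-τ) p.1 * N τ := by
    refine intervalIntegral.continuous_parametric_primitive_of_continuous (μ := volume)
      (f := fun ξ τ => phase s (-τ) ξ * N τ) ?_
    have h1 := h.continuous_charge
    exact ((continuous_phase hs0).comp (f := fun p : ℝ × ℝ => (-p.2, p.1)) (by fun_prop)).mul
      (by fun_prop)
  have key : HasDerivWithinAt (fun t => (𝓕 (duhamelState s σ β ψ₀ q t) : L2))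
      ((-Complex.I) • H t) (Set.Icc 0 T) t := by
    refine hasDerivWithinAt_of_pointwise (ψ := duhamelHat s U N) (H := fun t => (-Complex.I) • H t)
      (h := fun t ξ => -Complex.I * ((symb s ξ : ℂ) * duhamelHat s U N t ξ + N t))
      Set.ordConnected_Icc ?_ ?_ h.fourier_state ?_ ?_ ht
      (Continuous.continuousWithinAt (by have := h.continuous_image; fun_prop))
    · have m1 : Measurable U := (Lp.stronglyMeasurable U).measurable
      have m2 := measurable_phase s
      have m3 : Measurable fun p : ℝ × ℝ => ∫ τ in (0 : ℝ)..p.1, phase s (-τ) p.2 * N τ :=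
        (hJ.comp continuous_swap).measurable
      have m4 := h.continuous_charge.measurable
      have m5 := measurable_symb s
      refine Measurable.aestronglyMeasurable ?_
      simp only [duhamelHat]
      fun_prop
    · intro t ht
      filter_upwards [Lp.coeFn_smul (-Complex.I) (H t), h.graph t ht, h.fourier_state t ht] with
        ξ h1 h2 h3
      rw [h1, Pi.smul_apply, h2, h3, smul_eq_mul]
    · refine Eventually.of_forall fun ξ t _ r _ => ?_
      rw [intervalIntegral.integral_eq_sub_of_hasDerivAt (fun τ _ => hd τ ξ)
        ((hdc ξ).intervalIntegrable _ _)]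
    · exact Eventually.of_forall fun ξ t _ r _ => (hdc ξ).intervalIntegrable _ _
  set L : L2 →L[ℝ] L2 := ((Lp.fourierTransformₗᵢ ℝ ℂ).symm.toContinuousLinearEquiv :
    L2 →L[ℂ] L2).restrictScalars ℝ with hL
  have hLF : ∀ u : L2, L (𝓕 u) = u := fun u => (Lp.fourierTransformₗᵢ ℝ ℂ).symm_apply_apply u
  have h1 := L.hasFDerivAt.comp_hasDerivWithinAt t key
  have e1 : (L ∘ fun t => (𝓕 (duhamelState s σ β ψ₀ q t) : L2)) = duhamelState s σ β ψ₀ q := by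
    funext t
    exact hLF _
  have e2 : L ((-Complex.I) • H t) = -Complex.I • opH s σ β (duhamelState s σ β ψ₀ q t) := by
    rw [← (h.mem_domain hs ht).2, ← FourierTransform.fourier_smul, hLF]
  rwa [e1, e2] at h1

lemma IsDuhamelPair.isStrongSolution (h : IsDuhamelPair s σ β T ψ₀ q N H) (hs : 1 / 2 < s)
    (hT : 0 < T) : IsStrongSolution s σ β T ψ₀ (duhamelState s σ β ψ₀ q) := by
  have hd := fun t (ht : t ∈ Set.Icc 0 T) => h.hasDerivWithinAt hs ht
  have hu := uniqueDiffOn_Icc hT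
  have hc : ContinuousOn (fun t => opH s σ β (duhamelState s σ β ψ₀ q t)) (Set.Icc 0 T) := by
    set L := (Lp.fourierTransformₗᵢ ℝ ℂ).symm
    refine ((L.continuous.comp h.continuous_image).continuousOn).congr fun t ht => ?_
    rw [Function.comp, ← (h.mem_domain hs ht).2]
    exact ((Lp.fourierTransformₗᵢ ℝ ℂ).symm_apply_apply _).symm
  refine ⟨?_, fun t ht => (h.mem_domain hs ht).1, fun t ht => (hd t ht).continuousWithinAt, hc,
    ?_, fun t ht => ?_⟩
  · apply (Lp.fourierTransformₗᵢ ℝ ℂ).injective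
    refine Lp.ext ?_
    filter_upwards [h.fourier_state 0 ⟨le_rfl, hT.le⟩] with ξ hξ
    refine hξ.trans ?_
    simp [duhamelHat]
    rfl
  · rw [contDiffOn_one_iff_derivWithin hu]
    refine ⟨fun t ht => (hd t ht).differentiableWithinAt, ?_⟩
    exact (hc.const_smul (-Complex.I)).congr fun t ht => (hd t ht).derivWithin (hu t ht)
  · rw [(hd t ht).derivWithin (hu t ht), smul_smul]
    simp

end Pair

/-! ### Strong solutions on the Fourier side -/

/-- A curve `U` with image `H` and charge `q` solves the evolution equation on the
Fourier side. -/
structure IsFlow (s σ β T : ℝ) (U H : ℝ → L2) (q : ℝ → ℂ) : Prop where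
  deriv : ∀ t ∈ Set.Icc 0 T, HasDerivWithinAt U (-Complex.I • H t) (Set.Icc 0 T) t
  continuousOn_image : ContinuousOn H (Set.Icc 0 T)
  graph : ∀ t ∈ Set.Icc 0 T, Graph s (U t) (H t) (nonlin σ β (q t))
  integral_eq : ∀ t ∈ Set.Icc 0 T, ∫ ξ, U t ξ = q t

lemma IsStrongSolution.isFlow {s σ β T : ℝ} (hs : 1 / 2 < s) {ψ₀ : L2} {ψ : ℝ → L2}
    (h : IsStrongSolution s σ β T ψ₀ ψ) :
    IsFlow s σ β T (fun t => (𝓕 (ψ t) : L2)) (fun t => (𝓕 (opH s σ β (ψ t)) : L2))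
      (fun t => value (ψ t) 0) := by
  set L : L2 →L[ℝ] L2 := ((Lp.fourierTransformₗᵢ ℝ ℂ).toContinuousLinearEquiv :
    L2 →L[ℂ] L2).restrictScalars ℝ with hL
  have hLF : ∀ u : L2, L u = 𝓕 u := fun u => rfl
  refine ⟨fun t ht => ?_, L.continuous.comp_continuousOn h.continuousOn_opH,
    fun t ht => graph_of_mem_domain hs (h.mem_domain t ht),
    fun t ht => (value_of_mem_domain hs (h.mem_domain t ht)).symm⟩
  have h1 := ((h.contDiffOn.differentiableOn one_ne_zero) t ht).hasDerivWithinAt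
  have h2 : derivWithin ψ (Set.Icc 0 T) t = -Complex.I • opH s σ β (ψ t) := by
    rw [← h.eqn t ht, smul_smul]
    simp
  rw [h2] at h1
  have h3 := L.hasFDerivAt.comp_hasDerivWithinAt t h1
  rwa [hLF, FourierTransform.fourier_smul] at h3

lemma exists_pairing {g : ℝ → ℂ} (hg : MemLp g 2 volume) :
    ∃ ℓ : L2 →L[ℂ] ℂ, ∀ u, ℓ u = ∫ ξ, g ξ * u ξ := by
  have hg' : MemLp (fun ξ => (starRingEnd ℂ) (g ξ)) 2 volume :=
    hg.norm.mono' (Complex.continuous_conj.comp_aestronglyMeasurable hg.1)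
      (Eventually.of_forall fun ξ => by simp)
  refine ⟨innerSL ℂ (hg'.toLp _), fun u => ?_⟩
  rw [innerSL_apply_apply, L2.inner_def]
  refine integral_congr_ae ?_
  filter_upwards [hg'.coeFn_toLp] with ξ hξ
  rw [RCLike.inner_apply, hξ, Complex.conj_conj, mul_comm]

lemma memLp_inv_symb_add {s : ℝ} (hs : 1 / 2 < s) :
    MemLp (fun ξ => (((symb s ξ + 1)⁻¹ : ℝ) : ℂ)) 2 volume :=
  memLp_greenHat hs one_pos

/-- Since `U = (H + U)/(symb + 1) - z/(symb + 1)` and `(symb + 1)⁻¹` lies in both `L²` and `L¹`, the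
value at the origin depends continuously on `U`, `H` and `z`, although `∫ U` is not an
`L²`-continuous functional. -/
lemma Graph.integral_eq {s : ℝ} (hs : 1 / 2 < s) {U H : L2} {z : ℂ} (h : Graph s U H z) :
    ∫ ξ, U ξ = (∫ ξ, (((symb s ξ + 1)⁻¹ : ℝ) : ℂ) * (H + U : L2) ξ) - z * greenInt s := by
  have h1 := integrable_mul_of_memLp (memLp_inv_symb_add hs) (Lp.memLp (H + U))
  have h2 : Integrable fun ξ => z * (((symb s ξ + 1)⁻¹ : ℝ) : ℂ) :=
    ((integrable_inv_symb_add hs one_pos).ofReal (𝕜 := ℂ)).const_mul z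
  rw [greenInt, ← integral_complex_ofReal, ← integral_const_mul, ← integral_sub h1 h2]
  refine integral_congr_ae ?_
  filter_upwards [h, Lp.coeFn_add H U] with ξ h3 h4
  have h0 := symb_nonneg s ξ
  have hq : ((symb s ξ : ℂ) + 1) ≠ 0 := by
    rw [← Complex.ofReal_one, ← Complex.ofReal_add]
    exact Complex.ofReal_ne_zero.2 (by linarith)
  rw [h4, Pi.add_apply, h3]
  push_cast
  field_simp
  ring

lemma memLp_indicator_one (a b : ℝ) :
    MemLp ((Set.Ioc a b).indicator fun _ : ℝ => (1 : ℂ)) 2 volume :=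
  memLp_indicator_const 2 measurableSet_Ioc 1 (Or.inr (by simp))

lemma memLp_indicator_symb {s : ℝ} (hs : 0 ≤ s) (a b : ℝ) :
    MemLp ((Set.Ioc a b).indicator fun ξ => (symb s ξ : ℂ)) 2 volume := by
  have hc := continuous_symb hs
  rw [memLp_indicator_iff_restrict measurableSet_Ioc]
  obtain ⟨B, hB⟩ := (isCompact_Icc (a := a) (b := b)).exists_bound_of_continuousOn
    (f := fun ξ => (symb s ξ : ℂ)) (by fun_prop)
  refine MemLp.of_bound (by fun_prop) B ?_
  rw [ae_restrict_iff' measurableSet_Ioc]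
  exact Eventually.of_forall fun τ hτ => hB τ (Set.Ioc_subset_Icc_self hτ)

/-- Averaging `z = H - symb · U` over the frequencies in `(0, 1]` exhibits `z` as a continuous
functional of `(U, H)` in `L²`. -/
lemma Graph.charge_eq {s : ℝ} (hs : 0 ≤ s) {U H : L2} {z : ℂ} (h : Graph s U H z) :
    z = (∫ ξ, (Set.Ioc 0 1).indicator (fun _ => (1 : ℂ)) ξ * H ξ) -
      ∫ ξ, (Set.Ioc 0 1).indicator (fun ξ => (symb s ξ : ℂ)) ξ * U ξ := by
  have hI := memLp_indicator_one 0 1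
  have hJ := memLp_indicator_symb hs 0 1
  rw [← integral_sub (integrable_mul_of_memLp hI (Lp.memLp H))
    (integrable_mul_of_memLp hJ (Lp.memLp U))]
  have e : ∫ ξ : ℝ, (Set.Ioc 0 1).indicator (fun _ => z) ξ = z := by
    rw [integral_indicator measurableSet_Ioc]
    simp
  rw [← e]
  refine integral_congr_ae ?_
  filter_upwards [h] with ξ h3
  by_cases hξ : ξ ∈ Set.Ioc (0 : ℝ) 1
  · simp only [Set.indicator_of_mem hξ, h3]
    ring
  · simp only [Set.indicator_of_notMem hξ]
    simp

section Flow

variable {s σ β T : ℝ} {U H : ℝ → L2} {q : ℝ → ℂ}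

lemma IsFlow.continuousOn (h : IsFlow s σ β T U H q) : ContinuousOn U (Set.Icc 0 T) :=
  fun t ht => (h.deriv t ht).continuousWithinAt

lemma IsFlow.continuousOn_nonlin (h : IsFlow s σ β T U H q) (hs : 0 ≤ s) :
    ContinuousOn (fun t => nonlin σ β (q t)) (Set.Icc 0 T) := by
  obtain ⟨ℓ₁, h1⟩ := exists_pairing (memLp_indicator_one 0 1)
  obtain ⟨ℓ₂, h2⟩ := exists_pairing (memLp_indicator_symb hs 0 1)
  have hU := h.continuousOn
  have hH := h.continuousOn_image
  have key : ContinuousOn (fun t => ℓ₁ (H t) - ℓ₂ (U t)) (Set.Icc 0 T) := by fun_prop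
  refine key.congr fun t ht => ?_
  simp only [h1, h2]
  exact (h.graph t ht).charge_eq hs

/-- The nonlinearity cannot be inverted when `β = 0`; instead its continuity is inserted into
`Graph.integral_eq`. -/
lemma IsFlow.continuousOn_charge (h : IsFlow s σ β T U H q) (hs : 1 / 2 < s) :
    ContinuousOn q (Set.Icc 0 T) := by
  obtain ⟨ℓ, h3⟩ := exists_pairing (memLp_inv_symb_add hs)
  have hU := h.continuousOn
  have hH := h.continuousOn_image
  have hN := h.continuousOn_nonlin (by linarith)
  have key : ContinuousOn (fun t => ℓ (H t + U t) - nonlin σ β (q t) * greenInt s)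
      (Set.Icc 0 T) := by fun_prop
  refine key.congr fun t ht => ?_
  simp only [h3]
  exact (h.integral_eq t ht).symm.trans ((h.graph t ht).integral_eq hs)

/-- The free evolution of a compactly supported datum is differentiable in `L²`. -/
lemma exists_free_curve (hs : 1 / 2 < s) {V V' : L2} (hV : ∀ᵐ ξ, V' ξ = (symb s ξ : ℂ) * V ξ) :
    ∃ G G' : ℝ → L2, (∀ t, G t =ᵐ[volume] fun ξ => phase s t ξ * V ξ) ∧
      (∀ t, G' t =ᵐ[volume] fun ξ => phase s t ξ * V' ξ) ∧
      ∀ t, HasDerivAt G (-Complex.I • G' t) t := by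
  have h0 : MemLp (fun _ : ℝ => (0 : ℂ)) 2 volume := MemLp.zero
  have hp : ∀ t, phaseInt s ((Set.Ioc 0 t).indicator fun _ => 0) = fun _ => 0 := fun t => by
    funext ξ
    simp [phaseInt]
  have hev : ∀ V t, evol s V (fun _ => 0) t = fun ξ => phase s t ξ * V ξ := fun V t => by
    funext ξ
    rw [evol, hp, add_zero]
  have hmem : ∀ (V : L2) t, MemLp (fun ξ => phase s t ξ * V ξ) 2 volume := fun V t => by
    rw [← hev]
    exact memLp_evol (T := 0) hs h0 (fun _ _ => rfl) t
  set G : L2 → ℝ → L2 := fun V t => (hmem V t).toLp _ with hG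
  have hGt : ∀ V t, G V t =ᵐ[volume] fun ξ => phase s t ξ * V ξ := fun V t => MemLp.coeFn_toLp _
  have hcont : ∀ V, Continuous (G V) := fun V => by
    rw [continuous_iff_continuousAt]
    intro t₀
    rw [ContinuousAt, tendsto_iff_norm_sub_tendsto_zero]
    have h := (tendsto_integral_evol_sub (V := V) (T := 0) hs h0 (fun _ _ => rfl) t₀).sqrt
    rw [Real.sqrt_zero] at h
    refine h.congr fun t => ?_
    rw [← Real.sqrt_sq (norm_nonneg (G V t - G V t₀)), norm_sq_eq_integral]
    congr 1
    refine integral_congr_ae ?_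
    filter_upwards [Lp.coeFn_sub (G V t) (G V t₀), hGt V t, hGt V t₀] with ξ h1 h2 h3
    rw [h1, Pi.sub_apply, h2, h3, hev, hev]
  refine ⟨G V, G V', hGt V, hGt V', fun t => ?_⟩
  rw [← hasDerivWithinAt_univ]
  have hd : ∀ᵐ ξ, ∀ t, HasDerivAt (fun t => phase s t ξ * V ξ)
      (-Complex.I * (phase s t ξ * V' ξ)) t := by
    filter_upwards [hV] with ξ hξ t
    refine ((hasDerivAt_phase s t ξ).mul_const (V ξ)).congr_deriv ?_
    rw [hξ]
    ring
  have hc : ∀ ξ, Continuous fun t => -Complex.I * (phase s t ξ * V' ξ) := fun ξ => by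
    have := continuous_phase_left (s := s) ξ
    fun_prop
  refine hasDerivWithinAt_of_pointwise (ψ := fun t ξ => phase s t ξ * V ξ)
    (H := fun t => -Complex.I • G V' t) (h := fun t ξ => -Complex.I * (phase s t ξ * V' ξ))
    Set.ordConnected_univ ?_ ?_ (fun t _ => hGt V t) ?_ ?_ (Set.mem_univ t)
    (Continuous.continuousWithinAt (by have := hcont V'; fun_prop))
  · have m1 : Measurable V' := (Lp.stronglyMeasurable V').measurable
    have m2 := measurable_phase s
    refine Measurable.aestronglyMeasurable ?_
    fun_prop
  · intro t _
    filter_upwards [Lp.coeFn_smul (-Complex.I) (G V' t), hGt V' t] with ξ h1 h2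
    rw [h1, Pi.smul_apply, h2, smul_eq_mul]
  · filter_upwards [hd] with ξ hξ t _ r _
    rw [intervalIntegral.integral_eq_sub_of_hasDerivAt (fun τ _ => hξ τ)
      ((hc ξ).intervalIntegrable _ _)]
  · exact Eventually.of_forall fun ξ t _ r _ => (hc ξ).intervalIntegrable _ _

lemma inner_eq_integral (u v : L2) :
    inner ℂ u v = ∫ ξ, (starRingEnd ℂ) (u ξ) * v ξ := by
  rw [L2.inner_def]
  simp only [RCLike.inner_apply, mul_comm]

lemma integrable_conj_mul (u v : L2) : Integrable fun ξ => (starRingEnd ℂ) (u ξ) * v ξ := by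
  have := L2.integrable_inner (𝕜 := ℂ) u v
  simpa only [RCLike.inner_apply, mul_comm] using this

/-- The truncated form of the charge equation. -/
lemma IsFlow.integral_kernelCut (h : IsFlow s σ β T U H q) (hs : 1 / 2 < s) {t : ℝ}
    (ht : t ∈ Set.Icc 0 T) {R : ℝ} (hR : 0 ≤ R) :
    (∫ ξ in (-R)..R, U t ξ) - (∫ ξ in (-R)..R, phase s t ξ * U 0 ξ) =
      -Complex.I * ∫ τ in (0 : ℝ)..t, nonlin σ β (q τ) * kernelCut s R (t - τ) := by
  have hs0 : 0 ≤ s := by linarith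
  have hRR : -R ≤ R := by linarith
  have hI := memLp_indicator_one (-R) R
  have hJ := memLp_indicator_symb hs0 (-R) R
  set V : L2 := hI.toLp _ with hV
  have hVt : V =ᵐ[volume] (Set.Ioc (-R) R).indicator fun _ : ℝ => (1 : ℂ) := hI.coeFn_toLp
  set V' : L2 := hJ.toLp _ with hV'
  have hVt' : V' =ᵐ[volume] (Set.Ioc (-R) R).indicator fun ξ => (symb s ξ : ℂ) := hJ.coeFn_toLp
  obtain ⟨G, G', hG, hG', hGd⟩ := exists_free_curve hs (V := V) (V' := V') (by
    filter_upwards [hVt, hVt'] with ξ h1 h2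
    rw [h1, h2]
    by_cases hξ : ξ ∈ Set.Ioc (-R) R <;> simp [hξ])
  have hval : ∀ τ (u : L2), inner ℂ (G (τ - t)) u = ∫ ξ in (-R)..R, phase s (t - τ) ξ * u ξ := by
    intro τ u
    rw [inner_eq_integral, intervalIntegral.integral_of_le hRR, ← integral_indicator measurableSet_Ioc]
    refine integral_congr_ae ?_
    filter_upwards [hG (τ - t), hVt] with ξ h1 h2
    rw [h1, h2, map_mul, conj_phase, neg_sub]
    by_cases hξ : ξ ∈ Set.Ioc (-R) R <;> simp [hξ]
  -- The flow is paired with the free evolution of a frequency cut-off. Both factors carry the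
  -- multiplier `symb`, so these terms cancel and only the source times the truncated kernel
  -- remains.
  have hd : ∀ τ ∈ Set.Icc 0 T, HasDerivWithinAt (fun τ => inner ℂ (G (τ - t)) (U τ))
      (-Complex.I * (nonlin σ β (q τ) * kernelCut s R (t - τ))) (Set.Icc 0 T) τ := by
    intro τ hτ
    have h1 : HasDerivAt (fun τ => G (τ - t)) (-Complex.I • G' (τ - t)) τ :=
      (hGd (τ - t)).comp_sub_const τ t
    have h2 := h1.hasDerivWithinAt.inner ℂ (h.deriv τ hτ)
    refine h2.congr_deriv ?_
    rw [inner_smul_left, inner_smul_right, inner_eq_integral, inner_eq_integral]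
    have e : (∫ ξ, (starRingEnd ℂ) (G (τ - t) ξ) * H τ ξ) -
        (∫ ξ, (starRingEnd ℂ) (G' (τ - t) ξ) * U τ ξ) = nonlin σ β (q τ) * kernelCut s R (t - τ) := by
      rw [← integral_sub (integrable_conj_mul _ _) (integrable_conj_mul _ _), kernelCut,
        intervalIntegral.integral_of_le hRR, ← integral_indicator measurableSet_Ioc,
        ← integral_const_mul]
      refine integral_congr_ae ?_
      filter_upwards [hG (τ - t), hG' (τ - t), hVt, hVt', h.graph τ hτ] with ξ h3 h4 h5 h6 h7
      rw [h3, h4, h5, h6, h7, map_mul, map_mul, conj_phase, neg_sub]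
      by_cases hξ : ξ ∈ Set.Ioc (-R) R
      · simp only [Set.indicator_of_mem hξ, map_one, Complex.conj_ofReal]
        ring
      · simp [Set.indicator_of_notMem hξ]
    rw [← e]
    simp only [map_neg, Complex.conj_I]
    ring
  have hcz : ContinuousOn (fun τ => -Complex.I * (nonlin σ β (q τ) * kernelCut s R (t - τ)))
      (Set.Icc 0 t) := by
    have h1 := h.continuousOn_nonlin hs0
    have h2 := continuous_kernelCut hs0 R
    have h3 := h1.mono (Set.Icc_subset_Icc_right ht.2)
    fun_prop
  have hftc := intervalIntegral.integral_eq_sub_of_hasDerivAt_of_le ht.1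
    (f := fun τ => inner ℂ (G (τ - t)) (U τ))
    (fun τ hτ => ((hd τ ⟨hτ.1, hτ.2.trans ht.2⟩).mono
      (Set.Icc_subset_Icc_right ht.2)).continuousWithinAt)
    (fun τ hτ => (hd τ ⟨hτ.1.le, hτ.2.le.trans ht.2⟩).hasDerivAt
      (Icc_mem_nhds hτ.1 (hτ.2.trans_le ht.2)))
    (hcz.intervalIntegrable_of_Icc ht.1)
  rw [← intervalIntegral.integral_const_mul, hftc, hval, hval]
  simp

/-- The limit `R → ∞` of the truncated identity. `U t` and the free evolution of `U 0` are
integrable over the frequencies because both times lie on the graph. -/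
lemma IsFlow.isChargeSolution {ψ₀ : L2} (h : IsFlow s σ β T U H q) (hs : 1 / 2 < s) (hσ : 0 < σ)
    (hT : 0 ≤ T) (h0 : U 0 = 𝓕 ψ₀) : IsChargeSolution s σ β T ψ₀ q := by
  refine ⟨h.continuousOn_charge hs, fun t ht => ?_⟩
  have h00 : (0 : ℝ) ∈ Set.Icc 0 T := ⟨le_rfl, hT⟩
  have hF0 : FormInt s (𝓕 ψ₀ : L2) := by
    rw [← h0]
    exact (h.graph 0 h00).formInt hs
  have hFt := ((h.graph t ht).formInt hs).integrable hs
  have l1 := intervalIntegral_tendsto_integral hFt tendsto_neg_atTop_atBot tendsto_id (l := atTop)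
  have l2 := intervalIntegral_tendsto_integral
    (integrable_phase_mul_of_integrable (s := s) (hF0.integrable hs) t)
    tendsto_neg_atTop_atBot tendsto_id (l := atTop)
  have hN : ContinuousOn (fun τ => nonlin σ β (q τ)) (Set.Icc 0 t) :=
    (continuous_nonlin hσ).comp_continuousOn
      ((h.continuousOn_charge hs).mono (Set.Icc_subset_Icc_right ht.2))
  have l3 := (tendsto_integral_kernelCut hs ht.1 hN).const_mul (-Complex.I)
  have key := tendsto_nhds_unique ((l1.sub l2).congr' (by
    filter_upwards [eventually_ge_atTop 0] with R hR
    rw [← h0]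
    exact h.integral_kernelCut hs ht hR)) l3
  rw [value_propagator hs hF0, ← h.integral_eq t ht]
  linear_combination key

end Flow

/-! ### Conservation laws and uniqueness -/

lemma integrable_symb_conj_mul {s : ℝ} {U V : L2} (hU : FormInt s U) (hV : FormInt s V) :
    Integrable fun ξ => (symb s ξ : ℂ) * ((starRingEnd ℂ) (V ξ) * U ξ) := by
  have hm : AEStronglyMeasurable (fun ξ => (symb s ξ : ℂ) * ((starRingEnd ℂ) (V ξ) * U ξ)) volume :=
    (measurable_symb s).complex_ofReal.aestronglyMeasurable.mul
      ((Complex.continuous_conj.comp_aestronglyMeasurable (Lp.aestronglyMeasurable V)).mul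
        (Lp.aestronglyMeasurable U))
  refine (hV.add hU).mono' hm (Eventually.of_forall fun ξ => ?_)
  have h0 := symb_nonneg s ξ
  rw [norm_mul, norm_mul, Complex.norm_real, Real.norm_of_nonneg h0, RCLike.norm_conj]
  simp only [Pi.add_apply]
  rw [← mul_add]
  gcongr
  nlinarith [sq_nonneg (‖V ξ‖ - ‖U ξ‖), sq_nonneg (‖V ξ‖), sq_nonneg (‖U ξ‖)]

/-- The bilinear form of the operator. -/
lemma Graph.inner_eq {s : ℝ} (hs : 1 / 2 < s) {U H V : L2} {z : ℂ} (h : Graph s U H z)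
    (hV : FormInt s V) :
    inner ℂ V H = (∫ ξ, (symb s ξ : ℂ) * ((starRingEnd ℂ) (V ξ) * U ξ)) +
      z * (starRingEnd ℂ) (∫ ξ, V ξ) := by
  have hU := h.formInt hs
  have h1 := integrable_symb_conj_mul hU hV
  have h2 : Integrable fun ξ => z * (starRingEnd ℂ) (V ξ) := by
    refine ((hV.integrable hs).norm.mono' (Complex.continuous_conj.comp_aestronglyMeasurable
      (Lp.aestronglyMeasurable V)) (Eventually.of_forall fun ξ => ?_)).const_mul z
    simp
  rw [inner_eq_integral, ← integral_conj, ← integral_const_mul, ← integral_add h1 h2]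
  refine integral_congr_ae ?_
  filter_upwards [h] with ξ hξ
  rw [hξ]
  ring

lemma Graph.inner_self_eq {s : ℝ} (hs : 1 / 2 < s) {U H : L2} {z : ℂ} (h : Graph s U H z) :
    inner ℂ U H = ((∫ ξ, symb s ξ * ‖U ξ‖ ^ 2 : ℝ) : ℂ) + z * (starRingEnd ℂ) (∫ ξ, U ξ) := by
  rw [h.inner_eq hs (h.formInt hs), ← integral_complex_ofReal]
  congr 2
  funext ξ
  rw [mul_comm ((starRingEnd ℂ) (U ξ)), Complex.mul_conj, Complex.normSq_eq_norm_sq]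
  push_cast
  ring

lemma Graph.sub {s : ℝ} {U H V K : L2} {z w : ℂ} (h : Graph s U H z) (h' : Graph s V K w) :
    Graph s (U - V) (H - K) (z - w) := by
  filter_upwards [h, h', Lp.coeFn_sub U V, Lp.coeFn_sub H K] with ξ h1 h2 h3 h4
  rw [h4, h3, Pi.sub_apply, Pi.sub_apply, h1, h2]
  ring

lemma integral_sub_eq {U V : L2} (hU : Integrable U) (hV : Integrable V) :
    ∫ ξ, (U - V : L2) ξ = (∫ ξ, U ξ) - ∫ ξ, V ξ := by
  rw [← integral_sub hU hV]
  exact integral_congr_ae (Lp.coeFn_sub U V)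

lemma nonlin_mul_conj (σ β : ℝ) (z : ℂ) :
    nonlin σ β z * (starRingEnd ℂ) z = ((β * (‖z‖ ^ (2 * σ) * ‖z‖ ^ 2) : ℝ) : ℂ) := by
  rw [nonlin, mul_assoc, Complex.mul_conj, Complex.normSq_eq_norm_sq]
  push_cast
  ring

/-- A curve with `i∂ₜU = H` and `⟪U, H⟫` real has constant norm. -/
lemma norm_eq_of_hasDerivWithinAt {T : ℝ} {U H : ℝ → L2}
    (hd : ∀ t ∈ Set.Icc 0 T, HasDerivWithinAt U (-Complex.I • H t) (Set.Icc 0 T) t)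
    (him : ∀ t ∈ Set.Icc 0 T, (inner ℂ (U t) (H t) : ℂ).im = 0) {t : ℝ} (ht : t ∈ Set.Icc 0 T) :
    ‖U t‖ = ‖U 0‖ := by
  have h1 : ∀ t ∈ Set.Icc 0 T, HasDerivWithinAt (fun t => (inner ℂ (U t) (U t) : ℂ)) 0
      (Set.Icc 0 T) t := fun t ht => by
    refine ((hd t ht).inner ℂ (hd t ht)).congr_deriv ?_
    have h2 := inner_conj_symm (𝕜 := ℂ) (H t) (U t)
    have h3 := Complex.conj_eq_iff_im.2 (him t ht)
    rw [inner_smul_right, inner_smul_left, ← h2, h3, map_neg, Complex.conj_I]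
    ring
  have hT : 0 < T ∨ T = 0 := (ht.1.trans ht.2).lt_or_eq.imp id Eq.symm
  rcases hT with hT | hT
  · have h2 := constant_of_derivWithin_zero (fun t ht => (h1 t ht).differentiableWithinAt)
      (fun t ht => (h1 t ⟨ht.1, ht.2.le⟩).derivWithin
        (uniqueDiffOn_Icc hT t ⟨ht.1, ht.2.le⟩)) t ht
    simp only [inner_self_eq_norm_sq_to_K] at h2
    have h3 : ‖U t‖ ^ 2 = ‖U 0‖ ^ 2 := by exact_mod_cast h2
    exact (pow_left_inj₀ (norm_nonneg _) (norm_nonneg _) two_ne_zero).1 h3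
  · have : t = 0 := le_antisymm (ht.2.trans hT.le) ht.1
    rw [this]

lemma norm_fourier_eq (u : L2) : ‖(𝓕 u : L2)‖ = ‖u‖ := (Lp.fourierTransformₗᵢ ℝ ℂ).norm_map u

section Conservation

variable {s σ β T : ℝ} {U H : ℝ → L2} {q : ℝ → ℂ}

lemma IsFlow.norm_eq (h : IsFlow s σ β T U H q) (hs : 1 / 2 < s) {t : ℝ} (ht : t ∈ Set.Icc 0 T) :
    ‖U t‖ = ‖U 0‖ := by
  refine norm_eq_of_hasDerivWithinAt h.deriv (fun t ht => ?_) ht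
  rw [(h.graph t ht).inner_self_eq hs, h.integral_eq t ht, nonlin_mul_conj, ← Complex.ofReal_add,
    Complex.ofReal_im]

/-- Both charges solve the same charge equation and so coincide. The charge terms then cancel in the
difference of the flows, whose norm is constant and initially zero; no Gronwall argument in `L²` is
needed. -/
lemma IsFlow.eqOn {U' H' : ℝ → L2} {q' : ℝ → ℂ} {ψ₀ : L2} (h : IsFlow s σ β T U H q)
    (h' : IsFlow s σ β T U' H' q') (hs : 1 / 2 < s) (hσ : 0 < σ) (hT : 0 ≤ T) (h0 : U 0 = 𝓕 ψ₀)
    (h0' : U' 0 = 𝓕 ψ₀) : Set.EqOn U U' (Set.Icc 0 T) := by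
  intro t ht
  have hq := (h.isChargeSolution hs hσ hT h0).eqOn hs hσ hT (h'.isChargeSolution hs hσ hT h0')
  have key := norm_eq_of_hasDerivWithinAt (U := fun t => U t - U' t) (H := fun t => H t - H' t)
    (T := T) (fun t ht => by
      refine ((h.deriv t ht).sub (h'.deriv t ht)).congr_deriv ?_
      rw [smul_sub]) (fun t ht => by
      have hg := (h.graph t ht).sub (h'.graph t ht)
      rw [hg.inner_self_eq hs, hq ht, sub_self, zero_mul, add_zero, Complex.ofReal_im]) ht
  simp only [h0, h0', sub_self, norm_zero, norm_eq_zero, sub_eq_zero] at key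
  exact key

/-- Second order expansion of the interaction energy. -/
lemma exists_abs_interaction_sub_le (hσ : 0 < σ) (β B : ℝ) : ∃ C : ℝ, 0 ≤ C ∧ ∀ z w : ℂ,
    ‖z‖ ≤ B → ‖w‖ ≤ B →
    |β / (σ + 1) * ‖z‖ ^ (2 * σ + 2) - β / (σ + 1) * ‖w‖ ^ (2 * σ + 2) -
      ((nonlin σ β z + nonlin σ β w) * (starRingEnd ℂ) (z - w)).re| ≤ C * ‖z - w‖ ^ 2 := by
  set L := |β| * ((2 * σ + 2) * B ^ (2 * σ)) with hL
  rcases lt_or_ge B 0 with hB | hB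
  · exact ⟨0, le_rfl, fun z w hz _ => absurd hz (not_le.2 (hB.trans_le (norm_nonneg z)))⟩
  have hL0 : 0 ≤ L := by positivity
  refine ⟨2 * L, by positivity, fun z w hz hw => ?_⟩
  have hd : ∀ x : ℂ, HasFDerivAt (fun x : ℂ => β / (σ + 1) * ‖x‖ ^ (2 * σ + 2))
      (2 • innerSL ℝ (nonlin σ β x)) x := by
    intro x
    refine ((hasFDerivAt_norm_rpow x (p := 2 * σ + 2) (by linarith)).const_mul
      (β / (σ + 1))).congr_fderiv ?_
    have e : nonlin σ β x = (β * ‖x‖ ^ (2 * σ)) • x := by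
      rw [nonlin, Complex.real_smul]
      push_cast
      ring
    have e2 : 2 * σ + 2 - 2 = 2 * σ := by ring
    rw [e, map_smul, e2, smul_smul, ← Nat.cast_smul_eq_nsmul ℝ, smul_smul]
    congr 1
    push_cast
    field_simp
  have hseg : segment ℝ w z ⊆ Metric.closedBall (0 : ℂ) B :=
    (convex_closedBall _ _).segment_subset (by simpa using hw) (by simpa using hz)
  -- The gradient of the interaction energy at `x` is twice the nonlinearity at `x`. The comparison
  -- map uses the sum of its values at the two end points, and along the segment the deviation is
  -- `O(‖z - w‖)`.
  have key := Convex.norm_image_sub_le_of_norm_hasFDerivWithin_le' (𝕜 := ℝ)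
    (f := fun x : ℂ => β / (σ + 1) * ‖x‖ ^ (2 * σ + 2)) (s := segment ℝ w z)
    (f' := fun x => 2 • innerSL ℝ (nonlin σ β x))
    (φ := innerSL ℝ (nonlin σ β z + nonlin σ β w)) (C := 2 * L * ‖z - w‖)
    (fun x _ => (hd x).hasFDerivWithinAt) (fun x hx => ?_) (convex_segment w z)
    (left_mem_segment ℝ w z) (right_mem_segment ℝ w z)
  · rw [innerSL_apply_apply, Real.norm_eq_abs] at key
    have e : inner ℝ (nonlin σ β z + nonlin σ β w) (z - w) =
        ((nonlin σ β z + nonlin σ β w) * (starRingEnd ℂ) (z - w)).re := by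
      rw [Complex.inner, ← Complex.conj_re]
      simp only [map_mul, Complex.conj_conj]
      rw [mul_comm]
    rw [e] at key
    calc _ ≤ _ := key
      _ = _ := by ring
  · have hxB : ‖x‖ ≤ B := by simpa using hseg hx
    have e : 2 • innerSL ℝ (nonlin σ β x) - innerSL ℝ (nonlin σ β z + nonlin σ β w) =
        innerSL ℝ ((nonlin σ β x - nonlin σ β z) + (nonlin σ β x - nonlin σ β w)) := by
      simp only [map_add, map_sub]
      module
    rw [e, innerSL_apply_norm]
    have hxz : ‖x - z‖ ≤ ‖z - w‖ := by
      have := norm_sub_le_of_mem_segment (segment_symm ℝ w z ▸ hx)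
      rwa [norm_sub_rev w z] at this
    have hxw : ‖x - w‖ ≤ ‖z - w‖ := norm_sub_le_of_mem_segment hx
    calc _ ≤ L * ‖x - z‖ + L * ‖x - w‖ := (norm_add_le _ _).trans
          (add_le_add (norm_nonlin_sub_le hσ hxB hz) (norm_nonlin_sub_le hσ hxB hw))
      _ ≤ L * ‖z - w‖ + L * ‖z - w‖ := by gcongr
      _ = _ := by ring

/-- The energy on the Fourier side. -/
def energyHat (s σ β : ℝ) (U : L2) (z : ℂ) : ℝ :=
  (∫ ξ, symb s ξ * ‖U ξ‖ ^ 2) + β / (σ + 1) * ‖z‖ ^ (2 * σ + 2)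

/-- Polarisation: a difference of squares is the real part of the form evaluated at `U - V` and `U +
V`. The symmetric sum `z + w` matches the expansion in `exists_abs_interaction_sub_le`, so the
charge terms cancel in the energy. -/
lemma Graph.form_sub_eq (hs : 1 / 2 < s) {U H V K : L2} {z w : ℂ} (h : Graph s U H z)
    (h' : Graph s V K w) :
    (∫ ξ, symb s ξ * ‖U ξ‖ ^ 2) - (∫ ξ, symb s ξ * ‖V ξ‖ ^ 2) =
      (inner ℂ (U - V) (H + K) : ℂ).re -
        ((z + w) * (starRingEnd ℂ) ((∫ ξ, U ξ) - ∫ ξ, V ξ)).re := by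
  have hU := h.formInt hs
  have hV := h'.formInt hs
  have hD := (h.sub h').formInt hs
  rw [inner_add_right, h.inner_eq hs hD, h'.inner_eq hs hD,
    integral_sub_eq (hU.integrable hs) (hV.integrable hs)]
  have e : (∫ ξ, symb s ξ * ‖U ξ‖ ^ 2) - (∫ ξ, symb s ξ * ‖V ξ‖ ^ 2) =
      ((∫ ξ, (symb s ξ : ℂ) * ((starRingEnd ℂ) ((U - V : L2) ξ) * U ξ)) +
        ∫ ξ, (symb s ξ : ℂ) * ((starRingEnd ℂ) ((U - V : L2) ξ) * V ξ)).re := by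
    rw [← integral_add (integrable_symb_conj_mul hU hD) (integrable_symb_conj_mul hV hD),
      ← integral_sub hU hV]
    have h1 := integral_re (𝕜 := ℂ) ((integrable_symb_conj_mul hU hD).add
      (integrable_symb_conj_mul hV hD))
    refine Eq.trans ?_ h1
    refine integral_congr_ae ?_
    filter_upwards [Lp.coeFn_sub U V] with ξ hξ
    simp only [Pi.add_apply, RCLike.re_eq_complex_re]
    rw [hξ, Pi.sub_apply, ← Complex.normSq_eq_norm_sq, ← Complex.normSq_eq_norm_sq,
      Complex.normSq_apply, Complex.normSq_apply]
    simp only [map_sub, Complex.add_re, Complex.mul_re, Complex.sub_re, Complex.sub_im,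
      Complex.conj_re, Complex.conj_im, Complex.ofReal_re, Complex.ofReal_im, Complex.mul_im]
    ring
  rw [e]
  simp only [Complex.add_re, add_mul]
  ring

/-- The difference quotient of the energy is the real part of the pairing of the slope of `U` with
`H t + H r`, up to an error `|δq|²/|δt|`. The first tends to the real part of `⟪-iH, 2H⟫`, which is
zero; the second tends to zero by interpolation and the continuity of `U` and `H`. -/
lemma IsFlow.energy_eq (h : IsFlow s σ β T U H q) (hs : 1 / 2 < s) (hσ : 0 < σ) {t : ℝ}
    (ht : t ∈ Set.Icc 0 T) : energyHat s σ β (U t) (q t) = energyHat s σ β (U 0) (q 0) := by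
  obtain ⟨B, hB⟩ := isCompact_Icc.exists_bound_of_continuousOn (h.continuousOn_charge hs)
  obtain ⟨C, hC, hCB⟩ := exists_abs_interaction_sub_le hσ β B
  have h0 : (0 : ℝ) ∈ Set.Icc 0 T := ⟨le_rfl, ht.1.trans ht.2⟩
  have hB0 : 0 ≤ B := (norm_nonneg _).trans (hB 0 h0)
  set L := |β| * ((2 * σ + 2) * B ^ (2 * σ)) with hL
  have hL0 : 0 ≤ L := by positivity
  -- This `ε` lets the contribution `L |δq|²` of the nonlinearity be absorbed with factor at most
  -- `1/2`.
  obtain ⟨D, hD, hDB⟩ := exists_norm_integral_sq_le (ε := 1 / (2 * (L + 1))) hs (by positivity)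
  have hqd : ∀ t ∈ Set.Icc 0 T, ∀ r ∈ Set.Icc 0 T, ‖q t - q r‖ ^ 2 ≤
      ‖U t - U r‖ * ‖H t - H r‖ + 2 * D * ‖U t - U r‖ ^ 2 := by
    intro t ht r hr
    have hg := (h.graph t ht).sub (h.graph r hr)
    have hint : ∫ ξ, (U t - U r : L2) ξ = q t - q r := by
      rw [integral_sub_eq (((h.graph t ht).formInt hs).integrable hs)
        (((h.graph r hr).formInt hs).integrable hs), h.integral_eq t ht, h.integral_eq r hr]
    have h1 := hDB _ (hg.formInt hs)
    have h2 := hg.inner_self_eq hs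
    rw [hint] at h1 h2
    have h3 : ∫ ξ, symb s ξ * ‖(U t - U r : L2) ξ‖ ^ 2 ≤
        ‖U t - U r‖ * ‖H t - H r‖ + L * ‖q t - q r‖ ^ 2 := by
      have h4 := congrArg Complex.re h2
      rw [Complex.add_re, Complex.ofReal_re] at h4
      have h5 : |(inner ℂ (U t - U r) (H t - H r) : ℂ).re| ≤ ‖U t - U r‖ * ‖H t - H r‖ :=
        (Complex.abs_re_le_norm _).trans (norm_inner_le_norm _ _)
      have h6 : |((nonlin σ β (q t) - nonlin σ β (q r)) * (starRingEnd ℂ) (q t - q r)).re| ≤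
          L * ‖q t - q r‖ ^ 2 := by
        refine (Complex.abs_re_le_norm _).trans ?_
        rw [norm_mul, RCLike.norm_conj, pow_two, ← mul_assoc]
        gcongr
        exact norm_nonlin_sub_le hσ (hB t ht) (hB r hr)
      linarith [(abs_le.1 h5).2, (abs_le.1 h6).1]
    have h7 : 1 / (2 * (L + 1)) * (∫ ξ, symb s ξ * ‖(U t - U r : L2) ξ‖ ^ 2) ≤
        1 / 2 * (‖U t - U r‖ * ‖H t - H r‖) + 1 / 2 * ‖q t - q r‖ ^ 2 := by
      rw [div_mul_eq_mul_div, one_mul, div_le_iff₀ (by positivity)]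
      refine h3.trans ?_
      have := mul_nonneg (norm_nonneg (U t - U r)) (norm_nonneg (H t - H r))
      nlinarith [sq_nonneg ‖q t - q r‖, mul_nonneg this hL0]
    linarith
  have hd : ∀ r ∈ Set.Icc 0 T, HasDerivWithinAt (fun t => energyHat s σ β (U t) (q t)) 0
      (Set.Icc 0 T) r := by
    intro r hr
    rw [hasDerivWithinAt_iff_tendsto_slope]
    have hsl := hasDerivWithinAt_iff_tendsto_slope.1 (h.deriv r hr)
    have hle : 𝓝[Set.Icc 0 T \ {r}] r ≤ 𝓝[Set.Icc 0 T] r := nhdsWithin_mono _ Set.sdiff_subset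
    have hH : Tendsto H (𝓝[Set.Icc 0 T \ {r}] r) (𝓝 (H r)) := (h.continuousOn_image r hr).mono_left hle
    have hU : Tendsto U (𝓝[Set.Icc 0 T \ {r}] r) (𝓝 (U r)) := (h.continuousOn r hr).mono_left hle
    have l1 : Tendsto (fun t => (inner ℂ (slope U r t) (H t + H r) : ℂ).re)
        (𝓝[Set.Icc 0 T \ {r}] r) (𝓝 0) := by
      have h1 := (Complex.continuous_re.tendsto _).comp (hsl.inner (𝕜 := ℂ) (hH.add_const (H r)))
      have e : (inner ℂ (-Complex.I • H r) (H r + H r) : ℂ).re = 0 := by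
        rw [← two_smul ℂ (H r), inner_smul_left, inner_smul_right, inner_self_eq_norm_sq_to_K]
        simp [← Complex.ofReal_pow]
      rw [e] at h1
      exact h1
    have l2 : Tendsto (fun t => C * (‖slope U r t‖ * ‖H t - H r‖ +
        2 * D * (‖slope U r t‖ * ‖U t - U r‖))) (𝓝[Set.Icc 0 T \ {r}] r) (𝓝 0) := by
      have h1 := (hH.sub_const (H r)).norm
      have h2 := (hU.sub_const (U r)).norm
      rw [sub_self, norm_zero] at h1 h2
      simpa using ((hsl.norm.mul h1).add ((hsl.norm.mul h2).const_mul (2 * D))).const_mul C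
    have l3 : Tendsto (fun t => slope (fun t => energyHat s σ β (U t) (q t)) r t -
        (inner ℂ (slope U r t) (H t + H r) : ℂ).re) (𝓝[Set.Icc 0 T \ {r}] r) (𝓝 0) := by
      refine squeeze_zero_norm' ?_ l2
      filter_upwards [self_mem_nhdsWithin] with t ht
      have h1 := (h.graph t ht.1).form_sub_eq hs (h.graph r hr)
      have h2 := hCB (q t) (q r) (hB t ht.1) (hB r hr)
      rw [h.integral_eq t ht.1, h.integral_eq r hr] at h1
      have e : slope (fun t => energyHat s σ β (U t) (q t)) r t -
          (inner ℂ (slope U r t) (H t + H r) : ℂ).re = (t - r)⁻¹ *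
          (β / (σ + 1) * ‖q t‖ ^ (2 * σ + 2) - β / (σ + 1) * ‖q r‖ ^ (2 * σ + 2) -
          ((nonlin σ β (q t) + nonlin σ β (q r)) * (starRingEnd ℂ) (q t - q r)).re) := by
        have e1 : (inner ℂ (slope U r t) (H t + H r) : ℂ).re =
            (t - r)⁻¹ * (inner ℂ (U t - U r) (H t + H r) : ℂ).re := by
          rw [slope_def_module, RCLike.real_smul_eq_coe_smul (K := ℂ), inner_smul_left,
            RCLike.conj_ofReal]
          exact Complex.re_ofReal_mul _ _
        rw [e1, slope_def_module, smul_eq_mul, energyHat, energyHat]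
        linear_combination (t - r)⁻¹ * h1
      have e2 : ‖slope U r t‖ = |t - r|⁻¹ * ‖U t - U r‖ := by
        rw [slope_def_module, norm_smul, Real.norm_eq_abs, abs_inv]
      rw [e, Real.norm_eq_abs, abs_mul, abs_inv, e2]
      calc _ ≤ |t - r|⁻¹ * (C * ‖q t - q r‖ ^ 2) := by gcongr
        _ ≤ |t - r|⁻¹ * (C * (‖U t - U r‖ * ‖H t - H r‖ + 2 * D * ‖U t - U r‖ ^ 2)) := by
          gcongr
          exact hqd t ht.1 r hr
        _ = _ := by ring
    simpa using l3.add l1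
  rcases (ht.1.trans ht.2).lt_or_eq with hT | hT
  · exact constant_of_derivWithin_zero (fun t ht => (hd t ht).differentiableWithinAt)
      (fun t ht => (hd t ⟨ht.1, ht.2.le⟩).derivWithin
        (uniqueDiffOn_Icc hT t ⟨ht.1, ht.2.le⟩)) t ht
  · have : t = 0 := le_antisymm (ht.2.trans hT.symm.le) ht.1
    rw [this]

end Conservation

/-- Conservation of mass and energy. -/
lemma IsStrongSolution.conservation {s σ β T : ℝ} (hs : 1 / 2 < s) (hσ : 0 < σ) {ψ₀ : L2}
    {ψ : ℝ → L2} (h : IsStrongSolution s σ β T ψ₀ ψ) {t : ℝ} (ht : t ∈ Set.Icc 0 T) :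
    mass (ψ t) = mass ψ₀ ∧ energy s σ β (ψ t) = energy s σ β ψ₀ := by
  have hf := h.isFlow hs
  have h1 := hf.norm_eq hs ht
  have h2 := hf.energy_eq hs hσ ht
  simp only [norm_fourier_eq, h.initial] at h1
  simp only [h.initial] at h2
  exact ⟨h1, h2⟩

lemma IsStrongSolution.eqOn {s σ β T : ℝ} (hs : 1 / 2 < s) (hσ : 0 < σ) (hT : 0 ≤ T) {ψ₀ : L2}
    {ψ ψ' : ℝ → L2} (h : IsStrongSolution s σ β T ψ₀ ψ) (h' : IsStrongSolution s σ β T ψ₀ ψ') :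
    Set.EqOn ψ' ψ (Set.Icc 0 T) := fun t ht =>
  (Lp.fourierTransformₗᵢ ℝ ℂ).injective ((h'.isFlow hs).eqOn (h.isFlow hs) hs hσ hT
    (by rw [h'.initial]) (by rw [h.initial]) ht)

/-- A continuous solution of the charge equation generates a solution of the whole problem. -/
lemma IsChargeSolution.wellPosedOn {s σ β T : ℝ} (hs : 1 / 2 < s) (hσ : 0 < σ) (hT : 0 < T)
    {ψ₀ : L2} (hψ : ψ₀ ∈ domain s σ β) {q : ℝ → ℂ} (hq : IsChargeSolution s σ β T ψ₀ q) :
    WellPosedOn s σ β T ψ₀ q (duhamelState s σ β ψ₀ q) := by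
  obtain ⟨N, H, h⟩ := hq.exists_pair hs hσ hT.le hψ
  have hst := h.isStrongSolution hs hT
  exact ⟨hq, fun q' hq' => hq'.eqOn hs hσ hT.le hq, h.isDuhamel, hst,
    fun ψ' hψ' => hst.eqOn hs hσ hT.le hψ', fun t ht => h.value_eq hs ht⟩

/-! ### Existence of charges -/

lemma continuous_integral_phase_mul {s : ℝ} {U : ℝ → ℂ} (hU : Integrable U) :
    Continuous fun t => ∫ ξ, phase s t ξ * U ξ := by
  refine continuous_of_dominated (bound := fun ξ => ‖U ξ‖)
    (fun t => (integrable_phase_mul_of_integrable hU t).1) (fun t => Eventually.of_forall fun ξ => ?_)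
    hU.norm (Eventually.of_forall fun ξ => ?_)
  · rw [norm_mul, norm_phase, one_mul]
  · exact (continuous_phase_left ξ).mul_const _

lemma integral_const_div_rpow {α : ℝ} (hα : α < 1) (z : ℂ) {t : ℝ} (ht : 0 ≤ t) :
    ∫ τ in (0 : ℝ)..t, z / (((t - τ) ^ α : ℝ) : ℂ) = z * ((t ^ (1 - α) / (1 - α) : ℝ) : ℂ) := by
  rw [intervalIntegral.integral_comp_sub_left (fun x => z / ((x ^ α : ℝ) : ℂ)) t, sub_self, sub_zero]
  have h1 : ∫ x in (0 : ℝ)..t, z / ((x ^ α : ℝ) : ℂ) = ∫ x in (0 : ℝ)..t, z * ((x ^ (-α) : ℝ) : ℂ) := by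
    refine intervalIntegral.integral_congr fun x hx => ?_
    rw [Set.uIcc_of_le ht] at hx
    rw [Real.rpow_neg hx.1, Complex.ofReal_inv, div_eq_mul_inv]
  rw [h1, intervalIntegral.integral_const_mul, intervalIntegral.integral_ofReal,
    integral_rpow (Or.inl (by linarith)), Real.zero_rpow (by linarith), sub_zero,
    show -α + 1 = 1 - α by ring]

/-- Solution of the charge equation with a Lipschitz nonlinearity. -/
lemma exists_lipschitz_charge {s : ℝ} (hs : 1 / 2 < s) {ψ₀ : L2} (hF : FormInt s (𝓕 ψ₀ : L2))
    {P : ℂ → ℂ} {L : NNReal} (hP : LipschitzWith L P) :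
    ∃ Q : ℝ → ℂ, Continuous Q ∧ ∀ t, 0 ≤ t → Q t + Complex.I * kernelConst s *
      ∫ τ in (0 : ℝ)..t, P (Q τ) / (((t - τ) ^ (1 / (2 * s)) : ℝ) : ℂ) =
        value (propagator s t ψ₀) 0 := by
  set α := 1 / (2 * s) with hα'
  have hα : α < 1 := one_div_two_mul_lt_one hs
  have hα0 : 0 < α := by positivity
  set U := (𝓕 ψ₀ : L2) with hU
  have hUi := hF.integrable hs
  set q₀ := ∫ ξ, U ξ with hq₀
  -- The unknown is `p = Q - q₀`. The forcing is the free evolution minus its initial value and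
  -- minus the explicit Volterra integral of the constant `P q₀`; `max t 0` makes it vanish at
  -- negative times.
  set G : ℝ → ℂ := fun t => (∫ ξ, phase s (max t 0) ξ * U ξ) - q₀ - Complex.I * kernelConst s *
    (P q₀ * (((max t 0) ^ (1 - α) / (1 - α) : ℝ) : ℂ)) with hG
  have hGc : Continuous G := by
    have h1 := (continuous_integral_phase_mul (s := s) hUi).comp
      (continuous_id.max (continuous_const (y := (0 : ℝ))))
    have h2 : Continuous fun t : ℝ => (max t 0) ^ (1 - α) :=
      (continuous_id.max continuous_const).rpow_const fun _ => Or.inr (by linarith)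
    simp only [Function.comp_def, id] at h1
    fun_prop
  have hG0 : ∀ t ≤ 0, G t = 0 := fun t ht => by
    simp only [hG]
    rw [max_eq_right ht, Real.zero_rpow (by linarith)]
    simp [hq₀]
  set A := ‖q₀‖ + (∫ ξ, ‖U ξ‖) + ‖kernelConst s‖ * (‖P q₀‖ * (1 - α)⁻¹) with hA
  have h1α : 0 < 1 - α := by linarith
  have hA0 : 0 ≤ A := by positivity
  have hGB : ∀ t, ‖G t‖ ≤ A * Real.exp t := by
    intro t
    rcases le_total t 0 with ht | ht
    · rw [hG0 t ht, norm_zero]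
      positivity
    · have he : 1 + t ≤ Real.exp t := by linarith [Real.add_one_le_exp t]
      have he1 : 1 ≤ Real.exp t := by linarith
      have hp : t ^ (1 - α) ≤ Real.exp t := by
        refine le_trans ?_ he
        rcases le_total t 1 with h1 | h1
        · linarith [Real.rpow_le_one ht h1 h1α.le]
        · have := Real.rpow_le_rpow_of_exponent_le h1 (show 1 - α ≤ 1 by linarith)
          rw [Real.rpow_one] at this
          linarith
      have h1 : ‖∫ ξ, phase s t ξ * U ξ‖ ≤ ∫ ξ, ‖U ξ‖ := by
        refine (norm_integral_le_integral_norm _).trans (le_of_eq ?_)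
        simp only [norm_mul, norm_phase, one_mul]
      simp only [hG]
      rw [max_eq_left ht]
      calc _ ≤ ‖∫ ξ, phase s t ξ * U ξ‖ + ‖q₀‖ + ‖Complex.I * kernelConst s *
            (P q₀ * ((t ^ (1 - α) / (1 - α) : ℝ) : ℂ))‖ :=
            (norm_sub_le _ _).trans (add_le_add_left (norm_sub_le _ _) _)
        _ ≤ (∫ ξ, ‖U ξ‖) * Real.exp t + ‖q₀‖ * Real.exp t +
            ‖kernelConst s‖ * (‖P q₀‖ * (1 - α)⁻¹) * Real.exp t := by
          refine add_le_add (add_le_add (h1.trans ?_) ?_) ?_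
          · exact le_mul_of_one_le_right (integral_nonneg fun _ => norm_nonneg _) he1
          · exact le_mul_of_one_le_right (norm_nonneg _) he1
          · rw [norm_mul, norm_mul, norm_mul, Complex.norm_I, one_mul, Complex.norm_real,
              Real.norm_of_nonneg (by positivity), div_eq_mul_inv, mul_comm (t ^ (1 - α)),
              mul_assoc, mul_assoc]
            gcongr
        _ = _ := by rw [hA]; ring
  have hP' : LipschitzWith L fun p => P (q₀ + p) - P q₀ := by
    refine LipschitzWith.of_dist_le_mul fun x y => ?_
    rw [dist_sub_right]
    exact (hP.dist_le_mul _ _).trans (by rw [dist_add_left])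
  obtain ⟨p, hpc, hp0, hp⟩ := exists_volterra hα (Complex.I * kernelConst s) hP' (by simp) hGc hG0 hGB
  refine ⟨fun t => q₀ + p t, by fun_prop, fun t ht => ?_⟩
  have hPc : Continuous fun t => P (q₀ + p t) := hP.continuous.comp (by fun_prop)
  have h1 := integral_div_rpow_eq hα hPc (fun t ht => by rw [hp0 t ht, hp0 0 le_rfl]) ht
  rw [h1, hp0 0 le_rfl, add_zero, integral_const_div_rpow hα _ ht, value_propagator hs hF]
  simp only [hp t, hG]
  rw [max_eq_left ht]
  ring

lemma exists_first_exit {Q : ℝ → ℂ} (hQ : Continuous Q) {B : ℝ} (h0 : ‖Q 0‖ < B) :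
    (∀ t, 0 ≤ t → ‖Q t‖ ≤ B) ∨ ∃ T, 0 < T ∧ ‖Q T‖ = B ∧ ∀ t ∈ Set.Icc 0 T, ‖Q t‖ ≤ B := by
  by_cases hex : ∃ t, 0 ≤ t ∧ B ≤ ‖Q t‖
  · right
    set S := {t : ℝ | 0 ≤ t ∧ B ≤ ‖Q t‖} with hS
    have hcl : IsClosed S := (isClosed_le continuous_const continuous_id).inter
      (isClosed_le continuous_const hQ.norm)
    have hbd : BddBelow S := ⟨0, fun t ht => ht.1⟩
    have hmem : sInf S ∈ S := hcl.csInf_mem hex hbd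
    have hlt : ∀ t, 0 ≤ t → t < sInf S → ‖Q t‖ < B := fun t ht hts => by
      by_contra hcon
      exact absurd (csInf_le hbd (show t ∈ S from ⟨ht, not_lt.1 hcon⟩)) (not_le.2 hts)
    have hpos : 0 < sInf S := by
      refine lt_of_le_of_ne hmem.1 fun h => ?_
      rw [← h] at hmem
      exact absurd hmem.2 (not_le.2 h0)
    have hle : ‖Q (sInf S)‖ ≤ B := by
      have hc : Tendsto (fun t => ‖Q t‖) (𝓝[<] (sInf S)) (𝓝 ‖Q (sInf S)‖) :=
        (hQ.norm.tendsto _).mono_left nhdsWithin_le_nhds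
      refine le_of_tendsto hc ?_
      filter_upwards [Ioo_mem_nhdsLT hpos] with t ht
      exact (hlt t ht.1.le ht.2).le
    refine ⟨sInf S, hpos, le_antisymm hle hmem.2, fun t ht => ?_⟩
    rcases ht.2.lt_or_eq with h | h
    · exact (hlt t ht.1 h).le
    · rw [h]
      exact hle
  · left
    push Not at hex
    exact fun t ht => (hex t ht).le

/-- A charge exists for all times, or until its modulus reaches a given level. -/
lemma exists_charge_until {s σ β : ℝ} (hs : 1 / 2 < s) (hσ : 0 < σ) {ψ₀ : L2}
    (hψ : ψ₀ ∈ domain s σ β) {B : ℝ} (hB : ‖value ψ₀ 0‖ < B) :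
    ∃ q : ℝ → ℂ, Continuous q ∧ ((∀ T, IsChargeSolution s σ β T ψ₀ q) ∨
      ∃ T, 0 < T ∧ IsChargeSolution s σ β T ψ₀ q ∧ ‖q T‖ = B) := by
  obtain ⟨P, L, hP, hPeq⟩ := exists_lipschitz_nonlin (β := β) hσ B
  obtain ⟨Q, hQ, hQeq⟩ := exists_lipschitz_charge hs (formInt_of_mem_domain hs hψ) hP
  have h0 : Q 0 = value ψ₀ 0 := by
    have := hQeq 0 le_rfl
    rw [propagator_zero] at this
    simpa using this
  have key : ∀ T, (∀ t ∈ Set.Icc 0 T, ‖Q t‖ ≤ B) → IsChargeSolution s σ β T ψ₀ Q := by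
    refine fun T hT => ⟨hQ.continuousOn, fun t ht => ?_⟩
    rw [← hQeq t ht.1]
    congr 2
    refine intervalIntegral.integral_congr fun τ hτ => ?_
    rw [Set.uIcc_of_le ht.1] at hτ
    simp only [hPeq _ (hT τ ⟨hτ.1, hτ.2.trans ht.2⟩)]
  refine ⟨Q, hQ, ?_⟩
  rcases exists_first_exit hQ (by rwa [h0]) with h | ⟨T, hT, hTB, h⟩
  · exact Or.inl fun T => key T fun t ht => h t ht.1
  · exact Or.inr ⟨T, hT, key T h, hTB⟩

/-! ### Continuation of charges: local and global existence, blow-up alternative -/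

lemma IsChargeSolution.mono {s σ β T T' : ℝ} {ψ₀ : L2} {q : ℝ → ℂ}
    (hq : IsChargeSolution s σ β T ψ₀ q) (h : T' ≤ T) : IsChargeSolution s σ β T' ψ₀ q :=
  ⟨hq.continuousOn.mono (Set.Icc_subset_Icc_right h), fun t ht => hq.eqn t ⟨ht.1, ht.2.trans h⟩⟩

lemma exists_local_charge {s σ β : ℝ} (hs : 1 / 2 < s) (hσ : 0 < σ) {ψ₀ : L2}
    (hψ : ψ₀ ∈ domain s σ β) : ∃ T, 0 < T ∧ ∃ q, IsChargeSolution s σ β T ψ₀ q := by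
  obtain ⟨q, -, h | ⟨T, hT, h, -⟩⟩ := exists_charge_until hs hσ hψ (lt_add_one _)
  · exact ⟨1, one_pos, q, h 1⟩
  · exact ⟨T, hT, q, h⟩

/-- A static bound in terms of mass and energy gives a global solution. -/
lemma exists_global_of_bound {s σ β B : ℝ} (hs : 1 / 2 < s) (hσ : 0 < σ) {ψ₀ : L2}
    (hψ : ψ₀ ∈ domain s σ β) (hB : ∀ ψ ∈ domain s σ β, mass ψ = mass ψ₀ →
      energy s σ β ψ = energy s σ β ψ₀ → ‖value ψ 0‖ ≤ B) :
    ∃ (q : ℝ → ℂ) (ψ : ℝ → L2), ∀ T : ℝ, 0 < T → WellPosedOn s σ β T ψ₀ q ψ := by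
  have h0 : ‖value ψ₀ 0‖ < B + 1 := (hB ψ₀ hψ rfl rfl).trans_lt (lt_add_one B)
  obtain ⟨q, -, h | ⟨T, hT, h, hTB⟩⟩ := exists_charge_until hs hσ hψ h0
  · exact ⟨q, _, fun T hT => (h T).wellPosedOn hs hσ hT hψ⟩
  -- If the charge reached the level `B + 1`, the conservation laws at that time would contradict
  -- the static bound `B`.
  · have hw := h.wellPosedOn hs hσ hT hψ
    have hT' : T ∈ Set.Icc 0 T := ⟨hT.le, le_rfl⟩
    obtain ⟨h1, h2⟩ := hw.strong.conservation hs hσ hT'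
    have h3 := hB _ (hw.strong.mem_domain T hT') h1 h2
    rw [hw.value_eq T hT', hTB] at h3
    linarith

/-- The blow-up alternative. -/
lemma exists_blowup_of_bdd {s σ β T₁ : ℝ} (hs : 1 / 2 < s) (hσ : 0 < σ) {ψ₀ : L2}
    (hψ : ψ₀ ∈ domain s σ β)
    (hbd : ∀ T, 0 < T → ∀ q, IsChargeSolution s σ β T ψ₀ q → T ≤ T₁) :
    ∃ Tstar : ℝ, 0 < Tstar ∧ ∃ (q : ℝ → ℂ) (ψ : ℝ → L2),
      (∀ T : ℝ, 0 < T → T < Tstar → WellPosedOn s σ β T ψ₀ q ψ) ∧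
        limsup (fun t => ‖q t‖ₑ) (𝓝[<] Tstar) = ⊤ := by
  set S := {T : ℝ | 0 < T ∧ ∃ q, IsChargeSolution s σ β T ψ₀ q} with hS
  obtain ⟨T₀, hT₀, q₀, hq₀⟩ := exists_local_charge hs hσ hψ
  have hSb : BddAbove S := ⟨T₁, fun T hT => hbd T hT.1 _ hT.2.choose_spec⟩
  have hSn : S.Nonempty := ⟨T₀, hT₀, q₀, hq₀⟩
  set Ts := sSup S with hTs
  have hTs0 : 0 < Ts := hT₀.trans_le (le_csSup hSb ⟨hT₀, q₀, hq₀⟩)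
  have hex : ∀ t, t < Ts → ∃ T q, t < T ∧ T < Ts ∧ 0 < T ∧ IsChargeSolution s σ β T ψ₀ q := by
    intro t ht
    obtain ⟨T, hT, htT⟩ := exists_lt_of_lt_csSup hSn (max_lt ht hTs0)
    obtain ⟨r, hr1, hr2⟩ := exists_between htT
    obtain ⟨q, hq⟩ := hT.2
    exact ⟨r, q, (le_max_left _ _).trans_lt hr1, hr2.trans_le (le_csSup hSb hT),
      (le_max_right _ _).trans_lt hr1, hq.mono hr2.le⟩
  choose! τ Q hτ1 hτ2 hτ3 hQ using hex
  -- Each time is evaluated with a charge that exists slightly beyond it; uniqueness makes the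
  -- choices agree.
  set q : ℝ → ℂ := fun t => Q t t with hq
  have hqQ : ∀ T q', T < Ts → IsChargeSolution s σ β T ψ₀ q' → ∀ t ∈ Set.Icc 0 T, q t = q' t := by
    intro T q' hT hq' t ht
    have htT := ht.2.trans_lt hT
    exact ((hQ t htT).mono (hτ1 t htT).le).eqOn hs hσ ht.1 (hq'.mono ht.2) ⟨ht.1, le_rfl⟩
  have hsol : ∀ T, T < Ts → IsChargeSolution s σ β T ψ₀ q := by
    intro T hT
    have h1 := (hQ T hT).mono (hτ1 T hT).le
    have h2 := hqQ T _ hT h1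
    refine ⟨h1.continuousOn.congr h2, fun t ht => ?_⟩
    rw [← h1.eqn t ht, h2 t ht]
    congr 2
    refine intervalIntegral.integral_congr fun r hr => ?_
    rw [Set.uIcc_of_le ht.1] at hr
    simp only [h2 r ⟨hr.1, hr.2.trans ht.2⟩]
  refine ⟨Ts, hTs0, q, _, fun T hT hTT => (hsol T hTT).wellPosedOn hs hσ hT hψ, ?_⟩
  by_contra hlim
  obtain ⟨M, hM⟩ : ∃ M : NNReal, limsup (fun t => ‖q t‖ₑ) (𝓝[<] Ts) < M := by
    obtain ⟨M, hM1, -⟩ := ENNReal.lt_iff_exists_nnreal_btwn.1 (lt_top_iff_ne_top.2 hlim)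
    exact ⟨M, hM1⟩
  have hev := eventually_lt_of_limsup_lt hM
  obtain ⟨r, hr, hrM⟩ := (mem_nhdsLT_iff_exists_Ioo_subset' hTs0).1 hev
  have hr' : max r 0 < Ts := max_lt hr hTs0
  obtain ⟨B', hB'⟩ := isCompact_Icc.exists_bound_of_continuousOn (hsol _ hr').continuousOn
  have hbound : ∀ t, 0 ≤ t → t < Ts → ‖q t‖ ≤ max B' M := by
    intro t ht htT
    rcases le_or_gt t (max r 0) with h | h
    · exact (hB' t ⟨ht, h⟩).trans (le_max_left _ _)
    · have h1 : ‖q t‖ₑ < M := hrM ⟨(le_max_left _ _).trans_lt h, htT⟩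
      refine le_trans ?_ (le_max_right _ _)
      have h2 : ‖q t‖₊ < M := by exact_mod_cast h1
      exact_mod_cast h2.le
  have hv : value ψ₀ 0 = q 0 := by
    rw [(hsol 0 hTs0).apply_zero le_rfl, propagator_zero]
  have h0 : ‖value ψ₀ 0‖ < max B' M + 1 := by
    rw [hv]
    linarith [hbound 0 le_rfl hTs0]
  -- If `q` were bounded near `Ts`, a charge is built again from time `0` with a higher exit level,
  -- so no restart at a later time is needed. Being global contradicts `hbd`. Otherwise it exits at
  -- some `T ≤ Ts`, yet it agrees with `q` before `T` and by continuity stays below the level.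
  obtain ⟨q', hq'c, h | ⟨T, hT, h, hTB⟩⟩ := exists_charge_until hs hσ hψ h0
  · have := hbd (max T₁ 0 + 1) (by positivity) q' (h _)
    linarith [le_max_left T₁ 0]
  · have hTle : T ≤ Ts := le_csSup hSb ⟨hT, q', h⟩
    have hle : ‖q' T‖ ≤ max B' M := by
      have hc : Tendsto (fun t => ‖q' t‖) (𝓝[<] T) (𝓝 ‖q' T‖) :=
        (hq'c.norm.tendsto _).mono_left nhdsWithin_le_nhds
      refine le_of_tendsto hc ?_
      filter_upwards [Ioo_mem_nhdsLT hT] with t ht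
      have htT : t < Ts := ht.2.trans_le hTle
      rw [← hqQ t q' htT (h.mono ht.2.le) t ⟨ht.1.le, le_rfl⟩]
      exact hbound t ht.1.le htT
    linarith

/-! ### A priori bounds -/

/-- For `x ≥ 1` the constant `A` is at most `A x^r`, and dividing by `x^r` leaves a positive power
of `x` on the left. -/
lemma le_of_rpow_le {x p r A D : ℝ} (hx : 0 ≤ x) (hr0 : 0 ≤ r) (hr : r < p) (hA : 0 ≤ A)
    (h : x ^ p ≤ A + D * x ^ r) : x ≤ max 1 ((A + D) ^ (1 / (p - r))) := by
  rcases le_total x 1 with h1 | h1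
  · exact h1.trans (le_max_left _ _)
  · refine le_trans ?_ (le_max_right _ _)
    have hx0 : 0 < x := by linarith
    have h2 : 1 ≤ x ^ r := Real.one_le_rpow h1 hr0
    have h3 : x ^ (p - r) ≤ A + D := by
      rw [Real.rpow_sub hx0, div_le_iff₀ (by positivity)]
      nlinarith
    calc x = (x ^ (p - r)) ^ (1 / (p - r)) := by
          rw [← Real.rpow_mul hx, mul_one_div_cancel (by linarith), Real.rpow_one]
      _ ≤ _ := Real.rpow_le_rpow (by positivity) h3 (one_div_nonneg.2 (by linarith))

lemma norm_value_rpow_le {s σ β : ℝ} (hs : 1 / 2 < s) {ψ : L2} (hψ : ψ ∈ domain s σ β) :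
    ‖value ψ 0‖ ^ (4 * s) ≤ (2 * greenInt s) ^ (2 * s) * mass ψ ^ (4 * s - 2) *
      (energy s σ β ψ - β / (σ + 1) * ‖value ψ 0‖ ^ (2 * σ + 2)) := by
  have h := (formInt_of_mem_domain hs hψ).gagliardo_nirenberg hs
  rw [← value_of_mem_domain hs hψ, norm_fourier_eq] at h
  rw [energy, mass]
  simpa using h

/-- For `β ≥ 0` the interaction can be dropped from `norm_value_rpow_le`. For `β < 0` it enters with
the power `2σ + 2`, which is below `4s` exactly when `σ < 2s - 1`. -/
lemma exists_value_bound {s σ β : ℝ} (hs : 1 / 2 < s) (hσ : 0 < σ)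
    (hβ : 0 ≤ β ∨ (β < 0 ∧ σ < 2 * s - 1)) (M E : ℝ) : ∃ B, ∀ ψ ∈ domain s σ β, mass ψ = M →
      energy s σ β ψ = E → ‖value ψ 0‖ ≤ B := by
  set c := (2 * greenInt s) ^ (2 * s) * |M| ^ (4 * s - 2) with hc
  have hg := greenInt_pos hs
  have hc0 : 0 ≤ c := by positivity
  rcases hβ with hβ | ⟨hβ, hσs⟩
  · refine ⟨max 1 ((c * |E| + 0) ^ (1 / (4 * s - 0))), fun ψ hψ hM hE => ?_⟩
    refine le_of_rpow_le (norm_nonneg _) le_rfl (by linarith) (by positivity) ?_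
    have h := norm_value_rpow_le hs hψ
    have hM' : mass ψ = |M| := by
      rw [← hM, mass, abs_norm]
    rw [hM', hE, ← hc] at h
    rw [zero_mul, add_zero]
    refine h.trans (mul_le_mul_of_nonneg_left ?_ hc0)
    have : 0 ≤ β / (σ + 1) * ‖value ψ 0‖ ^ (2 * σ + 2) := by positivity
    linarith [le_abs_self E]
  · refine ⟨max 1 ((c * |E| + c * (-β / (σ + 1))) ^ (1 / (4 * s - (2 * σ + 2)))),
      fun ψ hψ hM hE => ?_⟩
    have hb : 0 ≤ -β / (σ + 1) := div_nonneg (by linarith) (by linarith)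
    refine le_of_rpow_le (norm_nonneg _) (by linarith) (by linarith) (by positivity) ?_
    have h := norm_value_rpow_le hs hψ
    have hM' : mass ψ = |M| := by
      rw [← hM, mass, abs_norm]
    rw [hM', hE, ← hc] at h
    rw [mul_assoc c, ← mul_add]
    refine h.trans (mul_le_mul_of_nonneg_left ?_ hc0)
    rw [neg_div]
    linarith [le_abs_self E]

lemma exists_critical_value_bound {s σ β : ℝ} (hs : 1 / 2 < s) (hβ : β < 0) (hσs : σ = 2 * s - 1) :
    ∃ C, 0 < C ∧ ∀ M E : ℝ, M < C → ∃ B, ∀ ψ ∈ domain s σ β, mass ψ = M →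
      energy s σ β ψ = E → ‖value ψ 0‖ ≤ B := by
  have hg := greenInt_pos hs
  set k := (2 * greenInt s) ^ (2 * s) with hk
  have hk0 : 0 < k := by positivity
  set b := -β / (σ + 1) with hb
  have hb0 : 0 < b := div_pos (by linarith) (by linarith)
  -- At the critical exponent both sides carry `|q|^{4s}`; this mass threshold makes the coefficient
  -- on the right at most `1/2`, so it can be absorbed.
  refine ⟨(1 / (2 * k * b)) ^ (1 / (4 * s - 2)), by positivity, fun M E hM => ?_⟩
  refine ⟨max 1 ((2 * (k * |M| ^ (4 * s - 2) * |E|) + 0) ^ (1 / (4 * s - 0))),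
    fun ψ hψ hMψ hE => ?_⟩
  refine le_of_rpow_le (norm_nonneg _) le_rfl (by linarith) (by positivity) ?_
  have h := norm_value_rpow_le hs hψ
  have hM0 : 0 ≤ M := hMψ ▸ norm_nonneg ψ
  have hM' : mass ψ = |M| := by rw [hMψ, abs_of_nonneg hM0]
  have hMC : |M| ^ (4 * s - 2) ≤ 1 / (2 * k * b) := by
    rw [abs_of_nonneg hM0]
    calc M ^ (4 * s - 2) ≤ ((1 / (2 * k * b)) ^ (1 / (4 * s - 2))) ^ (4 * s - 2) :=
          Real.rpow_le_rpow hM0 hM.le (by linarith)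
      _ = _ := by
          rw [← Real.rpow_mul (by positivity), one_div_mul_cancel (by linarith), Real.rpow_one]
  have hexp : 2 * σ + 2 = 4 * s := by rw [hσs]; ring
  rw [hM', hE, hexp, ← hk] at h
  have h1 : k * |M| ^ (4 * s - 2) * b ≤ 1 / 2 := by
    calc _ ≤ k * (1 / (2 * k * b)) * b := by gcongr
      _ = _ := by field_simp
  have h2 : k * |M| ^ (4 * s - 2) * E ≤ k * |M| ^ (4 * s - 2) * |E| := by
    gcongr
    exact le_abs_self E
  have hx : 0 ≤ ‖value ψ 0‖ ^ (4 * s) := by positivity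
  have hβb : β / (σ + 1) = -b := by rw [hb, neg_div, neg_neg]
  rw [hβb] at h
  nlinarith

/-! ### The virial identity -/

lemma hasDerivAt_intervalIntegral_param {E : Type*} [NormedAddCommGroup E] [NormedSpace ℝ E]
    [CompleteSpace E] {F F' : ℝ → ℝ → E} (hF : ∀ x, Continuous (F x))
    (hF' : Continuous (Function.uncurry F')) (hd : ∀ x τ, HasDerivAt (fun x => F x τ) (F' x τ) x)
    (a b x : ℝ) : HasDerivAt (fun x => ∫ τ in a..b, F x τ) (∫ τ in a..b, F' x τ) x := by
  have hc : Continuous fun x => ∫ τ in a..b, F' x τ :=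
    intervalIntegral.continuous_parametric_intervalIntegral_of_continuous' hF' _ _
  have e : (fun x => ∫ τ in a..b, F x τ) =
      fun x => (∫ τ in a..b, F 0 τ) + ∫ r in (0 : ℝ)..x, ∫ τ in a..b, F' r τ := by
    funext x
    rw [intervalIntegral_swap_of_continuous hF', ← intervalIntegral.integral_add
      ((hF 0).intervalIntegrable _ _)]
    · congr 1
      funext τ
      have hc' : Continuous fun r => F' r τ := hF'.comp (by fun_prop : Continuous fun r => (r, τ))
      rw [intervalIntegral.integral_eq_sub_of_hasDerivAt (fun r _ => hd r τ)
        (hc'.intervalIntegrable _ _)]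
      abel
    · refine Continuous.intervalIntegrable ?_ _ _
      exact intervalIntegral.continuous_parametric_intervalIntegral_of_continuous'
        (f := fun τ r => F' r τ) (hF'.comp continuous_swap) _ _
  rw [e]
  exact (intervalIntegral.integral_hasDerivAt_right (hc.intervalIntegrable _ _)
    (hc.stronglyMeasurableAtFilter _ _) hc.continuousAt).const_add _

/-- The derivative of the symbol. -/
def symbDeriv (s ξ : ℝ) : ℝ := deriv (symb s) ξ

lemma contDiff_symb {s : ℝ} (hs : 1 / 2 < s) : ContDiff ℝ 1 (symb s) := by
  have h1 : ContDiff ℝ 1 fun x : ℝ => ‖x‖ ^ (2 * s) := contDiff_norm_rpow (by linarith)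
  have h2 : ContDiff ℝ 1 fun ξ : ℝ => 2 * Real.pi * ξ := by fun_prop
  exact h1.comp h2

lemma continuous_symbDeriv {s : ℝ} (hs : 1 / 2 < s) : Continuous (symbDeriv s) :=
  (contDiff_symb hs).continuous_deriv le_rfl

lemma hasDerivAt_symb {s : ℝ} (hs : 1 / 2 < s) (ξ : ℝ) :
    HasDerivAt (symb s) (symbDeriv s ξ) ξ :=
  ((contDiff_symb hs).differentiable one_ne_zero ξ).hasDerivAt

lemma symbDeriv_eq {s : ℝ} (hs : 1 / 2 < s) (ξ : ℝ) :
    symbDeriv s ξ = 2 * s * |2 * Real.pi * ξ| ^ (2 * s - 2) * (2 * Real.pi * ξ) * (2 * Real.pi) := by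
  have h1 := hasDerivAt_abs_rpow (2 * Real.pi * ξ) (p := 2 * s) (by linarith)
  have h2 : HasDerivAt (fun ξ : ℝ => 2 * Real.pi * ξ) (2 * Real.pi) ξ := by
    simpa using (hasDerivAt_id ξ).const_mul (2 * Real.pi)
  exact (h1.comp ξ h2).deriv

lemma mul_symbDeriv {s : ℝ} (hs : 1 / 2 < s) (ξ : ℝ) : ξ * symbDeriv s ξ = 2 * s * symb s ξ := by
  rw [symbDeriv_eq hs, symb]
  rcases eq_or_ne ξ 0 with rfl | hξ
  · simp [Real.zero_rpow (by linarith : 2 * s ≠ 0)]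
  · have h0 : 0 < |2 * Real.pi * ξ| := abs_pos.2 (by positivity)
    rw [Real.rpow_sub h0, Real.rpow_two, sq_abs]
    have := Real.pi_pos
    field_simp

/-- The weight in the virial identity. -/
def virialWeight (s ξ : ℝ) : ℝ := |ξ| ^ (2 - 2 * s) / (2 * s * (2 * Real.pi) ^ (2 * s))

lemma virialWeight_nonneg {s : ℝ} (hs : 0 ≤ s) (ξ : ℝ) : 0 ≤ virialWeight s ξ := by
  unfold virialWeight
  positivity

lemma continuous_virialWeight {s : ℝ} (hs : s ≤ 1) : Continuous (virialWeight s) := by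
  unfold virialWeight
  exact (continuous_abs.rpow_const fun _ => Or.inr (by linarith)).div_const _

/-- This is what determines the weight: it is `ξ / symb'(ξ)`, so the derivative of the weighted
moment is the dilation functional. The exponent `2 - 2s` is nonnegative for `s ≤ 1`, and the weight
is then continuous at `0`. -/
lemma virialWeight_mul {s : ℝ} (hs : 1 / 2 < s) (ξ : ℝ) :
    virialWeight s ξ * symbDeriv s ξ = ξ := by
  rcases eq_or_ne ξ 0 with rfl | hξ
  · simp [symbDeriv_eq hs]
  · have h1 := mul_symbDeriv hs ξ
    have h2 : symbDeriv s ξ = 2 * s * symb s ξ / ξ := by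
      rw [← h1]
      field_simp
    have h0 : 0 < |ξ| := abs_pos.2 hξ
    have h3 : |ξ| ^ (2 - 2 * s) * |ξ| ^ (2 * s) = ξ ^ 2 := by
      rw [← Real.rpow_add h0, sub_add_cancel, Real.rpow_two, sq_abs]
    have hpi : (0 : ℝ) < 2 * Real.pi := by positivity
    have hpp : (0 : ℝ) < (2 * Real.pi) ^ (2 * s) := by positivity
    have hs0 : s ≠ 0 := by linarith
    rw [h2, virialWeight, symb, abs_mul, abs_of_pos hpi, Real.mul_rpow hpi.le h0.le]
    field_simp
    rw [← h3]
    ring_nf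

section Virial

variable {s : ℝ} {u u' N : ℝ → ℂ}

lemma hasDerivAt_phase_freq (hs : 1 / 2 < s) (t ξ : ℝ) :
    HasDerivAt (fun ξ => phase s t ξ)
      (-Complex.I * (symbDeriv s ξ : ℂ) * (t : ℂ) * phase s t ξ) ξ := by
  have h := ((((hasDerivAt_symb hs ξ).ofReal_comp).const_mul (-Complex.I)).mul_const (t : ℂ)).cexp
  have e : (fun ξ => phase s t ξ) =
      fun ξ => Complex.exp (-Complex.I * (symb s ξ : ℂ) * (t : ℂ)) := by
    funext ξ
    rw [phase]
  rw [e]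
  refine h.congr_deriv ?_
  rw [phase]
  ring

lemma continuous_source (hs : 0 ≤ s) (hN : Continuous N) :
    Continuous fun p : ℝ × ℝ => ∫ τ in (0 : ℝ)..p.1, phase s (-τ) p.2 * N τ := by
  have h : Continuous fun p : ℝ × ℝ => ∫ τ in (0 : ℝ)..p.2, phase s (-τ) p.1 * N τ := by
    refine intervalIntegral.continuous_parametric_primitive_of_continuous (μ := volume)
      (f := fun ξ τ => phase s (-τ) ξ * N τ) ?_
    exact ((continuous_phase hs).comp (f := fun p : ℝ × ℝ => (-p.2, p.1)) (by fun_prop)).mul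
      (by fun_prop)
  exact h.comp continuous_swap

/-- The frequency derivative of `duhamelHat`. -/
def duhamelDeriv (s : ℝ) (u u' N : ℝ → ℂ) (t ξ : ℝ) : ℂ :=
  -Complex.I * (t : ℂ) * (symbDeriv s ξ : ℂ) * duhamelHat s u N t ξ +
    phase s t ξ * (u' ξ + (symbDeriv s ξ : ℂ) *
      ∫ τ in (0 : ℝ)..t, phase s (-τ) ξ * ((τ : ℂ) * N τ))

lemma continuous_duhamelHat (hs : 0 ≤ s) (hu : Continuous u) (hN : Continuous N) :
    Continuous fun p : ℝ × ℝ => duhamelHat s u N p.1 p.2 := by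
  have h1 := continuous_source hs hN
  have h2 := continuous_phase hs
  unfold duhamelHat
  fun_prop

lemma continuous_duhamelDeriv (hs : 1 / 2 < s) (hu : Continuous u) (hu' : Continuous u')
    (hN : Continuous N) : Continuous fun p : ℝ × ℝ => duhamelDeriv s u u' N p.1 p.2 := by
  have hs0 : 0 ≤ s := by linarith
  have h1 := continuous_source hs0 (N := fun τ => (τ : ℂ) * N τ) (by fun_prop)
  have h2 := continuous_phase hs0
  have h3 := continuous_duhamelHat hs0 hu hN
  have h4 := continuous_symbDeriv hs
  unfold duhamelDeriv
  fun_prop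

lemma continuous_duhamelHat_right (hs : 0 ≤ s) (hu : Continuous u) (hN : Continuous N) (t : ℝ) :
    Continuous fun ξ => duhamelHat s u N t ξ := by
  have h := (continuous_duhamelHat hs hu hN).comp (by fun_prop : Continuous fun ξ : ℝ => (t, ξ))
  simp only [Function.comp_def] at h
  exact h

lemma continuous_duhamelDeriv_right (hs : 1 / 2 < s) (hu : Continuous u) (hu' : Continuous u')
    (hN : Continuous N) (t : ℝ) : Continuous fun ξ => duhamelDeriv s u u' N t ξ := by
  have h := (continuous_duhamelDeriv hs hu hu' hN).comp
    (by fun_prop : Continuous fun ξ : ℝ => (t, ξ))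
  simp only [Function.comp_def] at h
  exact h

lemma hasDerivAt_duhamelHat_freq (hs : 1 / 2 < s) (hu : ∀ ξ, HasDerivAt u (u' ξ) ξ)
    (hN : Continuous N) (t ξ : ℝ) :
    HasDerivAt (fun ξ => duhamelHat s u N t ξ) (duhamelDeriv s u u' N t ξ) ξ := by
  have hs0 : 0 ≤ s := by linarith
  have hp := continuous_phase hs0
  have hw := continuous_symbDeriv hs
  have hp' : Continuous fun p : ℝ × ℝ => phase s (-p.2) p.1 :=
    hp.comp (f := fun p : ℝ × ℝ => (-p.2, p.1)) (by fun_prop)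
  have h1 := hasDerivAt_intervalIntegral_param
    (F := fun ξ τ => phase s (-τ) ξ * N τ)
    (F' := fun ξ τ => (-Complex.I * (symbDeriv s ξ : ℂ) * ((-τ : ℝ) : ℂ) * phase s (-τ) ξ) * N τ)
    (fun ξ => (hp'.comp (by fun_prop : Continuous fun τ : ℝ => (ξ, τ))).mul hN)
    (by
      simp only [Function.uncurry_def]
      fun_prop)
    (fun ξ τ => (hasDerivAt_phase_freq hs (-τ) ξ).mul_const (N τ)) 0 t ξ
  have h2 := (hasDerivAt_phase_freq hs t ξ).mul ((hu ξ).sub (h1.const_mul Complex.I))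
  refine h2.congr_deriv ?_
  have e : ∫ τ in (0 : ℝ)..t, (-Complex.I * (symbDeriv s ξ : ℂ) * ((-τ : ℝ) : ℂ) *
      phase s (-τ) ξ) * N τ = Complex.I * (symbDeriv s ξ : ℂ) *
        ∫ τ in (0 : ℝ)..t, phase s (-τ) ξ * ((τ : ℂ) * N τ) := by
    rw [← intervalIntegral.integral_const_mul]
    congr 1
    funext τ
    push_cast
    ring
  rw [e]
  simp only [Pi.sub_apply, duhamelDeriv, duhamelHat]
  linear_combination (-phase s t ξ * (symbDeriv s ξ : ℂ) *
        ∫ τ in (0 : ℝ)..t, phase s (-τ) ξ * ((τ : ℂ) * N τ)) * Complex.I_mul_I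

/-- The frequency derivative of the evolution equation: the source is independent of `ξ` and drops
out, leaving the commutator term `symb' · U`. -/
lemma hasDerivAt_duhamelDeriv (hN : Continuous N) (t ξ : ℝ) :
    HasDerivAt (fun t => duhamelDeriv s u u' N t ξ)
      (-Complex.I * ((symb s ξ : ℂ) * duhamelDeriv s u u' N t ξ +
        (symbDeriv s ξ : ℂ) * duhamelHat s u N t ξ)) t := by
  have hc : Continuous fun τ => phase s (-τ) ξ * ((τ : ℂ) * N τ) :=
    ((continuous_phase_left (s := s) ξ).comp continuous_neg).mul (by fun_prop)
  have h1 := (hasDerivAt_phase s t ξ).mul (((intervalIntegral.integral_hasDerivAt_right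
    (hc.intervalIntegrable 0 t) (hc.stronglyMeasurableAtFilter _ _)
    hc.continuousAt).const_mul (symbDeriv s ξ : ℂ)).const_add (u' ξ))
  have h2 := (((hasDerivAt_id t).ofReal_comp.const_mul (-Complex.I)).mul_const
    (symbDeriv s ξ : ℂ)).mul (hasDerivAt_duhamelHat (s := s) (U := u) hN t ξ)
  refine (h2.add h1).congr_deriv ?_
  have h3 : phase s t ξ * phase s (-t) ξ = 1 := by
    rw [← phase_add, add_neg_cancel, phase_zero]
  simp only [duhamelDeriv, id]
  push_cast
  linear_combination (symbDeriv s ξ : ℂ) * t * N t * h3 +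
    (symbDeriv s ξ : ℂ) * t * N t * Complex.I_mul_I

/-- The weighted second moment of the frequency derivative, on bounded frequencies. -/
def virialV (s : ℝ) (u u' N : ℝ → ℂ) (R t : ℝ) : ℝ :=
  ∫ ξ in (-R)..R, virialWeight s ξ * ‖duhamelDeriv s u u' N t ξ‖ ^ 2

/-- The dilation functional, on bounded frequencies. -/
def virialD (s : ℝ) (u u' N : ℝ → ℂ) (R t : ℝ) : ℝ :=
  ∫ ξ in (-R)..R, ξ * ((starRingEnd ℂ) (duhamelDeriv s u u' N t ξ) * duhamelHat s u N t ξ).im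

/-- Multiplication by the real function `symb` does not change `|∂_ξ U|²`, so only the commutator
term contributes, and the weight turns `symb'` into `ξ`. -/
lemma hasDerivAt_virialV (hs : 1 / 2 < s) (hs1 : s ≤ 1) (hu : Continuous u) (hu' : Continuous u')
    (hN : Continuous N) (R t : ℝ) :
    HasDerivAt (virialV s u u' N R) (2 * virialD s u u' N R t) t := by
  have hs0 : 0 ≤ s := by linarith
  have hw := continuous_virialWeight hs1
  have hU := continuous_duhamelHat hs0 hu hN
  have hY := continuous_duhamelDeriv hs hu hu' hN
  have h := hasDerivAt_intervalIntegral_param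
    (F := fun t ξ => virialWeight s ξ * ‖duhamelDeriv s u u' N t ξ‖ ^ 2)
    (F' := fun t ξ => 2 * (ξ *
      ((starRingEnd ℂ) (duhamelDeriv s u u' N t ξ) * duhamelHat s u N t ξ).im))
    (fun t => by
      have h1 := hY.comp (by fun_prop : Continuous fun ξ : ℝ => (t, ξ))
      simp only [Function.comp_def] at h1
      fun_prop)
    (by
      simp only [Function.uncurry_def]
      have h1 : Continuous fun p : ℝ × ℝ => (starRingEnd ℂ) (duhamelDeriv s u u' N p.1 p.2) :=
        Complex.continuous_conj.comp hY
      have h2 := Complex.continuous_im.comp (h1.mul hU)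
      simp only [Function.comp_def] at h2
      fun_prop)
    (fun t ξ => by
      refine ((hasDerivAt_duhamelDeriv (s := s) (u := u) (u' := u') hN t ξ).norm_sq.const_mul
        (virialWeight s ξ)).congr_deriv ?_
      rw [Complex.inner]
      have h5 := virialWeight_mul hs ξ
      simp only [Complex.mul_re, Complex.mul_im, Complex.conj_re, Complex.conj_im, Complex.add_re,
        Complex.add_im, Complex.neg_re, Complex.neg_im, Complex.I_re, Complex.I_im,
        Complex.ofReal_re, Complex.ofReal_im]
      linear_combination (2 * ((duhamelDeriv s u u' N t ξ).re * (duhamelHat s u N t ξ).im -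
        (duhamelDeriv s u u' N t ξ).im * (duhamelHat s u N t ξ).re)) * h5) (-R) R t
  rw [intervalIntegral.integral_const_mul] at h
  exact h

lemma integral_mul_duhamelDeriv (hs : 1 / 2 < s) (hu : ∀ ξ, HasDerivAt u (u' ξ) ξ)
    (hu' : Continuous u') (hN : Continuous N) (R t : ℝ) :
    ∫ ξ in (-R)..R, (ξ : ℂ) * duhamelDeriv s u u' N t ξ =
      R * (duhamelHat s u N t R + duhamelHat s u N t (-R)) -
        ∫ ξ in (-R)..R, duhamelHat s u N t ξ := by
  have huc : Continuous u := continuous_iff_continuousAt.2 fun ξ => (hu ξ).continuousAt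
  have hY := continuous_duhamelDeriv_right hs huc hu' hN t
  have h1 : ∀ ξ : ℝ, HasDerivAt (fun ξ : ℝ => (ξ : ℂ)) 1 ξ := fun ξ => Complex.ofRealCLM.hasDerivAt
  have h := intervalIntegral.integral_mul_deriv_eq_deriv_mul (a := -R) (b := R)
    (u := fun ξ : ℝ => (ξ : ℂ)) (u' := fun _ => (1 : ℂ)) (v := fun ξ => duhamelHat s u N t ξ)
    (v' := fun ξ => duhamelDeriv s u u' N t ξ)
    (fun ξ _ => h1 ξ) (fun ξ _ => hasDerivAt_duhamelHat_freq hs hu hN t ξ)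
    intervalIntegrable_const (hY.intervalIntegrable _ _)
  rw [h]
  simp only [one_mul]
  push_cast
  ring

/-- The `symb` terms of the two factors cancel, and homogeneity, `ξ symb' = 2s symb`, turns the
commutator term into the form density. -/
lemma hasDerivAt_mul_im (hs : 1 / 2 < s) (hN : Continuous N) (t ξ : ℝ) :
    HasDerivAt (fun t => ξ *
        ((starRingEnd ℂ) (duhamelDeriv s u u' N t ξ) * duhamelHat s u N t ξ).im)
      (2 * s * (symb s ξ * ‖duhamelHat s u N t ξ‖ ^ 2) -
        (N t * (starRingEnd ℂ) ((ξ : ℂ) * duhamelDeriv s u u' N t ξ)).re) t := by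
  have h1 := hasDerivAt_duhamelDeriv (s := s) (u := u) (u' := u') hN t ξ
  have h2 := hasDerivAt_duhamelHat (s := s) (U := u) hN t ξ
  have h4 := (Complex.imCLM.hasFDerivAt.comp_hasDerivAt t (h1.star.mul h2)).const_mul ξ
  refine HasDerivAt.congr_deriv (f := fun t => ξ *
        ((starRingEnd ℂ) (duhamelDeriv s u u' N t ξ) * duhamelHat s u N t ξ).im) h4 ?_
  have h5 := mul_symbDeriv hs ξ
  rw [← Complex.normSq_eq_norm_sq, Complex.normSq_apply]
  generalize duhamelHat s u N t ξ = U
  generalize duhamelDeriv s u u' N t ξ = y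
  simp only [Complex.imCLM_apply, map_mul, RCLike.star_def, Complex.mul_re, Complex.mul_im,
    Complex.conj_re, Complex.conj_im, Complex.add_re,
    Complex.add_im, Complex.neg_re, Complex.neg_im, Complex.I_re, Complex.I_im,
    Complex.ofReal_re, Complex.ofReal_im]
  linear_combination (U.re ^ 2 + U.im ^ 2) * h5

/-- The source contributes the integral of `ξ ∂_ξ U`. Integration by parts turns this into minus the
integral of `U`, the truncated charge, and boundary terms at `±R`. -/
lemma hasDerivAt_virialD (hs : 1 / 2 < s) (hu : ∀ ξ, HasDerivAt u (u' ξ) ξ)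
    (hu' : Continuous u') (hN : Continuous N) (R t : ℝ) :
    HasDerivAt (virialD s u u' N R)
      (2 * s * (∫ ξ in (-R)..R, symb s ξ * ‖duhamelHat s u N t ξ‖ ^ 2) +
        (N t * (starRingEnd ℂ) (∫ ξ in (-R)..R, duhamelHat s u N t ξ)).re -
        (N t * (starRingEnd ℂ) (R * (duhamelHat s u N t R + duhamelHat s u N t (-R)))).re) t := by
  have hs0 : 0 ≤ s := by linarith
  have huc : Continuous u := continuous_iff_continuousAt.2 fun ξ => (hu ξ).continuousAt
  have hU := continuous_duhamelHat hs0 huc hN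
  have hY := continuous_duhamelDeriv hs huc hu' hN
  have hω := continuous_symb hs0
  have hYt := continuous_duhamelDeriv_right hs huc hu' hN t
  have hUt := continuous_duhamelHat_right hs0 huc hN t
  have hYc : Continuous fun p : ℝ × ℝ => (starRingEnd ℂ) (duhamelDeriv s u u' N p.1 p.2) :=
    Complex.continuous_conj.comp hY
  have h := hasDerivAt_intervalIntegral_param
    (F := fun t ξ => ξ * ((starRingEnd ℂ) (duhamelDeriv s u u' N t ξ) * duhamelHat s u N t ξ).im)
    (F' := fun t ξ => 2 * s * (symb s ξ * ‖duhamelHat s u N t ξ‖ ^ 2) -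
      (N t * (starRingEnd ℂ) ((ξ : ℂ) * duhamelDeriv s u u' N t ξ)).re)
    (fun t => by
      have h1 := (Complex.continuous_im.comp (hYc.mul hU)).comp
        (by fun_prop : Continuous fun ξ : ℝ => (t, ξ))
      simp only [Function.comp_def] at h1
      fun_prop)
    (by
      simp only [Function.uncurry_def, map_mul]
      have h1 := Complex.continuous_re.comp ((hN.comp continuous_fst).mul
        ((Complex.continuous_conj.comp (Complex.continuous_ofReal.comp continuous_snd)).mul hYc))
      simp only [Function.comp_def] at h1
      fun_prop)
    (fun t ξ => hasDerivAt_mul_im hs hN t ξ)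
    (-R) R t
  refine h.congr_deriv ?_
  have hi1 : IntervalIntegrable (fun ξ => symb s ξ * ‖duhamelHat s u N t ξ‖ ^ 2) volume (-R) R :=
    Continuous.intervalIntegrable (by fun_prop) _ _
  have hi2 : IntervalIntegrable (fun ξ => N t * (starRingEnd ℂ) ((ξ : ℂ) *
      duhamelDeriv s u u' N t ξ)) volume (-R) R := by
    refine Continuous.intervalIntegrable ?_ _ _
    exact continuous_const.mul (Complex.continuous_conj.comp (by fun_prop))
  have e1 : ∫ ξ in (-R)..R, (N t * (starRingEnd ℂ) ((ξ : ℂ) * duhamelDeriv s u u' N t ξ)).re =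
      (N t * (starRingEnd ℂ) (∫ ξ in (-R)..R, (ξ : ℂ) * duhamelDeriv s u u' N t ξ)).re := by
    have h1 := Complex.reCLM.intervalIntegral_comp_comm hi2
    have h2 : ∫ ξ in (-R)..R, (starRingEnd ℂ) ((ξ : ℂ) * duhamelDeriv s u u' N t ξ) =
        (starRingEnd ℂ) (∫ ξ in (-R)..R, (ξ : ℂ) * duhamelDeriv s u u' N t ξ) := by
      simp only [intervalIntegral, map_sub, integral_conj]
    simp only [Complex.reCLM_apply] at h1
    rw [h1, intervalIntegral.integral_const_mul, h2]
  have hi3 : IntervalIntegrable (fun ξ => (N t * (starRingEnd ℂ) ((ξ : ℂ) *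
      duhamelDeriv s u u' N t ξ)).re) volume (-R) R := ⟨hi2.1.re, hi2.2.re⟩
  rw [intervalIntegral.integral_sub (hi1.const_mul _) hi3, intervalIntegral.integral_const_mul, e1,
    integral_mul_duhamelDeriv hs hu hu' hN]
  simp only [map_sub, mul_sub, Complex.sub_re]
  ring

lemma le_of_second_deriv_le {V D D' : ℝ → ℝ} {c T : ℝ} (hT : 0 ≤ T)
    (hV : ∀ t, HasDerivAt V (2 * D t) t) (hD : ∀ t, HasDerivAt D (D' t) t)
    (h : ∀ t ∈ Set.Icc 0 T, D' t ≤ c) : V T ≤ V 0 + 2 * D 0 * T + c * T ^ 2 := by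
  have h1 : ∀ t ∈ Set.Icc 0 T, D t ≤ D 0 + c * t := by
    have hd : ∀ t, HasDerivAt (fun t => D t - c * t) (D' t - c) t := fun t => by
      exact ((hD t).sub ((hasDerivAt_id t).const_mul c)).congr_deriv (by simp)
    have ha := antitoneOn_of_deriv_nonpos (convex_Icc 0 T)
      (fun t _ => (hd t).continuousAt.continuousWithinAt)
      (fun t _ => (hd t).differentiableAt.differentiableWithinAt) (fun t ht => by
        rw [interior_Icc] at ht
        rw [(hd t).deriv]
        linarith [h t ⟨ht.1.le, ht.2.le⟩])
    intro t ht
    have := ha ⟨le_rfl, hT⟩ ht ht.1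
    simp only [mul_zero, sub_zero] at this
    linarith
  have hd : ∀ t, HasDerivAt (fun t => V t - (2 * D 0 * t + c * t ^ 2))
      (2 * D t - (2 * D 0 + c * (2 * t))) t := fun t => by
    have h2 := ((hasDerivAt_id t).const_mul (2 * D 0)).add ((hasDerivAt_pow 2 t).const_mul c)
    exact ((hV t).sub h2).congr_deriv (by simp)
  have ha := antitoneOn_of_deriv_nonpos (convex_Icc 0 T)
    (fun t _ => (hd t).continuousAt.continuousWithinAt)
    (fun t _ => (hd t).differentiableAt.differentiableWithinAt) (fun t ht => by
      rw [interior_Icc] at ht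
      rw [(hd t).deriv]
      linarith [h1 t ⟨ht.1.le, ht.2.le⟩])
  have := ha ⟨le_rfl, hT⟩ ⟨hT, le_rfl⟩ hT
  simp only [mul_zero] at this
  linarith

end Virial

/-! ### Frequency decay and removal of the cut-off in the virial inequality -/

lemma exists_one_add_sq_mul_norm_le (f : 𝓢(ℝ, ℂ)) :
    ∃ C, 0 ≤ C ∧ ∀ ξ, (1 + ξ ^ 2) * ‖f ξ‖ ≤ C := by
  obtain ⟨A, hA, h0⟩ := f.decay 0 0
  obtain ⟨B, hB, h2⟩ := f.decay 2 0
  refine ⟨A + B, by positivity, fun ξ => ?_⟩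
  have h0 := h0 ξ
  have h2 := h2 ξ
  rw [norm_iteratedFDeriv_zero] at h0 h2
  rw [Real.norm_eq_abs, sq_abs] at h2
  linarith

lemma hasDerivAt_schwartz (f : 𝓢(ℝ, ℂ)) (ξ : ℝ) :
    HasDerivAt f (SchwartzMap.derivCLM ℝ ℂ f ξ) ξ := by
  rw [SchwartzMap.derivCLM_apply]
  exact f.differentiable.differentiableAt.hasDerivAt

lemma tendsto_tail_inv_symb {s : ℝ} (hs : 1 / 2 < s) :
    Tendsto (fun R => greenInt s - ∫ ξ in (-R)..R, (symb s ξ + 1)⁻¹) atTop (𝓝 0) := by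
  have h := intervalIntegral_tendsto_integral (integrable_inv_symb_add hs one_pos)
    tendsto_neg_atTop_atBot tendsto_id
  have h2 := h.const_sub (greenInt s)
  rw [greenInt, sub_self] at h2
  exact h2

/-- Controls the boundary terms at `±R`: a state that is `O((symb + 1)⁻¹)` beats the factor `R`
because `2s > 1`. -/
lemma tendsto_mul_inv_symb {s : ℝ} (hs : 1 / 2 < s) :
    Tendsto (fun R => R * (symb s R + 1)⁻¹) atTop (𝓝 0) := by
  have h := tendsto_rpow_neg_atTop (by linarith : 0 < 2 * s - 1)
  refine squeeze_zero' ?_ ?_ h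
  · filter_upwards [eventually_ge_atTop 0] with R hR
    have := symb_nonneg s R
    positivity
  · filter_upwards [eventually_gt_atTop 0] with R hR
    have h1 : R ^ (2 * s) ≤ symb s R := by
      refine Real.rpow_le_rpow hR.le ?_ (by linarith)
      rw [abs_of_nonneg (by positivity)]
      nlinarith [Real.pi_gt_three]
    have h2 : 0 < R ^ (2 * s) := by positivity
    rw [neg_sub, Real.rpow_sub hR, Real.rpow_one, div_eq_mul_inv]
    gcongr
    linarith

section Bound

variable {s : ℝ} {u u' N : ℝ → ℂ}

lemma symb_mul_norm_sq_le {U : ℂ} {C ξ : ℝ} (h : (symb s ξ + 1) * ‖U‖ ≤ C) :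
    symb s ξ * ‖U‖ ^ 2 ≤ C ^ 2 * (symb s ξ + 1)⁻¹ := by
  have h0 := symb_nonneg s ξ
  have hp : 0 < symb s ξ + 1 := by linarith
  rw [← div_eq_mul_inv, le_div_iff₀ hp]
  calc symb s ξ * ‖U‖ ^ 2 * (symb s ξ + 1) ≤ ((symb s ξ + 1) * ‖U‖) ^ 2 := by
        nlinarith [mul_nonneg hp.le (sq_nonneg ‖U‖)]
    _ ≤ C ^ 2 := by gcongr

lemma norm_le_inv_symb {U : ℂ} {C ξ : ℝ} (h : (symb s ξ + 1) * ‖U‖ ≤ C) :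
    ‖U‖ ≤ C * (symb s ξ + 1)⁻¹ := by
  have h0 := symb_nonneg s ξ
  have hp : 0 < symb s ξ + 1 := by linarith
  rw [← div_eq_mul_inv, le_div_iff₀ hp]
  linarith

lemma norm_integral_tail_le (hs : 1 / 2 < s) {U : ℝ → ℂ} (hU : Continuous U) {C : ℝ}
    (h : ∀ ξ, (symb s ξ + 1) * ‖U ξ‖ ≤ C) {R : ℝ} (hR : 0 ≤ R) :
    ‖(∫ ξ, U ξ) - ∫ ξ in (-R)..R, U ξ‖ ≤
      C * (greenInt s - ∫ ξ in (-R)..R, (symb s ξ + 1)⁻¹) := by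
  have hi := integrable_inv_symb_add hs one_pos
  have hUi : Integrable U := (hi.const_mul C).mono' hU.aestronglyMeasurable
    (Eventually.of_forall fun ξ => norm_le_inv_symb (h ξ))
  rw [intervalIntegral.integral_of_le (by linarith), intervalIntegral.integral_of_le (by linarith),
    greenInt, ← setIntegral_compl measurableSet_Ioc hUi, ← setIntegral_compl measurableSet_Ioc hi,
    ← integral_const_mul]
  exact norm_integral_le_of_norm_le (hi.const_mul C).integrableOn
    (Eventually.of_forall fun ξ => norm_le_inv_symb (h ξ))

lemma symb_neg (s ξ : ℝ) : symb s (-ξ) = symb s ξ := by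
  rw [symb, symb, mul_neg, abs_neg]

/-- The truncated virial inequality, in the limit. -/
lemma virial_nonneg (hs : 1 / 2 < s) (hs1 : s ≤ 1) (hu : ∀ ξ, HasDerivAt u (u' ξ) ξ)
    (hu' : Continuous u') (hN : Continuous N) {T B C c V₀ D₀ : ℝ} (hT : 0 ≤ T)
    (hU : ∀ t ∈ Set.Icc 0 T, ∀ ξ, (symb s ξ + 1) * ‖duhamelHat s u N t ξ‖ ≤ C)
    (hNB : ∀ t ∈ Set.Icc 0 T, ‖N t‖ ≤ B)
    (hc : ∀ t ∈ Set.Icc 0 T, 2 * s * (∫ ξ, symb s ξ * ‖duhamelHat s u N t ξ‖ ^ 2) +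
      (N t * (starRingEnd ℂ) (∫ ξ, duhamelHat s u N t ξ)).re ≤ c)
    (hV : ∀ R, 0 ≤ R → virialV s u u' N R 0 ≤ V₀) (hD : ∀ R, 0 ≤ R → virialD s u u' N R 0 ≤ D₀) :
    0 ≤ V₀ + 2 * D₀ * T + c * T ^ 2 := by
  have hs0 : 0 ≤ s := by linarith
  have huc : Continuous u := continuous_iff_continuousAt.2 fun ξ => (hu ξ).continuousAt
  have hi := integrable_inv_symb_add hs one_pos
  have hω := continuous_symb hs0
  -- The errors, uniform in time: the tail of the charge integral and the boundary terms. Truncating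
  -- the form only decreases it, so it costs nothing.
  set ε : ℝ → ℝ := fun R => B * (C * (greenInt s - ∫ ξ in (-R)..R, (symb s ξ + 1)⁻¹)) +
    B * (2 * C * (R * (symb s R + 1)⁻¹)) with hε
  have hε0 : Tendsto ε atTop (𝓝 0) := by
    have := (((tendsto_tail_inv_symb hs).const_mul C).const_mul B).add
      (((tendsto_mul_inv_symb hs).const_mul (2 * C)).const_mul B)
    simpa using this
  have key : ∀ R, 0 ≤ R → 0 ≤ V₀ + 2 * D₀ * T + (c + ε R) * T ^ 2 := by
    intro R hR
    have hbd : ∀ t ∈ Set.Icc 0 T,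
        2 * s * (∫ ξ in (-R)..R, symb s ξ * ‖duhamelHat s u N t ξ‖ ^ 2) +
        (N t * (starRingEnd ℂ) (∫ ξ in (-R)..R, duhamelHat s u N t ξ)).re -
        (N t * (starRingEnd ℂ) (R * (duhamelHat s u N t R + duhamelHat s u N t (-R)))).re ≤
          c + ε R := by
      intro t ht
      have hUt := continuous_duhamelHat_right hs0 huc hN t
      have hB0 : 0 ≤ B := (norm_nonneg _).trans (hNB t ht)
      have h1 : ∫ ξ in (-R)..R, symb s ξ * ‖duhamelHat s u N t ξ‖ ^ 2 ≤
          ∫ ξ, symb s ξ * ‖duhamelHat s u N t ξ‖ ^ 2 := by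
        rw [intervalIntegral.integral_of_le (by linarith)]
        refine setIntegral_le_integral ?_ (Eventually.of_forall fun ξ =>
          mul_nonneg (symb_nonneg s ξ) (sq_nonneg _))
        refine (hi.const_mul (C ^ 2)).mono' (by fun_prop) (Eventually.of_forall fun ξ => ?_)
        rw [Real.norm_of_nonneg (mul_nonneg (symb_nonneg s ξ) (sq_nonneg _))]
        exact symb_mul_norm_sq_le (hU t ht ξ)
      have h2 : (N t * (starRingEnd ℂ) (∫ ξ in (-R)..R, duhamelHat s u N t ξ)).re ≤
          (N t * (starRingEnd ℂ) (∫ ξ, duhamelHat s u N t ξ)).re +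
            B * (C * (greenInt s - ∫ ξ in (-R)..R, (symb s ξ + 1)⁻¹)) := by
        have h3 := Complex.re_le_norm (N t * (starRingEnd ℂ) (-((∫ ξ, duhamelHat s u N t ξ) -
          ∫ ξ in (-R)..R, duhamelHat s u N t ξ)))
        have h4 := mul_le_mul (hNB t ht) (norm_integral_tail_le hs hUt (hU t ht) hR)
          (norm_nonneg _) hB0
        rw [norm_mul, RCLike.norm_conj, norm_neg] at h3
        simp only [map_neg, map_sub, mul_neg, mul_sub, Complex.neg_re, Complex.sub_re] at h3
        linarith
      have h3 : -(N t * (starRingEnd ℂ) (R * (duhamelHat s u N t R +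
          duhamelHat s u N t (-R)))).re ≤ B * (2 * C * (R * (symb s R + 1)⁻¹)) := by
        have h4 := (neg_le_abs _).trans (Complex.abs_re_le_norm
          (N t * (starRingEnd ℂ) (R * (duhamelHat s u N t R + duhamelHat s u N t (-R)))))
        refine h4.trans ?_
        rw [norm_mul, RCLike.norm_conj, norm_mul, Complex.norm_real, Real.norm_of_nonneg hR]
        have h5 := norm_le_inv_symb (hU t ht R)
        have h6 := norm_le_inv_symb (hU t ht (-R))
        rw [symb_neg] at h6
        refine mul_le_mul (hNB t ht) ?_ (by positivity) hB0
        have h7 := norm_add_le (duhamelHat s u N t R) (duhamelHat s u N t (-R))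
        have := mul_le_mul_of_nonneg_left (h7.trans (add_le_add h5 h6)) hR
        linarith
      have h4 := mul_le_mul_of_nonneg_left h1 (by linarith : 0 ≤ 2 * s)
      have := hc t ht
      simp only [hε]
      linarith
    have h1 := le_of_second_deriv_le hT (fun t => hasDerivAt_virialV hs hs1 huc hu' hN R t)
      (fun t => hasDerivAt_virialD hs hu hu' hN R t) hbd
    have h2 : 0 ≤ virialV s u u' N R T := by
      refine intervalIntegral.integral_nonneg (by linarith) fun ξ _ => ?_
      exact mul_nonneg (virialWeight_nonneg hs0 ξ) (sq_nonneg _)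
    have h3 := mul_le_mul_of_nonneg_right (hD R hR) hT
    have h4 := hV R hR
    linarith
  have hlim : Tendsto (fun R => V₀ + 2 * D₀ * T + (c + ε R) * T ^ 2) atTop
      (𝓝 (V₀ + 2 * D₀ * T + (c + 0) * T ^ 2)) :=
    ((hε0.const_add c).mul_const _).const_add _
  rw [add_zero] at hlim
  exact ge_of_tendsto hlim ((eventually_ge_atTop 0).mono key)

/-- Pointwise decay of the state, uniform in time. The integrated-by-parts formula bounds `symb ·
U`, and here `N'` is needed only in `L¹`. -/
lemma exists_duhamelHat_bound {n : ℝ → ℂ} {z : ℂ} (hn : Integrable n) {C₀ : ℝ}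
    (hu : ∀ ξ, (symb s ξ + 1) * ‖u ξ‖ ≤ C₀) (T : ℝ) :
    ∃ C, ∀ t ∈ Set.Icc 0 T, ∀ ξ,
      (symb s ξ + 1) * ‖duhamelHat s u (fun τ => z + ∫ r in (0 : ℝ)..τ, n r) t ξ‖ ≤ C := by
  set M := ∫ τ, ‖n τ‖ with hM
  have hMi : ∀ t, 0 ≤ t → ∫ τ in (0 : ℝ)..t, ‖n τ‖ ≤ M := fun t ht => by
    rw [intervalIntegral.integral_of_le ht]
    exact setIntegral_le_integral hn.norm (Eventually.of_forall fun _ => norm_nonneg _)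
  have hM0 : 0 ≤ M := integral_nonneg fun _ => norm_nonneg _
  have hN : ∀ t, 0 ≤ t → ‖z + ∫ r in (0 : ℝ)..t, n r‖ ≤ ‖z‖ + M := fun t ht =>
    (norm_add_le _ _).trans (by
      gcongr
      exact (intervalIntegral.norm_integral_le_integral_norm ht).trans (hMi t ht))
  refine ⟨(C₀ + ‖z‖ + M + (‖z‖ + M)) + (C₀ + T * (‖z‖ + M)), fun t ht ξ => ?_⟩
  set U := duhamelHat s u (fun τ => z + ∫ r in (0 : ℝ)..τ, n r) t ξ with hUdef
  have h0 := symb_nonneg s ξ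
  have hu1 : symb s ξ * ‖u ξ‖ ≤ C₀ := by
    have := hu ξ
    nlinarith [norm_nonneg (u ξ)]
  have hu2 : ‖u ξ‖ ≤ C₀ := by
    have := hu ξ
    nlinarith [norm_nonneg (u ξ), mul_nonneg h0 (norm_nonneg (u ξ))]
  have h1 : symb s ξ * ‖U‖ ≤ C₀ + ‖z‖ + M + (‖z‖ + M) := by
    have e := eq_sub_of_add_eq (symb_mul_duhamelHat_add (s := s) (U := u) (z := z) hn ht.1 ξ)
    have h2 : ‖∫ τ in (0 : ℝ)..t, phase s (-τ) ξ * n τ‖ ≤ M := by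
      refine (intervalIntegral.norm_integral_le_integral_norm ht.1).trans ?_
      simp only [norm_mul, norm_phase, one_mul]
      exact hMi t ht.1
    have h3 : symb s ξ * ‖U‖ = ‖(symb s ξ : ℂ) * U‖ := by
      rw [norm_mul, Complex.norm_real, Real.norm_of_nonneg h0]
    rw [h3, hUdef, e]
    refine (norm_sub_le _ _).trans (add_le_add ?_ (hN t ht.1))
    rw [norm_mul, norm_phase, one_mul]
    refine (norm_add_le _ _).trans (add_le_add ((norm_add_le _ _).trans (add_le_add ?_ le_rfl)) h2)
    rwa [norm_mul, Complex.norm_real, Real.norm_of_nonneg h0]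
  have h2 : ‖U‖ ≤ C₀ + T * (‖z‖ + M) := by
    rw [hUdef, duhamelHat, norm_mul, norm_phase, one_mul]
    refine (norm_sub_le _ _).trans (add_le_add hu2 ?_)
    rw [norm_mul, Complex.norm_I, one_mul]
    have h3 := intervalIntegral.norm_integral_le_of_norm_le_const (a := 0) (b := t)
      (f := fun τ => phase s (-τ) ξ * (z + ∫ r in (0 : ℝ)..τ, n r)) (C := ‖z‖ + M) (fun τ hτ => by
        rw [Set.uIoc_of_le ht.1] at hτ
        rw [norm_mul, norm_phase, one_mul]
        exact hN τ hτ.1.le)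
    refine h3.trans ?_
    rw [sub_zero, abs_of_nonneg ht.1, mul_comm]
    exact mul_le_mul_of_nonneg_right ht.2 (by positivity)
  rw [add_mul, one_mul]
  exact add_le_add h1 h2

lemma virialV_zero_le (hs : 1 / 2 < s) (hu : Continuous u') (hs1 : s ≤ 1) {C : ℝ}
    (h : ∀ ξ, (symb s ξ + 1) * (virialWeight s ξ * ‖u' ξ‖ ^ 2) ≤ C) {R : ℝ} (hR : 0 ≤ R) :
    virialV s u u' N R 0 ≤ C * greenInt s := by
  have hi := integrable_inv_symb_add hs one_pos
  have hs0 : 0 ≤ s := by linarith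
  have e : ∀ ξ, duhamelDeriv s u u' N 0 ξ = u' ξ := fun ξ => by
    simp [duhamelDeriv, phase]
  have hle : ∀ ξ, virialWeight s ξ * ‖u' ξ‖ ^ 2 ≤ C * (symb s ξ + 1)⁻¹ := fun ξ => by
    have h0 := symb_nonneg s ξ
    rw [← div_eq_mul_inv, le_div_iff₀ (by linarith)]
    linarith [h ξ]
  have hw := continuous_virialWeight hs1
  simp only [virialV, e]
  rw [intervalIntegral.integral_of_le (by linarith), greenInt, ← integral_const_mul]
  have hm : Integrable fun ξ => virialWeight s ξ * ‖u' ξ‖ ^ 2 :=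
    (hi.const_mul C).mono' (by fun_prop) (Eventually.of_forall fun ξ => by
      rw [Real.norm_of_nonneg (mul_nonneg (virialWeight_nonneg hs0 ξ) (sq_nonneg _))]
      exact hle ξ)
  exact (setIntegral_le_integral hm (Eventually.of_forall fun ξ =>
    mul_nonneg (virialWeight_nonneg hs0 ξ) (sq_nonneg _))).trans
      (integral_mono hm (hi.const_mul C) hle)

lemma virialD_zero_le (hs : 1 / 2 < s) {C₀ C₁ : ℝ}
    (h : ∀ ξ, (symb s ξ + 1) * ‖u ξ‖ ≤ C₀) (h' : ∀ ξ, |ξ| * ‖u' ξ‖ ≤ C₁) {R : ℝ} (hR : 0 ≤ R) :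
    virialD s u u' N R 0 ≤ C₁ * C₀ * greenInt s := by
  have hi := integrable_inv_symb_add hs one_pos
  have e : ∀ ξ, duhamelDeriv s u u' N 0 ξ = u' ξ := fun ξ => by
    simp [duhamelDeriv, phase]
  have e' : ∀ ξ, duhamelHat s u N 0 ξ = u ξ := fun ξ => by
    simp [duhamelHat, phase]
  have hC₁ : 0 ≤ C₁ := (by positivity : 0 ≤ |(0 : ℝ)| * ‖u' 0‖).trans (h' 0)
  have hle : ∀ ξ, ‖ξ * ((starRingEnd ℂ) (u' ξ) * u ξ).im‖ ≤ C₁ * C₀ * (symb s ξ + 1)⁻¹ :=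
    fun ξ => by
      have h1 := Complex.abs_im_le_norm ((starRingEnd ℂ) (u' ξ) * u ξ)
      rw [norm_mul, RCLike.norm_conj] at h1
      rw [norm_mul, Real.norm_eq_abs, Real.norm_eq_abs]
      calc _ ≤ |ξ| * (‖u' ξ‖ * ‖u ξ‖) := by gcongr
        _ = (|ξ| * ‖u' ξ‖) * ‖u ξ‖ := by ring
        _ ≤ C₁ * (C₀ * (symb s ξ + 1)⁻¹) :=
          mul_le_mul (h' ξ) (norm_le_inv_symb (h ξ)) (norm_nonneg _) hC₁
        _ = _ := by ring
  simp only [virialD, e, e']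
  rw [intervalIntegral.integral_of_le (by linarith), greenInt, ← integral_const_mul]
  refine (Real.le_norm_self _).trans ((norm_integral_le_of_norm_le (hi.const_mul _).integrableOn
    (Eventually.of_forall hle)).trans ?_)
  refine setIntegral_le_integral (hi.const_mul _) (Eventually.of_forall fun ξ => ?_)
  exact (norm_nonneg _).trans (hle ξ)

end Bound

/-- With `∫ U = q`, the second virial derivative is `2s ∫ symb |U|² + β |q|^{2σ+2}`. By energy
conservation it is at most `2s E`, and this is the quadratic coefficient. -/
lemma IsChargeSolution.virial {s σ β T : ℝ} (hs : 1 / 2 < s) (hs1 : s ≤ 1) (hσ : 0 < σ)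
    (hβ : β < 0) (hσs : 2 * s - 1 ≤ σ) (hT : 0 < T) {ψ₀ : L2} (hψ : ψ₀ ∈ domain s σ β) {q : ℝ → ℂ}
    (hq : IsChargeSolution s σ β T ψ₀ q) {u u' : ℝ → ℂ} (hF : (𝓕 ψ₀ : L2) =ᵐ[volume] u)
    (hu : ∀ ξ, HasDerivAt u (u' ξ) ξ) (hu' : Continuous u') {C₀ C₁ C₂ : ℝ}
    (h₀ : ∀ ξ, (symb s ξ + 1) * ‖u ξ‖ ≤ C₀) (h₁ : ∀ ξ, |ξ| * ‖u' ξ‖ ≤ C₁)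
    (h₂ : ∀ ξ, (symb s ξ + 1) * (virialWeight s ξ * ‖u' ξ‖ ^ 2) ≤ C₂) :
    0 ≤ C₂ * greenInt s + 2 * (C₁ * C₀ * greenInt s) * T + 2 * s * energy s σ β ψ₀ * T ^ 2 := by
  obtain ⟨n, hn2, hn0, hn⟩ := hq.exists_density hs hσ hT.le hψ
  have hni := integrable_of_memLp_of_support hn2 hn0
  obtain ⟨M, H, hp⟩ := hq.exists_pair hs hσ hT.le hψ
  have hwp := hq.wellPosedOn hs hσ hT hψ
  set N : ℝ → ℂ := fun τ => nonlin σ β (q 0) + ∫ r in (0 : ℝ)..τ, n r with hNdef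
  have hN : Continuous N :=
    (intervalIntegral.continuous_primitive (fun a b => hni.intervalIntegrable) 0).const_add _
  have hNq : ∀ t ∈ Set.Icc 0 T, N t = nonlin σ β (q t) := fun t ht => (hn t ht).symm
  have hstate : ∀ t ∈ Set.Icc 0 T,
      (𝓕 (duhamelState s σ β ψ₀ q t) : L2) =ᵐ[volume] duhamelHat s u N t := by
    intro t ht
    filter_upwards [hp.fourier_state t ht, hF] with ξ h1 h2
    rw [h1, duhamelHat_congr (N' := N) ht.1 (fun τ hτ => ?_), duhamelHat, duhamelHat, h2]
    rw [hNq τ ⟨hτ.1, hτ.2.trans ht.2⟩, hp.charge_eq τ ⟨hτ.1, hτ.2.trans ht.2⟩]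
  obtain ⟨C, hC⟩ := exists_duhamelHat_bound (z := nonlin σ β (q 0)) hni h₀ T
  obtain ⟨B, hB⟩ := isCompact_Icc.exists_bound_of_continuousOn (hN.continuousOn (s := Set.Icc 0 T))
  refine virial_nonneg hs hs1 hu hu' hN hT.le hC hB (fun t ht => ?_)
    (fun R hR => virialV_zero_le hs hu' hs1 h₂ hR) (fun R hR => virialD_zero_le hs h₀ h₁ hR)
  have e1 : ∫ ξ, duhamelHat s u N t ξ = q t := by
    rw [← integral_congr_ae (hstate t ht)]
    exact hp.integral_eq t ht
  have e2 := (hwp.strong.conservation hs hσ ht).2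
  have e3 : ∫ ξ, symb s ξ * ‖duhamelHat s u N t ξ‖ ^ 2 =
      ∫ ξ, symb s ξ * ‖(𝓕 (duhamelState s σ β ψ₀ q t) : L2) ξ‖ ^ 2 := by
    refine integral_congr_ae ?_
    filter_upwards [hstate t ht] with ξ h
    rw [h]
  rw [energy, ← e3, hwp.value_eq t ht] at e2
  rw [e1, hNq t ht, nonlin_mul_conj, Complex.ofReal_re, ← e2]
  have e4 : ‖q t‖ ^ (2 * σ + 2) = ‖q t‖ ^ (2 * σ) * ‖q t‖ ^ 2 := by
    rw [Real.rpow_add_of_nonneg (norm_nonneg _) (by linarith) two_pos.le, Real.rpow_two]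
  rw [e4]
  have e5 : 0 ≤ ‖q t‖ ^ (2 * σ) * ‖q t‖ ^ 2 := by positivity
  -- The only use of `σ + 1 ≥ 2s`; the sign of `β` reverses the inequality.
  have e6 : β ≤ 2 * s * (β / (σ + 1)) := by
    rw [← mul_div_assoc, le_div_iff₀ (by linarith)]
    nlinarith
  have := mul_le_mul_of_nonneg_right e6 e5
  linarith

/-! ### Finite virial moments for data with Schwartz regular part -/

lemma one_le_mul_symb_add {s lam : ℝ} (hlam : 0 < lam) (ξ : ℝ) :
    symb s ξ + 1 ≤ (1 + lam⁻¹) * (symb s ξ + lam) := by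
  have h0 := symb_nonneg s ξ
  have h1 : lam⁻¹ * lam = 1 := inv_mul_cancel₀ hlam.ne'
  have h2 : 0 < lam⁻¹ := inv_pos.2 hlam
  nlinarith [mul_nonneg h2.le h0]

lemma exists_symb_add_one_le {s : ℝ} (hs : 0 ≤ s) (hs1 : s ≤ 1) :
    ∃ K, 0 ≤ K ∧ ∀ ξ, symb s ξ + 1 ≤ K * (1 + ξ ^ 2) := by
  refine ⟨((2 * Real.pi) ^ 2) ^ s + 1, by positivity, fun ξ => ?_⟩
  have h1 := symb_le hs ξ
  have h2 : (1 + ‖ξ‖ ^ 2) ^ s ≤ 1 + ξ ^ 2 := by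
    rw [Real.norm_eq_abs, sq_abs]
    exact Real.rpow_le_self_of_one_le (by nlinarith [sq_nonneg ξ]) hs1
  have h3 : (0 : ℝ) ≤ ((2 * Real.pi) ^ 2) ^ s := by positivity
  nlinarith [mul_le_mul_of_nonneg_left h2 h3, sq_nonneg ξ]

lemma exists_virialWeight_le {s : ℝ} (hs : 0 ≤ s) (hs1 : s ≤ 1) :
    ∃ K, 0 ≤ K ∧ ∀ ξ, virialWeight s ξ ≤ K * (1 + ξ ^ 2) := by
  refine ⟨(2 * s * (2 * Real.pi) ^ (2 * s))⁻¹, by positivity, fun ξ => ?_⟩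
  rw [virialWeight, div_eq_mul_inv, mul_comm]
  gcongr
  rcases le_total |ξ| 1 with h | h
  · exact (Real.rpow_le_one (abs_nonneg _) h (by linarith)).trans (by nlinarith [sq_nonneg ξ])
  · calc |ξ| ^ (2 - 2 * s) ≤ |ξ| ^ (2 : ℝ) := Real.rpow_le_rpow_of_exponent_le h (by linarith)
      _ ≤ 1 + ξ ^ 2 := by
        rw [Real.rpow_two, sq_abs]
        linarith

/-- The Fourier transform of a state with regular part in the Schwartz class. -/
def regularHat (s lam : ℝ) (f : 𝓢(ℝ, ℂ)) (z : ℂ) (ξ : ℝ) : ℂ := f ξ - z * greenHat s lam ξ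

/-- The derivative of `regularHat`. -/
def regularHatDeriv (s lam : ℝ) (f : 𝓢(ℝ, ℂ)) (z : ℂ) (ξ : ℝ) : ℂ :=
  SchwartzMap.derivCLM ℝ ℂ f ξ + z * ((symbDeriv s ξ / (symb s ξ + lam) ^ 2 : ℝ) : ℂ)

section RegularHat

variable {s lam : ℝ} (hs : 1 / 2 < s) (hlam : 0 < lam) (f : 𝓢(ℝ, ℂ)) (z : ℂ)
include hs hlam

lemma hasDerivAt_regularHat (ξ : ℝ) :
    HasDerivAt (regularHat s lam f z) (regularHatDeriv s lam f z ξ) ξ := by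
  have h0 := symb_nonneg s ξ
  have h1 := (((hasDerivAt_symb hs ξ).add_const lam).inv
    (by linarith : symb s ξ + lam ≠ 0)).ofReal_comp.const_mul z
  refine ((hasDerivAt_schwartz f ξ).sub h1).congr_deriv ?_
  rw [regularHatDeriv]
  push_cast
  ring

lemma continuous_regularHatDeriv : Continuous (regularHatDeriv s lam f z) := by
  have h1 := continuous_symbDeriv hs
  have h2 := continuous_symb (by linarith : 0 ≤ s)
  have h3 : ∀ ξ, (symb s ξ + lam) ^ 2 ≠ 0 := fun ξ => by
    have := symb_nonneg s ξ
    positivity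
  have h4 : Continuous fun ξ => symbDeriv s ξ / (symb s ξ + lam) ^ 2 :=
    h1.div (by fun_prop) h3
  have h5 := (SchwartzMap.derivCLM ℝ ℂ f).continuous
  unfold regularHatDeriv
  fun_prop

lemma exists_regularHat_le (hs1 : s ≤ 1) :
    ∃ C, ∀ ξ, (symb s ξ + 1) * ‖regularHat s lam f z ξ‖ ≤ C := by
  obtain ⟨A, hA, hf⟩ := exists_one_add_sq_mul_norm_le f
  obtain ⟨K, hK, hω⟩ := exists_symb_add_one_le (by linarith : 0 ≤ s) hs1
  refine ⟨K * A + ‖z‖ * (1 + lam⁻¹), fun ξ => ?_⟩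
  have h0 := symb_nonneg s ξ
  have hp : 0 < symb s ξ + lam := by linarith
  have h1 : (symb s ξ + 1) * ‖f ξ‖ ≤ K * A :=
    calc _ ≤ K * (1 + ξ ^ 2) * ‖f ξ‖ := by
          gcongr
          exact hω ξ
      _ = K * ((1 + ξ ^ 2) * ‖f ξ‖) := by ring
      _ ≤ K * A := by
        gcongr
        exact hf ξ
  have h2 : (symb s ξ + 1) * ‖z * greenHat s lam ξ‖ ≤ ‖z‖ * (1 + lam⁻¹) := by
    have h3 : (symb s ξ + 1) * (symb s ξ + lam)⁻¹ ≤ 1 + lam⁻¹ := by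
      rw [← div_eq_mul_inv, div_le_iff₀ hp]
      exact one_le_mul_symb_add hlam ξ
    rw [norm_mul, greenHat, Complex.norm_real, Real.norm_of_nonneg (inv_nonneg.2 hp.le)]
    have := mul_le_mul_of_nonneg_left h3 (norm_nonneg z)
    linarith
  have h3 := mul_le_mul_of_nonneg_left (norm_sub_le (f ξ) (z * greenHat s lam ξ))
    (by linarith : 0 ≤ symb s ξ + 1)
  rw [regularHat]
  linarith

lemma exists_regularHatDeriv_le :
    ∃ C, ∀ ξ, |ξ| * ‖regularHatDeriv s lam f z ξ‖ ≤ C := by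
  obtain ⟨A, hA, hf⟩ := exists_one_add_sq_mul_norm_le (SchwartzMap.derivCLM ℝ ℂ f)
  refine ⟨A + ‖z‖ * (2 * s * lam⁻¹), fun ξ => ?_⟩
  have h0 := symb_nonneg s ξ
  have hp : 0 < symb s ξ + lam := by linarith
  have h1 : |ξ| * ‖SchwartzMap.derivCLM ℝ ℂ f ξ‖ ≤ A := by
    refine le_trans (mul_le_mul_of_nonneg_right ?_ (norm_nonneg _)) (hf ξ)
    rw [← sq_abs]
    nlinarith [sq_nonneg (|ξ| - 1), abs_nonneg ξ]
  have h2 : |ξ| * |symbDeriv s ξ / (symb s ξ + lam) ^ 2| ≤ 2 * s * lam⁻¹ := by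
    rw [← abs_mul, ← mul_div_assoc, mul_symbDeriv hs, abs_of_nonneg (by positivity),
      ← div_eq_mul_inv, div_le_div_iff₀ (by positivity) hlam]
    have h3 : symb s ξ * lam ≤ (symb s ξ + lam) ^ 2 := by nlinarith
    have := mul_le_mul_of_nonneg_left h3 (by linarith : 0 ≤ 2 * s)
    linarith
  have h3 := mul_le_mul_of_nonneg_left (norm_add_le (SchwartzMap.derivCLM ℝ ℂ f ξ)
    (z * ((symbDeriv s ξ / (symb s ξ + lam) ^ 2 : ℝ) : ℂ))) (abs_nonneg ξ)
  rw [norm_mul, Complex.norm_real, Real.norm_eq_abs] at h3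
  have h4 := mul_le_mul_of_nonneg_left h2 (norm_nonneg z)
  rw [regularHatDeriv]
  linarith

/-- The Schwartz part beats all polynomial weights. For the Green's function the derivative is
`symb'/(symb + lam)²` up to sign, and `w · (symb')² = 2s symb`, so the product reduces to a multiple
of `(symb + 1) symb / (symb + lam)⁴`, which is bounded. -/
lemma exists_virialWeight_regularHatDeriv_le (hs1 : s ≤ 1) :
    ∃ C, ∀ ξ, (symb s ξ + 1) * (virialWeight s ξ * ‖regularHatDeriv s lam f z ξ‖ ^ 2) ≤ C := by
  have hs0 : 0 ≤ s := by linarith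
  obtain ⟨A, hA, hf⟩ := exists_one_add_sq_mul_norm_le (SchwartzMap.derivCLM ℝ ℂ f)
  obtain ⟨K, hK, hω⟩ := exists_symb_add_one_le hs0 hs1
  obtain ⟨L, hL, hw⟩ := exists_virialWeight_le hs0 hs1
  refine ⟨2 * (K * L * A ^ 2) + 2 * (‖z‖ ^ 2 * ((1 + lam⁻¹) * (2 * s) * (lam⁻¹) ^ 2)),
    fun ξ => ?_⟩
  have h0 := symb_nonneg s ξ
  have hw0 := virialWeight_nonneg hs0 ξ
  have hp : 0 < symb s ξ + lam := by linarith
  have h1 : (symb s ξ + 1) * (virialWeight s ξ * ‖SchwartzMap.derivCLM ℝ ℂ f ξ‖ ^ 2) ≤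
      K * L * A ^ 2 :=
    calc _ ≤ K * (1 + ξ ^ 2) * (L * (1 + ξ ^ 2) * ‖SchwartzMap.derivCLM ℝ ℂ f ξ‖ ^ 2) := by
          gcongr
          · exact hω ξ
          · exact hw ξ
      _ = K * L * ((1 + ξ ^ 2) * ‖SchwartzMap.derivCLM ℝ ℂ f ξ‖) ^ 2 := by ring
      _ ≤ K * L * A ^ 2 := by
        gcongr
        exact hf ξ
  have h2 : (symb s ξ + 1) * (virialWeight s ξ * (symbDeriv s ξ / (symb s ξ + lam) ^ 2) ^ 2) ≤
      (1 + lam⁻¹) * (2 * s) * (lam⁻¹) ^ 2 := by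
    have e : virialWeight s ξ * symbDeriv s ξ ^ 2 = 2 * s * symb s ξ := by
      rw [← mul_symbDeriv hs ξ, sq, ← mul_assoc, virialWeight_mul hs]
    have e1 : (symb s ξ + lam)⁻¹ ≤ lam⁻¹ := inv_anti₀ hlam (by linarith)
    have e2 : symb s ξ * (symb s ξ + lam)⁻¹ ≤ 1 := by
      rw [← div_eq_mul_inv, div_le_one hp]
      linarith
    calc _ = (symb s ξ + 1) * (virialWeight s ξ * symbDeriv s ξ ^ 2) *
            ((symb s ξ + lam)⁻¹) ^ 4 := by
          rw [div_pow, ← pow_mul, div_eq_mul_inv, inv_pow]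
          ring
      _ ≤ (1 + lam⁻¹) * (symb s ξ + lam) * (2 * s * symb s ξ) * ((symb s ξ + lam)⁻¹) ^ 4 := by
          rw [e]
          gcongr
          exact one_le_mul_symb_add hlam ξ
      _ = (1 + lam⁻¹) * (2 * s) * (symb s ξ * (symb s ξ + lam)⁻¹) *
            ((symb s ξ + lam)⁻¹) ^ 2 := by
          field_simp
      _ ≤ (1 + lam⁻¹) * (2 * s) * 1 * (lam⁻¹) ^ 2 := by gcongr
      _ = _ := by ring
  have h3 : ‖regularHatDeriv s lam f z ξ‖ ^ 2 ≤ 2 * ‖SchwartzMap.derivCLM ℝ ℂ f ξ‖ ^ 2 +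
      2 * (‖z‖ ^ 2 * (symbDeriv s ξ / (symb s ξ + lam) ^ 2) ^ 2) := by
    have h4 := norm_add_le (SchwartzMap.derivCLM ℝ ℂ f ξ)
      (z * ((symbDeriv s ξ / (symb s ξ + lam) ^ 2 : ℝ) : ℂ))
    rw [norm_mul, Complex.norm_real, Real.norm_eq_abs] at h4
    rw [← sq_abs (symbDeriv s ξ / (symb s ξ + lam) ^ 2), ← mul_pow, regularHatDeriv]
    exact (pow_le_pow_left₀ (norm_nonneg _) h4 2).trans (by
      nlinarith [sq_nonneg (‖SchwartzMap.derivCLM ℝ ℂ f ξ‖ -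
        ‖z‖ * |symbDeriv s ξ / (symb s ξ + lam) ^ 2|)])
  have h4 := mul_le_mul_of_nonneg_left (mul_le_mul_of_nonneg_left h3 hw0)
    (by linarith : 0 ≤ symb s ξ + 1)
  have h5 := mul_le_mul_of_nonneg_left h2 (sq_nonneg ‖z‖)
  linarith

end RegularHat

lemma fourier_eq_regularHat {s σ β lam : ℝ} (hs : 1 / 2 < s) (hlam : 0 < lam) {ψ : L2}
    {g : 𝓢(ℝ, ℂ)} (h : regularPart s σ β lam ψ = g.toLp 2 volume) :
    (𝓕 ψ : L2) =ᵐ[volume] regularHat s lam (𝓕 g) (nonlin σ β (value ψ 0)) := by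
  have h1 := fourier_regularPart (σ := σ) (β := β) hs hlam ψ
  rw [h, SchwartzMap.toLp_fourier_eq] at h1
  filter_upwards [h1, (𝓕 g : 𝓢(ℝ, ℂ)).coeFn_toLp 2 volume] with ξ h2 h3
  rw [regularHat, ← h3, h2]
  ring

/-- The virial inequality says that a quadratic in `T` with negative leading coefficient is
nonnegative at every existence time. For `T ≥ 1` the constant term is at most `|V| T`, and dividing
by `T` gives the explicit bound. -/
lemma exists_time_bound {s σ β : ℝ} (hs : 1 / 2 < s) (hs1 : s ≤ 1) (hσ : 0 < σ) (hβ : β < 0)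
    (hσs : 2 * s - 1 ≤ σ) {ψ₀ : L2} (hψ : ψ₀ ∈ domain s σ β) {lam : ℝ} (hlam : 0 < lam)
    {g : 𝓢(ℝ, ℂ)} (hg : regularPart s σ β lam ψ₀ = g.toLp 2 volume)
    (hE : energy s σ β ψ₀ < 0) :
    ∃ T₁, ∀ T, 0 < T → ∀ q, IsChargeSolution s σ β T ψ₀ q → T ≤ T₁ := by
  set z := nonlin σ β (value ψ₀ 0)
  obtain ⟨C₀, h₀⟩ := exists_regularHat_le hs hlam (𝓕 g) z hs1
  obtain ⟨C₁, h₁⟩ := exists_regularHatDeriv_le hs hlam (𝓕 g) z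
  obtain ⟨C₂, h₂⟩ := exists_virialWeight_regularHatDeriv_le hs hlam (𝓕 g) z hs1
  set V := C₂ * greenInt s
  set D := C₁ * C₀ * greenInt s
  have ha : 0 < -(2 * s * energy s σ β ψ₀) := by nlinarith
  refine ⟨max 1 ((|V| + 2 * |D|) / -(2 * s * energy s σ β ψ₀)), fun T hT q hq => ?_⟩
  have h := hq.virial hs hs1 hσ hβ hσs hT hψ (fourier_eq_regularHat hs hlam hg)
    (hasDerivAt_regularHat hs hlam _ z) (continuous_regularHatDeriv hs hlam _ z) h₀ h₁ h₂
  rcases le_total T 1 with h1 | h1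
  · exact h1.trans (le_max_left _ _)
  · refine le_trans ?_ (le_max_right _ _)
    rw [le_div_iff₀ ha]
    have h2 : V ≤ |V| * T := (le_abs_self V).trans (le_mul_of_one_le_right (abs_nonneg V) h1)
    have h3 : D * T ≤ |D| * T := mul_le_mul_of_nonneg_right (le_abs_self D) hT.le
    refine le_of_mul_le_mul_right ?_ hT
    linarith

end FracDelta

end

/-! ### The main theorem -/

theorem theorem1 (s : ℝ) (hs : 1 / 2 < s) (hs1 : s ≤ 1) (σ β : ℝ) (hσ : 0 < σ) :
    -- the improper integral that defines the constant of the kernel converges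
    Tendsto (kernelTrunc s) atTop (𝓝 (kernelConst s)) ∧
    -- (i) local well-posedness, and well-posedness as long as the charge exists
    (∀ ψ₀ ∈ domain s σ β,
      (∃ T : ℝ, 0 < T ∧ ∃ (q : ℝ → ℂ) (ψ : ℝ → L2), WellPosedOn s σ β T ψ₀ q ψ) ∧
      (∀ T : ℝ, 0 < T → ∀ q : ℝ → ℂ, IsChargeSolution s σ β T ψ₀ q →
        ∃ ψ : ℝ → L2, WellPosedOn s σ β T ψ₀ q ψ)) ∧
    -- (ii) conservation laws
    (∀ ψ₀ ∈ domain s σ β, ∀ T : ℝ, 0 < T → ∀ ψ : ℝ → L2, IsStrongSolution s σ β T ψ₀ ψ →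
      ∀ t ∈ Set.Icc 0 T, mass (ψ t) = mass ψ₀ ∧ energy s σ β (ψ t) = energy s σ β ψ₀) ∧
    -- (iii) global well-posedness: defocusing and sub-critical focusing cases
    ((0 ≤ β ∨ (β < 0 ∧ σ < 2 * s - 1)) → ∀ ψ₀ ∈ domain s σ β,
      ∃ (q : ℝ → ℂ) (ψ : ℝ → L2), ∀ T : ℝ, 0 < T → WellPosedOn s σ β T ψ₀ q ψ) ∧
    -- (iii) global well-posedness: critical focusing case with small mass
    (β < 0 → σ = 2 * s - 1 → ∃ C : ℝ, 0 < C ∧ ∀ ψ₀ ∈ domain s σ β, mass ψ₀ < C →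
      ∃ (q : ℝ → ℂ) (ψ : ℝ → L2), ∀ T : ℝ, 0 < T → WellPosedOn s σ β T ψ₀ q ψ) ∧
    -- (iv) blow-up
    (β < 0 → 2 * s - 1 ≤ σ → ∀ ψ₀ ∈ domain s σ β,
      (∃ lam : ℝ, 0 < lam ∧ ∃ g : 𝓢(ℝ, ℂ), regularPart s σ β lam ψ₀ = g.toLp 2 volume) →
      energy s σ β ψ₀ < 0 →
      ∃ Tstar : ℝ, 0 < Tstar ∧ ∃ (q : ℝ → ℂ) (ψ : ℝ → L2),
        (∀ T : ℝ, 0 < T → T < Tstar → WellPosedOn s σ β T ψ₀ q ψ) ∧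
        limsup (fun t => ‖q t‖ₑ) (𝓝[<] Tstar) = ⊤) := by
  refine ⟨tendsto_kernelTrunc hs, fun ψ₀ hψ => ⟨?_, fun T hT q hq => ⟨_, hq.wellPosedOn hs hσ hT hψ⟩⟩,
    fun ψ₀ _ T _ ψ h t ht => h.conservation hs hσ ht, fun hβ ψ₀ hψ => ?_, fun hβ hσs => ?_, ?_⟩
  · obtain ⟨T, hT, q, hq⟩ := exists_local_charge hs hσ hψ
    exact ⟨T, hT, q, _, hq.wellPosedOn hs hσ hT hψ⟩
  · obtain ⟨B, hB⟩ := exists_value_bound hs hσ hβ (mass ψ₀) (energy s σ β ψ₀)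
    exact exists_global_of_bound hs hσ hψ hB
  · obtain ⟨C, hC, h⟩ := exists_critical_value_bound hs hβ hσs
    refine ⟨C, hC, fun ψ₀ hψ hM => ?_⟩
    obtain ⟨B, hB⟩ := h _ (energy s σ β ψ₀) hM
    exact exists_global_of_bound hs hσ hψ hB
  · intro hβ hσs ψ₀ hψ ⟨lam, hlam, g, hg⟩ hE
    obtain ⟨T₁, h⟩ := exists_time_bound hs hs1 hσ hβ hσs hψ hlam hg hE
    exact exists_blowup_of_bdd hs hσ hψ h
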